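/- \textbf{Domains.} Let $\Omega$ be one of the following: (a) the isosceles right triangle $\mathcal D=\{(x,y): 0<y<x<\pi\}$, with $\gamma(\Omega)=\sqrt2$; (b) for $n\ge 2$, the box $\mathcal B^{(n)}=\prod_{j=1}^n(0,\pi\gamma_n^{-(j-1)})$, with $\gamma(\Omega)=\gamma_n=2^{1/n}$. \textbf{Spectral quantities.} Consider the Dirichlet problem $-\Delta\varphi=\lambda\varphi$ in $\Omega$, $\varphi|_{\partial\Omega}=0$. Let $\underline N(\lambda)$ be the number of eigenvalues, counted with multiplicity, that are strictly smaller than $\lambda$, and let $N(\lambda)=\underline N(\lambda)+1$ if $\lambda$ is an eigenvalue, $N(\lambda)=\underline N(\lambda)$ otherwise. For a real eigenfunction $\varphi$ let $\nu(\varphi)$ be the number of connected components of $\Omega\setminus\varphi^{-1}(0)$. The nodal deficiency of an eigenfunction $\varphi$ with eigenvalue $\lambda$ is $\delta(\varphi)=N(\lambda)-\nu(\varphi)$, and the nodal deficiency of $\lambda$ is $\delta(\lambda)=\min_\varphi\delta(\varphi)$, over all eigenfunctions $\varphi\neq0$ with eigenvalue $\lambda$. The eigenvalue $\lambda$ is Courant-sharp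 if $\nu(\varphi)=N(\lambda)$ for some eigenfunction $\varphi$ with eigenvalue $\lambda$. \textbf{Quantum numbers.} For the triangle let $\mathcal Q=\{(m_1,m_2)\in\mathbb N^2: m_1>m_2\ge1\}$ and $\lambda_m=m_1^2+m_2^2$; call $m\in\mathcal Q$ even if $m_1\equiv m_2 \pmod 2$, and odd otherwise. For the box let $\mathcal Q=\{m\in\mathbb N^n: m_j\ge1 \text{ for all } j\}$ and $\lambda_m=\sum_{j=1}^n(\gamma_n^{j-1}m_j)^2$; call $m$ even if $m_1$ is even, and odd otherwise. Let $\mathcal E$ and $\mathcal O$ be the sets of even and odd $m\in\mathcal Q$, and $\sigma_{\mathrm{even}}(\Omega)=\{\lambda_m: m\in\mathcal E\}$ the set of even eigenvalues. Put $\mathcal Q(\lambda)=\{m\in\mathcal Q:\lambda_m<\lambda\}$, and let $\partial\mathcal Q(\lambda)$ be its right boundary, the set of $m\in\mathcal Q(\lambda)$ such that $(m_1+1,m_2,\dots)\notin\mathcal Q(\lambda)$. \textbf{Statement.} Let $\lambda\in\sigma_{\mathrm{even}}(\Omega)$. Then $\lambda$ and $\gamma(\Omega)^{-2}\lambda$ are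 Dirichlet eigenvalues of $\Omega$ whose nodal deficiencies are well defined (there are finitely many eigenvalues up to each of them, all of finite multiplicity; their eigenfunctions have finitely many nodal domains; and the minimum is attained), and $$\delta(\lambda)=2\,\delta\big(\gamma(\Omega)^{-2}\lambda\big)+|\partial\mathcal Q(\lambda)\cap\mathcal O|-1 .$$ Moreover $|\partial\mathcal Q(\lambda)\cap\mathcal O|\ge1$, and $|\partial\mathcal Q(\lambda)\cap\mathcal O|\ge2$ unless $\lambda$ is the smallest even eigenvalue of $\Omega$ or $(\Omega,\lambda)=(\mathcal B^{(2)},24)$. No even eigenvalue other than the smallest one is Courant-sharp. -/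

import Mathlib

noncomputable section

namespace RepTileNodal

/-! ### The Dirichlet eigenvalue problem on a domain of Euclidean space -/

section Spectral

variable {n : ℕ}

/-- The space of real solutions of `-Δ φ = μ φ` in `Ω`, `φ = 0` on the boundary of `Ω`: functions
that are twice continuously differentiable in `Ω` and continuous up to the boundary with boundary
value zero. Each of them is identified with its extension by zero outside `Ω`, which is a continuous
function on the whole space. -/
def eigenspace (Ω : Set (EuclideanSpace ℝ (Fin n))) (μ : ℝ) :
    Submodule ℝ (EuclideanSpace ℝ (Fin n) → ℝ) where
  carrier := {φ | Continuous φ ∧ (∀ x, x ∉ Ω → φ x = 0) ∧ (∀ x ∈ Ω, ContDiffAt ℝ 2 φ x) ∧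
    ∀ x ∈ Ω, -(Laplacian.laplacian φ x) = μ * φ x}
  zero_mem' := by
    refine ⟨continuous_const, fun _ _ => rfl, fun _ _ => contDiffAt_const, fun x _ => ?_⟩
    have h : Laplacian.laplacian (0 : EuclideanSpace ℝ (Fin n) → ℝ) = 0 :=
      InnerProductSpace.laplacian_const (c := (0 : ℝ))
    simp [h]
  add_mem' := by
    rintro φ ψ ⟨h1, h2, h3, h4⟩ ⟨k1, k2, k3, k4⟩
    refine ⟨h1.add k1, fun x hx => ?_, fun x hx => (h3 x hx).add (k3 x hx), fun x hx => ?_⟩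
    · simp [h2 x hx, k2 x hx]
    · rw [(h3 x hx).laplacian_add (k3 x hx), Pi.add_apply, mul_add, ← h4 x hx, ← k4 x hx]
      ring
  smul_mem' := by
    rintro c φ ⟨h1, h2, h3, h4⟩
    refine ⟨h1.const_smul c, fun x hx => ?_, fun x hx => (h3 x hx).const_smul c, fun x hx => ?_⟩
    · simp [h2 x hx]
    · rw [InnerProductSpace.laplacian_smul c (h3 x hx), Pi.smul_apply, smul_eq_mul, smul_eq_mul,
        mul_left_comm, ← h4 x hx]
      ring

/-- `φ` is a Dirichlet eigenfunction on `Ω` with eigenvalue `μ`. -/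
def IsEigenfunction (Ω : Set (EuclideanSpace ℝ (Fin n))) (μ : ℝ)
    (φ : EuclideanSpace ℝ (Fin n) → ℝ) : Prop :=
  φ ∈ eigenspace Ω μ ∧ φ ≠ 0

/-- `μ` is a Dirichlet eigenvalue of `Ω`. -/
def IsEigenvalue (Ω : Set (EuclideanSpace ℝ (Fin n))) (μ : ℝ) : Prop :=
  ∃ φ, IsEigenfunction Ω μ φ

/-- The multiplicity of `μ` (zero if `μ` is not an eigenvalue). -/
def multiplicity (Ω : Set (EuclideanSpace ℝ (Fin n))) (μ : ℝ) : ℕ :=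
  Module.finrank ℝ (eigenspace Ω μ)

/-- The number of eigenvalues strictly below `lam`, counted with multiplicity. -/
def lowerCount (Ω : Set (EuclideanSpace ℝ (Fin n))) (lam : ℝ) : ℕ :=
  ∑ᶠ (μ : ℝ) (_ : μ < lam), multiplicity Ω μ

open Classical in
/-- The counting function `N`; for an eigenvalue `lam` it is the smallest position of `lam` in the
nondecreasing list of eigenvalues. -/
def count (Ω : Set (EuclideanSpace ℝ (Fin n))) (lam : ℝ) : ℕ :=
  if IsEigenvalue Ω lam then lowerCount Ω lam + 1 else lowerCount Ω lam

/-- The set of nodal domains of `φ`: the connected components of `Ω` minus the zero set. -/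
abbrev NodalDomains (Ω : Set (EuclideanSpace ℝ (Fin n)))
    (φ : EuclideanSpace ℝ (Fin n) → ℝ) : Type :=
  ConnectedComponents {x : EuclideanSpace ℝ (Fin n) // x ∈ Ω ∧ φ x ≠ 0}

/-- The number of nodal domains of `φ`. -/
def nodalCount (Ω : Set (EuclideanSpace ℝ (Fin n))) (φ : EuclideanSpace ℝ (Fin n) → ℝ) : ℕ :=
  Nat.card (NodalDomains Ω φ)

/-- The nodal deficiency `N(lam) - ν(φ)` of an eigenfunction `φ` with eigenvalue `lam`. -/
def eigenfunctionDeficiency (Ω : Set (EuclideanSpace ℝ (Fin n))) (lam : ℝ)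
    (φ : EuclideanSpace ℝ (Fin n) → ℝ) : ℤ :=
  (count Ω lam : ℤ) - (nodalCount Ω φ : ℤ)

/-- The set of nodal deficiencies of all eigenfunctions with eigenvalue `lam`. -/
def deficiencySet (Ω : Set (EuclideanSpace ℝ (Fin n))) (lam : ℝ) : Set ℤ :=
  {d | ∃ φ, IsEigenfunction Ω lam φ ∧ eigenfunctionDeficiency Ω lam φ = d}

/-- The nodal deficiency of `lam`: the minimum of the deficiencies of its eigenfunctions. -/
def nodalDeficiency (Ω : Set (EuclideanSpace ℝ (Fin n))) (lam : ℝ) : ℤ :=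
  sInf (deficiencySet Ω lam)

/-- All quantities that enter the nodal deficiency of `lam` are meaningful: there are finitely many
eigenvalues up to `lam`, all of finite multiplicity, every eigenfunction with eigenvalue `lam` has
finitely many nodal domains, and the minimum that defines the deficiency is attained (in particular
`lam` is an eigenvalue). -/
structure DeficiencyWellDefined (Ω : Set (EuclideanSpace ℝ (Fin n))) (lam : ℝ) : Prop where
  finite_spectrum : {μ : ℝ | μ ≤ lam ∧ IsEigenvalue Ω μ}.Finite
  finite_multiplicity : ∀ μ ≤ lam, FiniteDimensional ℝ (eigenspace Ω μ)
  finite_nodalDomains : ∀ φ, IsEigenfunction Ω lam φ → Finite (NodalDomains Ω φ)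
  isLeast : IsLeast (deficiencySet Ω lam) (nodalDeficiency Ω lam)

/-- `lam` is a Courant-sharp eigenvalue. -/
def IsCourantSharp (Ω : Set (EuclideanSpace ℝ (Fin n))) (lam : ℝ) : Prop :=
  ∃ φ, IsEigenfunction Ω lam φ ∧ nodalCount Ω φ = count Ω lam

end Spectral

/-! ### The isosceles right triangle and the 2-rep-tile boxes -/

/-- The domains: the isosceles right triangle, and for every `n ≥ 2` the `n`-dimensional box. -/
inductive RepTile : Type
  | triangle : RepTile
  | box (n : ℕ) (hn : 2 ≤ n) : RepTile

namespace RepTile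

/-- The dimension. -/
def dim : RepTile → ℕ
  | triangle => 2
  | box n _ => n

/-- The scaling factor `γ`: `√2` for the triangle, `2 ^ (1 / n)` for the `n`-dimensional box. -/
def γ : RepTile → ℝ
  | triangle => Real.sqrt 2
  | box n _ => (2 : ℝ) ^ ((1 : ℝ) / (n : ℝ))

/-- The open domain: `{0 < y < x < π}`, or the box with edge lengths `π, π / γ, …, π / γ ^ (n - 1)`
(coordinates are numbered from zero). -/
def domain : (T : RepTile) → Set (EuclideanSpace ℝ (Fin T.dim))
  | triangle => {x : EuclideanSpace ℝ (Fin 2) | 0 < x 1 ∧ x 1 < x 0 ∧ x 0 < Real.pi}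
  | box n hn => {x : EuclideanSpace ℝ (Fin n) |
      ∀ j : Fin n, 0 < x j ∧ x j < Real.pi / (box n hn).γ ^ (j : ℕ)}

/-- The index of the first coordinate. -/
def first : (T : RepTile) → Fin T.dim
  | triangle => (0 : Fin 2)
  | box n hn => (⟨0, by omega⟩ : Fin n)

/-- The quantum numbers: pairs `m₁ > m₂ ≥ 1` for the triangle, `n`-tuples of positive integers for
the box. -/
def quantumNumbers : (T : RepTile) → Set (Fin T.dim → ℕ)
  | triangle => {m : Fin 2 → ℕ | 1 ≤ m 1 ∧ m 1 < m 0}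
  | box n _ => {m : Fin n → ℕ | ∀ j, 1 ≤ m j}

/-- The number `λ_m` that belongs to the quantum number `m`. -/
def eigenvalue : (T : RepTile) → (Fin T.dim → ℕ) → ℝ
  | triangle => fun m : Fin 2 → ℕ => (m 0 : ℝ) ^ 2 + (m 1 : ℝ) ^ 2
  | box n hn => fun m : Fin n → ℕ => ∑ j : Fin n, ((box n hn).γ ^ (j : ℕ) * (m j : ℝ)) ^ 2

/-- The even quantum numbers. -/
def evenNumbers : (T : RepTile) → Set (Fin T.dim → ℕ)
  | triangle => {m : Fin 2 → ℕ | m ∈ triangle.quantumNumbers ∧ m 0 ≡ m 1 [MOD 2]}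
  | box n hn => {m : Fin n → ℕ | m ∈ (box n hn).quantumNumbers ∧ m (box n hn).first ≡ 0 [MOD 2]}

/-- The odd quantum numbers. -/
def oddNumbers : (T : RepTile) → Set (Fin T.dim → ℕ)
  | triangle => {m : Fin 2 → ℕ | m ∈ triangle.quantumNumbers ∧ ¬ m 0 ≡ m 1 [MOD 2]}
  | box n hn => {m : Fin n → ℕ | m ∈ (box n hn).quantumNumbers ∧ m (box n hn).first ≡ 1 [MOD 2]}

/-- The set of even eigenvalues. -/
def evenSpectrum (T : RepTile) : Set ℝ :=
  T.eigenvalue '' T.evenNumbers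

/-- `Q(lam)`: the quantum numbers `m` with `λ_m < lam`. -/
def quantumNumbersBelow (T : RepTile) (lam : ℝ) : Set (Fin T.dim → ℕ) :=
  {m | m ∈ T.quantumNumbers ∧ T.eigenvalue m < lam}

/-- The right boundary of `A`: the points of `A` whose right neighbour (first entry increased by
one) is not in `A`. -/
def rightBoundary (T : RepTile) (A : Set (Fin T.dim → ℕ)) : Set (Fin T.dim → ℕ) :=
  {m | m ∈ A ∧ Function.update m T.first (m T.first + 1) ∉ A}

/-- The number of odd points in the right boundary of `Q(lam)`. -/
def oddBoundaryCount (T : RepTile) (lam : ℝ) : ℕ :=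
  (T.rightBoundary (T.quantumNumbersBelow lam) ∩ T.oddNumbers).ncard

end RepTile

end RepTileNodal

end

/-!
# Nodal deficiency of the isosceles right triangle and of the 2-rep-tile boxes

The spectrum of these domains is explicit: products of sines on the boxes, antisymmetrized products
of sines on the triangle. Each domain is the union of two congruent halves, which a reflection `R`
exchanges, and each half is similar to the whole domain with ratio `γ⁻¹`.

*Doubling.* If `λ` is an even eigenvalue, all quantum numbers with eigenvalue `λ` are even: on the
triangle this is the parity of `m₁² + m₂²`, on the boxes it follows from the integrality of `γ²`,
whose power of order `n` is `4` (`modEq_of_sum_eq`). Hence every eigenfunction for `λ` is odd under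
`R`, and its restriction to a half is a rescaled eigenfunction for `λ / γ²`; all eigenfunctions for
`λ / γ²` arise in this way. So the nodal domains double (`RepTiling.nodalCount_eq_two_mul`), and
`δ(λ) - 2 δ(λ / γ²) = N(λ) - 2 N(λ / γ²)` (`RepTiling.nodalDeficiency_eq`).

*Counting.* The quantum numbers below `λ / γ²` correspond to the even ones below `λ`. The shift
`m ↦ m + e₁` maps the odd quantum numbers below `λ` that are not on the right boundary bijectively
onto the even ones, so `N(λ) - 2 N(λ / γ²)` is the number of odd boundary points minus one
(`RepTile.ncard_quantumNumbersBelow`). The left neighbour of an even quantum number of `λ` is such a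
point.

*A second odd boundary point.* Boundary points are the ends of the rows in the direction of the first
coordinate, and one looks for a row, different from the given one, with an end of the right parity.
On the triangle the first five rows of a long staircase have length `k` or `k - 1`, which leaves no
room for fewer than two odd ends. On the boxes the rows are indexed by the remaining quantum numbers.
If the longest row, that of `(1, …, 1)`, has odd length, it serves; if its length `k` is even, a row
of length `k - 1` is found whose cost lies in a suitable window of width `2 k - 1`
(`exists_second_isOddEnd`). Short rows need separate arguments; in the plane they leave the exception
`λ = 24`.

*Courant's theorem.* The deficiencies are well defined and nonnegative by Courant's nodal domain
theorem, so that two odd boundary points make the deficiency positive; the exception `24` inherits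
positivity from the eigenvalue `12`. Courant's theorem is proved here without Sobolev spaces, for
domains with an explicit complete system of eigenfunctions (`DirichletSystem`). The members of the
system are eigenfunctions of all discrete Laplacians `Δ_h`, in the whole space. Summation by parts for
`Δ_h`, in which boundary terms disappear as `h → 0` because the functions are Lipschitz and vanish on
the boundary, replaces Green's formula: it yields orthogonality and, by way of dilations of a
classical eigenfunction, the fact that the eigenspaces are spanned by members of the system
(`DirichletSystem.mem_eigenspace_iff`). Completeness comes from the Stone–Weierstrass theorem
(`exists_mem_span_near`). The Dirichlet energy is the limit of the energies of the difference
quotients; a function that is constant multiples of an eigenfunction on its nodal domains has the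
energy one expects (`DirichletSystem.energy_piecewise_le`), and if it is orthogonal to the lower
eigenspaces it is an eigenfunction itself (`DirichletSystem.eq_sum_level_of_energy_le`), which is
impossible if it vanishes on one of the nodal domains.
-/

noncomputable section

namespace RepTileNodal

set_option linter.unusedSectionVars false

open MeasureTheory Filter Topology Set
open scoped NNReal

/-! ### Second differences -/

section SecondDifferences

variable {E : Type*} [NormedAddCommGroup E] [NormedSpace ℝ E]

/-- The second difference of `f` in direction `u`. -/
def secondDiff (u : E) (f : E → ℝ) (x : E) : ℝ := f (x + u) + f (x - u) - 2 * f x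

theorem exists_secondDiff_eq {ψ : E → ℝ} {x u : E}
    (hψ : ∀ t ∈ Icc (-1 : ℝ) 1, ContDiffAt ℝ 2 ψ (x + t • u)) :
    ∃ t ∈ Ioo (0 : ℝ) 1, secondDiff u ψ x =
      (iteratedFDeriv ℝ 2 ψ (x + t • u) ![u, u] + iteratedFDeriv ℝ 2 ψ (x - t • u) ![u, u]) / 2 := by
  have hline : ∀ (s t : ℝ), HasDerivAt (fun t : ℝ => x + (s * t) • u) (s • u) t := by
    intro s t
    have h1 : HasDerivAt (fun t : ℝ => s * t) s t := by
      simpa using (hasDerivAt_id t).const_mul s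
    simpa using (h1.smul_const u).const_add x
  have hd1 : ∀ s t : ℝ, s * t ∈ Icc (-1 : ℝ) 1 →
      HasDerivAt (fun t : ℝ => ψ (x + (s * t) • u)) (s * fderiv ℝ ψ (x + (s * t) • u) u) t := by
    intro s t hst
    have h1 := ((hψ _ hst).differentiableAt (by norm_num)).hasFDerivAt
    exact (h1.comp_hasDerivAt t (hline s t)).congr_deriv (by simp)
  have hd2 : ∀ s t : ℝ, s * t ∈ Icc (-1 : ℝ) 1 →
      HasDerivAt (fun t : ℝ => s * fderiv ℝ ψ (x + (s * t) • u) u)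
        (s * (s * iteratedFDeriv ℝ 2 ψ (x + (s * t) • u) ![u, u])) t := by
    intro s t hst
    have h0 : ContDiffAt ℝ 1 (fderiv ℝ ψ) (x + (s * t) • u) :=
      (hψ _ hst).fderiv_right (by norm_num)
    have h1 := (h0.differentiableAt (by norm_num)).hasFDerivAt
    have h2 : HasDerivAt (fun t : ℝ => fderiv ℝ ψ (x + (s * t) • u) u)
        (fderiv ℝ (fderiv ℝ ψ) (x + (s * t) • u) (s • u) u) t :=
      (ContinuousLinearMap.apply ℝ ℝ u).hasFDerivAt.comp_hasDerivAt t
        (h1.comp_hasDerivAt t (hline s t))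
    refine (h2.const_mul s).congr_deriv ?_
    rw [iteratedFDeriv_two_apply, map_smul, smul_apply, smul_eq_mul]
    rfl
  have hmem : ∀ s : ℝ, (s = 1 ∨ s = -1) → ∀ t ∈ Icc (0 : ℝ) 1, s * t ∈ Icc (-1 : ℝ) 1 := by
    rintro s (rfl | rfl) t ⟨h0, h1⟩ <;> constructor <;> linarith
  have hG1 : ∀ t ∈ Icc (0 : ℝ) 1, HasDerivAt
      (fun t : ℝ => ψ (x + ((1 : ℝ) * t) • u) + ψ (x + ((-1 : ℝ) * t) • u))
      (1 * fderiv ℝ ψ (x + ((1 : ℝ) * t) • u) u + (-1) * fderiv ℝ ψ (x + ((-1 : ℝ) * t) • u) u) t :=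
    fun t ht => (hd1 1 t (hmem 1 (Or.inl rfl) t ht)).add (hd1 (-1) t (hmem (-1) (Or.inr rfl) t ht))
  have hG2 := fun (t : ℝ) (ht : t ∈ Icc (0 : ℝ) 1) =>
    (hd2 1 t (hmem 1 (Or.inl rfl) t ht)).add (hd2 (-1) t (hmem (-1) (Or.inr rfl) t ht))
  -- Cauchy's mean value theorem against `t ^ 2`, then the mean value theorem for the derivative.
  obtain ⟨c, hc, hc'⟩ := exists_ratio_hasDerivAt_eq_ratio_slope _ _ (zero_lt_one' ℝ)
    (fun t ht => (hG1 t ht).continuousAt.continuousWithinAt)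
    (fun t ht => hG1 t (Ioo_subset_Icc_self ht)) (fun t : ℝ => t ^ 2) (fun t => 2 * t)
    (by fun_prop) (fun t _ => by simpa using hasDerivAt_pow 2 t)
  obtain ⟨d, hd, hd'⟩ := exists_hasDerivAt_eq_slope _ _ hc.1
    (fun t ht => (hG2 t ⟨ht.1, ht.2.trans hc.2.le⟩).continuousAt.continuousWithinAt)
    (fun t ht => hG2 t ⟨ht.1.le, ht.2.le.trans hc.2.le⟩)
  refine ⟨d, ⟨hd.1, hd.2.trans hc.2⟩, ?_⟩
  have hc0 : c ≠ 0 := hc.1.ne'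
  simp only [one_mul, neg_mul, mul_neg, neg_neg, one_smul, neg_smul, mul_zero, zero_smul,
    neg_zero, add_zero, Pi.add_apply, sub_zero] at hc' hd'
  rw [eq_div_iff hc0] at hd'
  simp only [← sub_eq_add_neg] at hc' hd'
  simp only [secondDiff]
  have : (2 * c) * (ψ (x + u) + ψ (x - u) - 2 * ψ x) = (2 * c) *
      ((iteratedFDeriv ℝ 2 ψ (x + d • u) ![u, u] + iteratedFDeriv ℝ 2 ψ (x - d • u) ![u, u]) / 2) := by
    linarith
  exact mul_left_cancel₀ (by positivity) this

/-- On compact sets, second difference quotients converge uniformly to second derivatives. -/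
theorem eventually_abs_secondDiff_sub_le {ψ : E → ℝ} {U K : Set E} (hU : IsOpen U)
    (hψ : ∀ x ∈ U, ContDiffAt ℝ 2 ψ x) (hK : IsCompact K) (hKU : K ⊆ U) [ProperSpace E]
    (e : E) {ε : ℝ} (hε : 0 < ε) :
    ∀ᶠ h : ℝ in 𝓝[≠] 0, ∀ x ∈ K,
      |secondDiff (h • e) ψ x / h ^ 2 - iteratedFDeriv ℝ 2 ψ x ![e, e]| ≤ ε := by
  obtain ⟨r, hr, hrU⟩ := hK.exists_cthickening_subset_open hU hKU
  have hK' : IsCompact (Metric.cthickening r K) := hK.cthickening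
  have hcont : ContinuousOn (fun x => iteratedFDeriv ℝ 2 ψ x ![e, e]) (Metric.cthickening r K) := by
    intro x hx
    have h1 : ContDiffAt ℝ 0 (iteratedFDeriv ℝ 2 ψ) x :=
      (hψ x (hrU hx)).iteratedFDeriv_right (by norm_num)
    have h2 : ContinuousAt (fun x => iteratedFDeriv ℝ 2 ψ x ![e, e]) x :=
      (ContinuousMultilinearMap.apply ℝ (fun _ : Fin 2 => E) ℝ
        ![e, e]).continuous.continuousAt.comp h1.continuousAt
    exact h2.continuousWithinAt
  obtain ⟨δ, hδ, hδ'⟩ := Metric.uniformContinuousOn_iff.1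
    (hK'.uniformContinuousOn_of_continuous hcont) ε hε
  have hpos : 0 < min r δ / (‖e‖ + 1) := by positivity
  have hev : ∀ᶠ h : ℝ in 𝓝[≠] 0, |h| < min r δ / (‖e‖ + 1) := by
    refine nhdsWithin_le_nhds ?_
    filter_upwards [Metric.ball_mem_nhds (0 : ℝ) hpos] with h hh
    simpa [Real.dist_eq] using hh
  filter_upwards [hev, self_mem_nhdsWithin] with h hh hne x hx
  have hh0 : (h : ℝ) ≠ 0 := hne
  have hnorm : ‖h • e‖ < min r δ := by
    rw [norm_smul, Real.norm_eq_abs]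
    have h1 := (lt_div_iff₀ (by positivity)).1 hh
    nlinarith [abs_nonneg h, norm_nonneg e]
  have hmem : ∀ t ∈ Icc (-1 : ℝ) 1, x + t • h • e ∈ Metric.cthickening r K ∧
      dist (x + t • h • e) x < δ := by
    intro t ht
    have h2 : dist (x + t • h • e) x < min r δ := by
      rw [dist_self_add_left, norm_smul, Real.norm_eq_abs]
      have : |t| ≤ 1 := abs_le.2 ht
      nlinarith [abs_nonneg t, norm_nonneg (h • e)]
    exact ⟨Metric.mem_cthickening_of_dist_le _ x _ _ hx (h2.le.trans (min_le_left _ _)),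
      h2.trans_le (min_le_right _ _)⟩
  obtain ⟨t, ht, heq⟩ := exists_secondDiff_eq (fun t ht => hψ _ (hrU (hmem t ht).1))
  have hhom : ∀ y, iteratedFDeriv ℝ 2 ψ y ![h • e, h • e] =
      h ^ 2 * iteratedFDeriv ℝ 2 ψ y ![e, e] := by
    intro y
    rw [iteratedFDeriv_two_apply, iteratedFDeriv_two_apply]
    simp
    ring
  have hx0 : x ∈ Metric.cthickening r K := Metric.self_subset_cthickening _ hx
  have ha := hmem t ⟨by linarith [ht.1], ht.2.le⟩
  have hb := hmem (-t) ⟨by linarith [ht.2], by linarith [ht.1]⟩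
  rw [neg_smul, ← sub_eq_add_neg] at hb
  have ha' := hδ' _ ha.1 _ hx0 ha.2
  have hb' := hδ' _ hb.1 _ hx0 hb.2
  rw [heq, hhom, hhom, show ∀ a b : ℝ, (h ^ 2 * a + h ^ 2 * b) / 2 / h ^ 2 = (a + b) / 2 by
    intro a b; field_simp]
  rw [Real.dist_eq, abs_lt] at ha' hb'
  rw [abs_le]
  constructor <;> linarith [ha'.1, ha'.2, hb'.1, hb'.2]

end SecondDifferences

/-! ### Convex domains: boundary strips -/

section Strips

variable {E : Type*} [NormedAddCommGroup E] [NormedSpace ℝ E]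

theorem exists_mem_segment_mem_frontier {s : Set E} {x y : E} (hx : x ∈ s) (hy : y ∉ s) :
    ∃ z ∈ segment ℝ x y, z ∈ frontier s := by
  by_contra! hcon
  have hpre : IsPreconnected (segment ℝ x y) := (convex_segment x y).isPreconnected
  obtain ⟨z, -, hz1, hz2⟩ := hpre (interior s) (closure s)ᶜ isOpen_interior
    isClosed_closure.isOpen_compl
    (fun z hz => by
      by_contra hcon'
      simp only [mem_union, mem_compl_iff, not_or, not_not] at hcon'
      exact hcon z hz ⟨hcon'.2, hcon'.1⟩)
    ⟨x, left_mem_segment ℝ x y, by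
      by_contra hxi
      exact hcon x (left_mem_segment ℝ x y) ⟨subset_closure hx, hxi⟩⟩
    ⟨y, right_mem_segment ℝ x y, fun hyc =>
      hcon y (right_mem_segment ℝ x y) ⟨hyc, fun hyi => hy (interior_subset hyi)⟩⟩
  exact hz2 (interior_subset_closure hz1)

theorem dist_le_of_mem_segment {x y z : E} (hz : z ∈ segment ℝ x y) :
    dist x z ≤ dist x y ∧ dist y z ≤ dist x y := by
  have h := dist_add_dist_of_mem_segment hz
  have h1 := dist_nonneg (x := x) (y := z)
  have h2 := dist_nonneg (x := z) (y := y)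
  rw [dist_comm z y] at h h2
  constructor <;> linarith

variable [MeasurableSpace E] [BorelSpace E] [FiniteDimensional ℝ E] (μ : Measure E)
  [μ.IsAddHaarMeasure]

/-- The part of a bounded convex open set that leaves it under translation by `u` has measure
`O(‖u‖)`: a homothetic copy of ratio `1 - ‖u‖ / ρ` stays inside. -/
theorem exists_measureReal_translate_diff_le {Ω : Set E} (hconv : Convex ℝ Ω) (hopen : IsOpen Ω)
    (hbdd : Bornology.IsBounded Ω) :
    ∃ C : ℝ, 0 ≤ C ∧ ∀ u : E, μ.real {x | x ∈ Ω ∧ x + u ∉ Ω} ≤ C * ‖u‖ := by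
  rcases Ω.eq_empty_or_nonempty with rfl | ⟨p, hp⟩
  · exact ⟨0, le_rfl, fun u => by simp⟩
  obtain ⟨ρ, hρ, hball⟩ := Metric.nhds_basis_closedBall.mem_iff.1 (hopen.mem_nhds hp)
  have hfin : μ Ω ≠ ⊤ := hbdd.measure_lt_top.ne
  set d := Module.finrank ℝ E
  refine ⟨(d + 1) * μ.real Ω / ρ, by positivity, fun u => ?_⟩
  have hsub0 : {x | x ∈ Ω ∧ x + u ∉ Ω} ⊆ Ω := fun x hx => hx.1
  set t : ℝ := ‖u‖ / ρ with ht
  have ht0 : 0 ≤ t := by positivity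
  have hCt : (d + 1) * μ.real Ω / ρ * ‖u‖ = (d + 1) * t * μ.real Ω := by
    rw [ht]; field_simp
  rw [hCt]
  have hΩ0 : 0 ≤ μ.real Ω := measureReal_nonneg
  rcases le_or_gt 1 t with h1 | h1
  · refine (measureReal_mono hsub0 hfin).trans ?_
    have : (1 : ℝ) ≤ (d + 1) * t := by nlinarith [(Nat.cast_nonneg d : (0 : ℝ) ≤ d)]
    nlinarith
  set S := AffineMap.homothety p (1 - t) '' Ω with hS
  have hSΩ : S ⊆ Ω := by
    rintro _ ⟨x, hx, rfl⟩
    have : AffineMap.homothety p (1 - t) x = (1 - t) • x + t • p := by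
      simp [AffineMap.homothety_apply]; module
    rw [this]
    exact hconv hx hp (by linarith) ht0 (by ring)
  have hSu : ∀ x ∈ S, x + u ∈ Ω := by
    rintro _ ⟨x, hx, rfl⟩
    have hw : p + t⁻¹ • u ∈ Ω := by
      apply hball
      rw [Metric.mem_closedBall, dist_self_add_left, norm_smul, norm_inv, Real.norm_of_nonneg ht0]
      rcases eq_or_ne u 0 with rfl | hu
      · simp [hρ.le]
      · have : ‖u‖ ≠ 0 := norm_ne_zero_iff.2 hu
        rw [ht]
        field_simp
        exact le_rfl
    have : AffineMap.homothety p (1 - t) x + u = (1 - t) • x + t • (p + t⁻¹ • u) := by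
      have htu : t • t⁻¹ • u = u := by
        rcases eq_or_ne u 0 with rfl | hu
        · simp
        · have : t ≠ 0 := by
            have : ‖u‖ ≠ 0 := norm_ne_zero_iff.2 hu
            positivity
          rw [smul_smul, mul_inv_cancel₀ this, one_smul]
      rw [smul_add, htu]
      simp [AffineMap.homothety_apply]; module
    rw [this]
    exact hconv hx hw (by linarith) ht0 (by ring)
  have hsub : {x | x ∈ Ω ∧ x + u ∉ Ω} ⊆ Ω \ S := fun x hx => ⟨hx.1, fun hxS => hx.2 (hSu x hxS)⟩
  have hSmeas : MeasurableSet S := by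
    have hopenS : IsOpen S := by
      have h0 : (1 - t) ≠ 0 := by linarith
      exact AffineMap.homothety_isOpenMap p _ h0 _ hopen
    exact hopenS.measurableSet
  have hSval : μ.real S = (1 - t) ^ d * μ.real Ω := by
    rw [hS, measureReal_def, Measure.addHaar_image_homothety, ENNReal.toReal_mul,
      ENNReal.toReal_ofReal (abs_nonneg _), abs_of_nonneg (by
        have : 0 ≤ 1 - t := by linarith
        positivity), measureReal_def]
  have hbern : 1 + (d : ℝ) * (-t) ≤ (1 + (-t)) ^ d := one_add_mul_le_pow (by linarith) d
  calc μ.real {x | x ∈ Ω ∧ x + u ∉ Ω} ≤ μ.real (Ω \ S) :=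
        measureReal_mono hsub (ne_top_of_le_ne_top hfin (measure_mono sdiff_subset))
    _ = μ.real Ω - μ.real S := measureReal_sdiff hSΩ hSmeas hfin
    _ ≤ (d + 1) * t * μ.real Ω := by
        rw [hSval]
        have : 1 - (1 - t) ^ d ≤ (d + 1) * t := by
          rw [← sub_eq_add_neg] at hbern
          linarith
        nlinarith

end Strips

/-! ### Difference quotients of functions cut off at the boundary -/

section CutOff

variable {E : Type*} [NormedAddCommGroup E] [NormedSpace ℝ E]

theorem abs_le_of_mem_of_notMem {Ω : Set E} {f : E → ℝ} {L : ℝ≥0} (hf : LipschitzWith L f)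
    (hf0 : ∀ x ∈ frontier Ω, f x = 0) {x y : E} (hx : x ∈ Ω) (hy : y ∉ Ω) :
    |f x| ≤ L * dist x y ∧ |f y| ≤ L * dist x y := by
  obtain ⟨z, hz, hzf⟩ := exists_mem_segment_mem_frontier hx hy
  have h0 := hf0 z hzf
  have h1 := hf.dist_le_mul x z
  have h2 := hf.dist_le_mul y z
  rw [h0, Real.dist_0_eq_abs] at h1 h2
  have h3 := dist_le_of_mem_segment hz
  exact ⟨h1.trans (by gcongr; exact h3.1), h2.trans (by gcongr; exact h3.2)⟩

theorem lipschitzWith_indicator {Ω : Set E} {f : E → ℝ} {L : ℝ≥0} (hf : LipschitzWith L f)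
    (hf0 : ∀ x ∈ frontier Ω, f x = 0) : LipschitzWith L (Ω.indicator f) := by
  refine LipschitzWith.of_dist_le_mul fun x y => ?_
  by_cases hx : x ∈ Ω <;> by_cases hy : y ∈ Ω
  · simpa [hx, hy] using hf.dist_le_mul x y
  · simpa [hx, hy] using (abs_le_of_mem_of_notMem hf hf0 hx hy).1
  · rw [dist_comm, dist_comm x y]
    simpa [hx, hy] using (abs_le_of_mem_of_notMem hf hf0 hy hx).1
  · simp [hx, hy]; positivity

theorem hasCompactSupport_of_eq_zero [ProperSpace E] {Ω : Set E} (hbdd : Bornology.IsBounded Ω)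
    {f : E → ℝ} (hf : ∀ x, x ∉ Ω → f x = 0) : HasCompactSupport f :=
  HasCompactSupport.intro hbdd.isCompact_closure fun x hx => hf x fun h => hx (subset_closure h)

theorem continuous_secondDiff {f : E → ℝ} (hf : Continuous f) (u : E) :
    Continuous (secondDiff u f) := by
  unfold secondDiff
  fun_prop

variable [MeasurableSpace E] [BorelSpace E] [FiniteDimensional ℝ E] (μ : Measure E)
  [μ.IsAddHaarMeasure]

theorem integrable_mul_of_continuous {f g : E → ℝ} (hf : Continuous f) (hg : Continuous g)
    (hg' : HasCompactSupport g) : Integrable (fun x => g x * f x) μ :=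
  (hg.mul hf).integrable_of_hasCompactSupport hg'.mul_right

/-- Summation by parts. -/
theorem integral_mul_secondDiff_comm {f g : E → ℝ} (hf : Continuous f) (hg : Continuous g)
    (hg' : HasCompactSupport g) (u : E) :
    ∫ x, g x * secondDiff u f x ∂μ = ∫ x, f x * secondDiff u g x ∂μ := by
  have key : ∀ v : E, ∫ x, g x * f (x + v) ∂μ = ∫ x, f x * g (x - v) ∂μ := fun v => by
    rw [← integral_add_right_eq_self (fun x => f x * g (x - v)) v]
    simp [mul_comm]
  have hi : ∀ v : E, Integrable (fun x => g x * f (x + v)) μ := fun v =>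
    integrable_mul_of_continuous μ (by fun_prop) hg hg'
  have hi' : ∀ v : E, Integrable (fun x => f x * g (x + v)) μ := fun v => by
    have h1 : HasCompactSupport fun x => g (x + v) := hg'.comp_homeomorph (Homeomorph.addRight v)
    simpa [mul_comm] using integrable_mul_of_continuous μ hf
      (show Continuous fun x => g (x + v) by fun_prop) h1
  have e1 := key u
  have e2 := key (-u)
  have i1 := hi u
  have i2 := hi (-u)
  have i3 := hi 0
  have j1 := hi' u
  have j2 := hi' (-u)
  have j3 := hi' 0
  simp only [← sub_eq_add_neg, sub_neg_eq_add, add_zero] at *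
  have h1 : ∫ x, g x * secondDiff u f x ∂μ =
      ∫ x, g x * f (x + u) ∂μ + ∫ x, g x * f (x - u) ∂μ - 2 * ∫ x, g x * f x ∂μ := by
    rw [← integral_add' i1 i2, ← integral_const_mul, ← integral_sub (i1.add i2) (i3.const_mul 2)]
    refine integral_congr_ae (ae_of_all _ fun x => ?_)
    simp only [secondDiff, Pi.add_apply]; ring
  have h2 : ∫ x, f x * secondDiff u g x ∂μ =
      ∫ x, f x * g (x + u) ∂μ + ∫ x, f x * g (x - u) ∂μ - 2 * ∫ x, f x * g x ∂μ := by
    rw [← integral_add' j1 j2, ← integral_const_mul, ← integral_sub (j1.add j2) (j3.const_mul 2)]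
    refine integral_congr_ae (ae_of_all _ fun x => ?_)
    simp only [secondDiff, Pi.add_apply]; ring
  rw [h1, h2, e1, e2]
  simp only [mul_comm (g _) (f _)]
  ring

/-- Cutting `f` off outside `Ω` changes its second differences, tested against `g`, only through a
boundary strip of width `‖u‖`, where `f` is of size `‖u‖`. -/
theorem exists_abs_integral_mul_secondDiff_indicator_sub_le {Ω : Set E} (hconv : Convex ℝ Ω)
    (hopen : IsOpen Ω) (hbdd : Bornology.IsBounded Ω) {f : E → ℝ} {L : ℝ≥0}
    (hf : LipschitzWith L f) (hf0 : ∀ x ∈ frontier Ω, f x = 0) :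
    ∃ C : ℝ, 0 ≤ C ∧ ∀ (u : E) (g : E → ℝ) (ε : ℝ), Continuous g → HasCompactSupport g → 0 ≤ ε →
      (∀ x y, dist x y ≤ ‖u‖ → x ∈ Ω → y ∉ Ω → |g x| ≤ ε ∧ |g y| ≤ ε) →
      |∫ x, g x * secondDiff u (Ω.indicator f) x ∂μ - ∫ x in Ω, g x * secondDiff u f x ∂μ| ≤
        C * ε * ‖u‖ ^ 2 := by
  obtain ⟨C, hC0, hC⟩ := exists_measureReal_translate_diff_le μ hconv hopen hbdd
  refine ⟨4 * C * L, by positivity, fun u g ε hg hg' hε hstrip => ?_⟩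
  have hfin : μ Ω ≠ ⊤ := hbdd.measure_lt_top.ne
  have hvc : Continuous (Ω.indicator f) := (lipschitzWith_indicator hf hf0).continuous
  -- `out v` is the set of points that leave `Ω` under translation by `v`.
  set out : E → Set E := fun v => {x | x ∈ Ω ∧ x + v ∉ Ω} with hout
  have houtm : ∀ v, MeasurableSet (out v) := fun v =>
    hopen.measurableSet.inter ((hopen.preimage (continuous_add_const v)).measurableSet.compl)
  have houtfin : ∀ v, μ (out v) ≠ ⊤ := fun v =>
    ne_top_of_le_ne_top hfin (measure_mono fun x hx => hx.1)
  set bad : E → E → ℝ := fun v x =>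
    (out v).indicator (fun _ => (1 : ℝ)) x + (out (-v)).indicator (fun _ => (1 : ℝ)) (x + v)
    with hbad
  have hint1 : ∀ v, Integrable ((out v).indicator fun _ => (1 : ℝ)) μ := fun v =>
    (integrable_indicator_iff (houtm v)).2 (integrableOn_const (houtfin v))
  have hbadint : ∀ v, Integrable (bad v) μ := fun v =>
    (hint1 v).add ((hint1 (-v)).comp_add_right v)
  have hbadle : ∀ v, ∫ x, bad v x ∂μ ≤ 2 * (C * ‖v‖) := by
    intro v
    have h1 := hC v
    have h2 := hC (-v)
    rw [norm_neg] at h2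
    simp only [hbad]
    rw [integral_add (hint1 v) ((hint1 (-v)).comp_add_right v),
      integral_add_right_eq_self (fun x => (out (-v)).indicator (fun _ => (1 : ℝ)) x) v,
      integral_indicator_const _ (houtm v), integral_indicator_const _ (houtm (-v))]
    simp only [smul_eq_mul, mul_one]
    linarith
  have hone : ∀ v, ‖v‖ = ‖u‖ → ∀ x,
      |g x * (Ω.indicator f (x + v) - Ω.indicator (fun x => f (x + v)) x)| ≤
        ε * (L * ‖u‖) * bad v x := by
    intro v hv x
    have hd : dist x (x + v) = ‖u‖ := by rw [dist_self_add_right, hv]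
    have hb0 : 0 ≤ bad v x := add_nonneg (indicator_nonneg (fun _ _ => zero_le_one) _)
      (indicator_nonneg (fun _ _ => zero_le_one) _)
    by_cases hx : x ∈ Ω <;> by_cases hxv : x + v ∈ Ω
    · simp only [indicator_of_mem hx, indicator_of_mem hxv, sub_self, mul_zero, abs_zero]
      positivity
    · have hb : 1 ≤ bad v x := by
        have h1 : x ∈ out v := ⟨hx, hxv⟩
        simp only [hbad, indicator_of_mem h1]
        linarith [indicator_nonneg (fun _ _ => zero_le_one) (x + v) (s := out (-v))
          (f := fun _ => (1 : ℝ))]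
      have h2 := (abs_le_of_mem_of_notMem hf hf0 hx hxv).2
      have h3 := (hstrip x (x + v) hd.le hx hxv).1
      rw [hd] at h2
      rw [indicator_of_mem hx, indicator_of_notMem hxv, zero_sub, abs_mul, abs_neg]
      calc |g x| * |f (x + v)| ≤ ε * (L * ‖u‖) := by gcongr
        _ ≤ ε * (L * ‖u‖) * bad v x := le_mul_of_one_le_right (by positivity) hb
    · have hb : 1 ≤ bad v x := by
        have h1 : x + v ∈ out (-v) := ⟨hxv, by simpa using hx⟩
        simp only [hbad, indicator_of_mem h1]
        linarith [indicator_nonneg (fun _ _ => zero_le_one) x (s := out v)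
          (f := fun _ => (1 : ℝ))]
      have h2 := (abs_le_of_mem_of_notMem hf hf0 hxv hx).1
      have h3 := (hstrip (x + v) x (by rw [dist_comm, hd]) hxv hx).2
      rw [dist_comm, hd] at h2
      rw [indicator_of_mem hxv, indicator_of_notMem hx, sub_zero, abs_mul]
      calc |g x| * |f (x + v)| ≤ ε * (L * ‖u‖) := by gcongr
        _ ≤ ε * (L * ‖u‖) * bad v x := le_mul_of_one_le_right (by positivity) hb
    · simp only [indicator_of_notMem hx, indicator_of_notMem hxv, sub_self, mul_zero, abs_zero]
      positivity
  have hi1 : Integrable (fun x => g x * secondDiff u (Ω.indicator f) x) μ :=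
    integrable_mul_of_continuous μ (continuous_secondDiff hvc u) hg hg'
  have hi2 : Integrable (Ω.indicator fun x => g x * secondDiff u f x) μ :=
    (integrable_mul_of_continuous μ (continuous_secondDiff hf.continuous u) hg hg').indicator
      hopen.measurableSet
  rw [← integral_indicator hopen.measurableSet, ← integral_sub hi1 hi2, ← Real.norm_eq_abs]
  have hneg : ‖-u‖ = ‖u‖ := norm_neg u
  refine (norm_integral_le_of_norm_le
    (((hbadint u).add (hbadint (-u))).const_mul (ε * (L * ‖u‖))) (ae_of_all _ fun x => ?_)).trans ?_
  · have h1 := hone u rfl x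
    have h2 := hone (-u) hneg x
    rw [Real.norm_eq_abs]
    have heq : g x * secondDiff u (Ω.indicator f) x - Ω.indicator (fun x => g x * secondDiff u f x) x
        = g x * (Ω.indicator f (x + u) - Ω.indicator (fun x => f (x + u)) x) +
          g x * (Ω.indicator f (x + -u) - Ω.indicator (fun x => f (x + -u)) x) := by
      by_cases hx : x ∈ Ω
      · simp only [secondDiff, indicator_of_mem hx, sub_eq_add_neg]; ring
      · simp only [secondDiff, indicator_of_notMem hx, sub_eq_add_neg]; ring
    rw [heq]
    refine (abs_add_le _ _).trans ?_
    rw [Pi.add_apply, mul_add]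
    exact add_le_add h1 h2
  · rw [integral_const_mul, integral_add' (hbadint u) (hbadint (-u))]
    have h1 := hbadle u
    have h2 := hbadle (-u)
    rw [hneg] at h2
    calc ε * (L * ‖u‖) * (∫ x, bad u x ∂μ + ∫ x, bad (-u) x ∂μ)
        ≤ ε * (L * ‖u‖) * (2 * (C * ‖u‖) + 2 * (C * ‖u‖)) := by gcongr
      _ = 4 * C * L * ε * ‖u‖ ^ 2 := by ring

end CutOff

section DiffQuot

variable {E : Type*} [NormedAddCommGroup E] [NormedSpace ℝ E] {κ : Type*} [Fintype κ]

/-- The sum of the second difference quotients with step `h` in the directions `e k`. For an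
orthonormal basis this is the discrete Laplacian. -/
def diffQuot (e : κ → E) (h : ℝ) (f : E → ℝ) (x : E) : ℝ := (∑ k, secondDiff (h • e k) f x) / h ^ 2

/-- `f` is an eigenfunction of all difference quotients along `e`, with eigenvalues that tend to
`-a` as the step tends to zero. -/
def IsDiffEigen (e : κ → E) (f : E → ℝ) (a : ℝ) : Prop :=
  ∃ r : ℝ → ℝ, Tendsto r (𝓝[≠] 0) (𝓝 a) ∧ ∀ h ≠ 0, ∀ x, diffQuot e h f x = -r h * f x

theorem continuous_diffQuot {f : E → ℝ} (hf : Continuous f) (e : κ → E) (h : ℝ) :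
    Continuous (diffQuot e h f) :=
  (continuous_finsetSum _ fun _ _ => continuous_secondDiff hf _).div_const _

variable [MeasurableSpace E] [BorelSpace E] [FiniteDimensional ℝ E] (μ : Measure E)
  [μ.IsAddHaarMeasure]

theorem integral_mul_diffQuot {f g : E → ℝ} (hf : Continuous f) (hg : Continuous g)
    (hg' : HasCompactSupport g) (e : κ → E) (h : ℝ) :
    ∫ x, g x * diffQuot e h f x ∂μ = (∑ k, ∫ x, g x * secondDiff (h • e k) f x ∂μ) / h ^ 2 := by
  rw [← integral_finsetSum _ fun _ _ =>
    integrable_mul_of_continuous μ (continuous_secondDiff hf _) hg hg', ← integral_div]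
  refine integral_congr_ae (ae_of_all _ fun x => ?_)
  simp only [diffQuot]
  rw [← mul_div_assoc, Finset.mul_sum]

theorem integral_mul_diffQuot_comm {f g : E → ℝ} (hf : Continuous f) (hg : Continuous g)
    (hf' : HasCompactSupport f) (hg' : HasCompactSupport g) (e : κ → E) (h : ℝ) :
    ∫ x, g x * diffQuot e h f x ∂μ = ∫ x, f x * diffQuot e h g x ∂μ := by
  rw [integral_mul_diffQuot μ hf hg hg', integral_mul_diffQuot μ hg hf hf']
  simp only [integral_mul_secondDiff_comm μ hf hg hg']

theorem exists_abs_integral_mul_diffQuot_indicator_add_le {Ω : Set E} (hconv : Convex ℝ Ω)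
    (hopen : IsOpen Ω) (hbdd : Bornology.IsBounded Ω) {f : E → ℝ} {L : ℝ≥0}
    (hf : LipschitzWith L f) (hf0 : ∀ x ∈ frontier Ω, f x = 0) {e : κ → E} (he : ∀ k, ‖e k‖ = 1)
    {r : ℝ → ℝ} (hr : ∀ h ≠ 0, ∀ x, diffQuot e h f x = -r h * f x) :
    ∃ C : ℝ, 0 ≤ C ∧ ∀ (h : ℝ) (g : E → ℝ) (ε : ℝ), h ≠ 0 → Continuous g → HasCompactSupport g →
      0 ≤ ε → (∀ x y, dist x y ≤ |h| → x ∈ Ω → y ∉ Ω → |g x| ≤ ε ∧ |g y| ≤ ε) →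
      |∫ x, g x * diffQuot e h (Ω.indicator f) x ∂μ + r h * ∫ x, g x * Ω.indicator f x ∂μ| ≤
        C * ε := by
  obtain ⟨C, _, hC⟩ :=
    exists_abs_integral_mul_secondDiff_indicator_sub_le μ hconv hopen hbdd hf hf0
  refine ⟨Fintype.card κ * C, by positivity, fun h g ε hh hg hg' hε hstrip => ?_⟩
  have hnorm : ∀ k, ‖h • e k‖ = |h| := fun k => by rw [norm_smul, he, mul_one, Real.norm_eq_abs]
  have hvc : Continuous (Ω.indicator f) := (lipschitzWith_indicator hf hf0).continuous
  have h2 : r h * ∫ x, g x * Ω.indicator f x ∂μ =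
      -((∑ k, ∫ x in Ω, g x * secondDiff (h • e k) f x ∂μ) / h ^ 2) := by
    rw [← integral_finsetSum _ fun _ _ => (integrable_mul_of_continuous μ
      (continuous_secondDiff hf.continuous _) hg hg').integrableOn, ← integral_div,
      ← integral_indicator hopen.measurableSet, ← integral_const_mul, ← integral_neg]
    refine integral_congr_ae (ae_of_all _ fun x => ?_)
    by_cases hx : x ∈ Ω
    · have := hr h hh x
      simp only [diffQuot] at this
      simp only [indicator_of_mem hx, ← Finset.mul_sum, mul_div_assoc, this]
      ring
    · simp [hx]
  rw [integral_mul_diffQuot μ hvc hg hg', h2, ← sub_eq_add_neg, ← sub_div, abs_div,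
    abs_of_nonneg (sq_nonneg h), div_le_iff₀ (by positivity), ← Finset.sum_sub_distrib]
  refine (Finset.abs_sum_le_sum_abs _ _).trans ?_
  have hle : ∀ k, |∫ x, g x * secondDiff (h • e k) (Ω.indicator f) x ∂μ -
      ∫ x in Ω, g x * secondDiff (h • e k) f x ∂μ| ≤ C * ε * h ^ 2 := fun k => by
    have := hC (h • e k) g ε hg hg' hε (by rw [hnorm]; exact hstrip)
    rwa [hnorm, sq_abs] at this
  refine (Finset.sum_le_sum fun k _ => hle k).trans (le_of_eq ?_)
  simp
  ring

/-- A continuous function that vanishes outside `Ω` is uniformly small in thin boundary strips. -/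
theorem eventually_strip_small {Ω : Set E} (hbdd : Bornology.IsBounded Ω) {g : E → ℝ}
    (hg : Continuous g) (hg0 : ∀ x, x ∉ Ω → g x = 0) {ε : ℝ} (hε : 0 < ε) :
    ∃ δ > 0, ∀ x y, dist x y < δ → y ∉ Ω → |g x| < ε := by
  have huc : UniformContinuous g :=
    (hasCompactSupport_of_eq_zero hbdd hg0).uniformContinuous_of_continuous hg
  obtain ⟨δ, hδ, h⟩ := Metric.uniformContinuous_iff.1 huc ε hε
  refine ⟨δ, hδ, fun x y hxy hy => ?_⟩
  have := h hxy
  rwa [hg0 y hy, Real.dist_0_eq_abs] at this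

theorem eventually_abs_lt {δ : ℝ} (hδ : 0 < δ) : ∀ᶠ h : ℝ in 𝓝[≠] 0, |h| < δ := by
  refine nhdsWithin_le_nhds ?_
  filter_upwards [Metric.ball_mem_nhds (0 : ℝ) hδ] with h hh
  simpa [Real.dist_eq] using hh

theorem tendsto_integral_mul_diffQuot_indicator {Ω : Set E} (hconv : Convex ℝ Ω)
    (hopen : IsOpen Ω) (hbdd : Bornology.IsBounded Ω) {f : E → ℝ} {L : ℝ≥0}
    (hf : LipschitzWith L f) (hf0 : ∀ x ∈ frontier Ω, f x = 0) {e : κ → E} (he : ∀ k, ‖e k‖ = 1)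
    {a : ℝ} (ha : IsDiffEigen e f a) {g : E → ℝ} (hg : Continuous g)
    (hg0 : ∀ x, x ∉ Ω → g x = 0) :
    Tendsto (fun h => ∫ x, g x * diffQuot e h (Ω.indicator f) x ∂μ) (𝓝[≠] 0)
      (𝓝 (-a * ∫ x, g x * Ω.indicator f x ∂μ)) := by
  obtain ⟨r, hr, hr'⟩ := ha
  obtain ⟨C, hC0, hC⟩ :=
    exists_abs_integral_mul_diffQuot_indicator_add_le μ hconv hopen hbdd hf hf0 he hr'
  set I := ∫ x, g x * Ω.indicator f x ∂μ
  have h1 : Tendsto (fun h => ∫ x, g x * diffQuot e h (Ω.indicator f) x ∂μ + r h * I) (𝓝[≠] 0)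
      (𝓝 0) := by
    rw [Metric.tendsto_nhds]
    intro ε hε
    obtain ⟨δ, hδ, hδ'⟩ := eventually_strip_small hbdd hg hg0 (ε := ε / (C + 1)) (by positivity)
    filter_upwards [eventually_abs_lt hδ, self_mem_nhdsWithin] with h hh hne
    rw [Real.dist_0_eq_abs]
    refine (hC h g (ε / (C + 1)) hne hg (hasCompactSupport_of_eq_zero hbdd hg0) (by positivity)
      fun x y hxy hx hy => ⟨(hδ' x y (hxy.trans_lt hh) hy).le, ?_⟩).trans_lt ?_
    · rw [hg0 y hy, abs_zero]; positivity
    · rw [← mul_div_assoc, div_lt_iff₀ (by positivity)]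
      nlinarith
  have h2 := h1.sub (hr.mul_const I)
  simpa using h2

/-- Functions with distinct difference eigenvalues are orthogonal in `L²(Ω)`. -/
theorem integral_mul_eq_zero_of_isDiffEigen {Ω : Set E} (hconv : Convex ℝ Ω)
    (hopen : IsOpen Ω) (hbdd : Bornology.IsBounded Ω) {f g : E → ℝ} {L L' : ℝ≥0}
    (hf : LipschitzWith L f) (hf0 : ∀ x ∈ frontier Ω, f x = 0) (hg : LipschitzWith L' g)
    (hg0 : ∀ x ∈ frontier Ω, g x = 0) {e : κ → E} (he : ∀ k, ‖e k‖ = 1)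
    {a b : ℝ} (ha : IsDiffEigen e f a) (hb : IsDiffEigen e g b) (hab : a ≠ b) :
    ∫ x, Ω.indicator f x * Ω.indicator g x ∂μ = 0 := by
  have hfc := (lipschitzWith_indicator hf hf0).continuous
  have hgc := (lipschitzWith_indicator hg hg0).continuous
  have hfz : ∀ x, x ∉ Ω → Ω.indicator f x = 0 := fun x hx => indicator_of_notMem hx _
  have hgz : ∀ x, x ∉ Ω → Ω.indicator g x = 0 := fun x hx => indicator_of_notMem hx _
  have h1 := tendsto_integral_mul_diffQuot_indicator μ hconv hopen hbdd hf hf0 he ha hgc hgz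
  have h2 := tendsto_integral_mul_diffQuot_indicator μ hconv hopen hbdd hg hg0 he hb hfc hfz
  have h3 := tendsto_nhds_unique h1 (h2.congr fun h =>
    integral_mul_diffQuot_comm μ hgc hfc (hasCompactSupport_of_eq_zero hbdd hgz)
      (hasCompactSupport_of_eq_zero hbdd hfz) e h)
  simp only [mul_comm (Ω.indicator g _)] at h3
  have h4 : (a - b) * ∫ x, Ω.indicator f x * Ω.indicator g x ∂μ = 0 := by linarith
  exact (mul_eq_zero.1 h4).resolve_left (sub_ne_zero.2 hab)

end DiffQuot

/-! ### Systems of explicit Dirichlet eigenfunctions -/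

section DirichletSystem

variable {n : ℕ}

/-- The standard basis, as the directions of the discrete Laplacian. -/
def stdDir (n : ℕ) (j : Fin n) : EuclideanSpace ℝ (Fin n) := EuclideanSpace.single j 1

theorem norm_stdDir (j : Fin n) : ‖stdDir n j‖ = 1 := by simp [stdDir]

/-- The discrete Laplacian converges to the Laplacian, uniformly on compact sets. -/
theorem eventually_abs_diffQuot_sub_laplacian_le {ψ : EuclideanSpace ℝ (Fin n) → ℝ}
    {U K : Set (EuclideanSpace ℝ (Fin n))} (hU : IsOpen U) (hψ : ∀ x ∈ U, ContDiffAt ℝ 2 ψ x)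
    (hK : IsCompact K) (hKU : K ⊆ U) {ε : ℝ} (hε : 0 < ε) :
    ∀ᶠ h : ℝ in 𝓝[≠] 0, ∀ x ∈ K,
      |diffQuot (stdDir n) h ψ x - Laplacian.laplacian ψ x| ≤ ε := by
  have h1 : ∀ j : Fin n, ∀ᶠ h : ℝ in 𝓝[≠] 0, ∀ x ∈ K,
      |secondDiff (h • stdDir n j) ψ x / h ^ 2 -
        iteratedFDeriv ℝ 2 ψ x ![stdDir n j, stdDir n j]| ≤ ε / (n + 1) := fun j =>
    eventually_abs_secondDiff_sub_le hU hψ hK hKU (stdDir n j) (by positivity)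
  filter_upwards [eventually_all.2 h1] with h hh x hx
  rw [InnerProductSpace.laplacian_eq_iteratedFDeriv_orthonormalBasis ψ
    (EuclideanSpace.basisFun (Fin n) ℝ), diffQuot, Finset.sum_div, ← Finset.sum_sub_distrib]
  refine (Finset.abs_sum_le_sum_abs _ _).trans ?_
  calc _ ≤ ∑ _j : Fin n, ε / (n + 1) := Finset.sum_le_sum fun j _ => by
        simpa [stdDir] using hh j x hx
    _ ≤ ε := by
        simp only [Finset.sum_const, Finset.card_univ, Fintype.card_fin, nsmul_eq_mul]
        rw [← mul_div_assoc, div_le_iff₀ (by positivity)]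
        nlinarith

theorem tendsto_diffQuot_laplacian {ψ : EuclideanSpace ℝ (Fin n) → ℝ} (hψ : ContDiff ℝ 2 ψ)
    (x : EuclideanSpace ℝ (Fin n)) :
    Tendsto (fun h => diffQuot (stdDir n) h ψ x) (𝓝[≠] 0) (𝓝 (Laplacian.laplacian ψ x)) := by
  rw [Metric.tendsto_nhds]
  intro ε hε
  filter_upwards [eventually_abs_diffQuot_sub_laplacian_le isOpen_univ
    (fun x _ => hψ.contDiffAt) (isCompact_singleton (x := x)) (subset_univ _) (half_pos hε)]
    with h hh
  rw [Real.dist_eq]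
  exact (hh x rfl).trans_lt (half_lt_self hε)

/-- A family of analytic functions on the whole space that vanish on the boundary of the convex
domain `Ω`, are eigenfunctions of the Laplacian (in the strong sense that they are eigenfunctions of
all discrete Laplacians), and form a complete orthogonal system in `Ω`. -/
structure DirichletSystem (Ω : Set (EuclideanSpace ℝ (Fin n))) {ι : Type*}
    (φ : ι → EuclideanSpace ℝ (Fin n) → ℝ) (lam : ι → ℝ) : Prop where
  convex : Convex ℝ Ω
  isOpen : IsOpen Ω
  bounded : Bornology.IsBounded Ω
  nonempty : Ω.Nonempty
  analytic : ∀ i, AnalyticOnNhd ℝ (φ i) univ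
  lipschitz : ∀ i, ∃ L, LipschitzWith L (φ i)
  boundary : ∀ i, ∀ x ∈ frontier Ω, φ i x = 0
  isDiffEigen : ∀ i, IsDiffEigen (stdDir n) (φ i) (lam i)
  orthogonal : ∀ i j, i ≠ j → ∫ x, Ω.indicator (φ i) x * Ω.indicator (φ j) x = 0
  ne_zero : ∀ i, ∃ x ∈ Ω, φ i x ≠ 0
  total : ∀ w : EuclideanSpace ℝ (Fin n) → ℝ, Continuous w → (∀ x, x ∉ Ω → w x = 0) →
    ∀ ε > 0, ∃ p ∈ Submodule.span ℝ (range φ), ∀ x ∈ Ω, |w x - p x| ≤ ε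
  finite : ∀ b, {i | lam i ≤ b}.Finite

namespace DirichletSystem

variable {Ω : Set (EuclideanSpace ℝ (Fin n))} {ι : Type*} {φ : ι → EuclideanSpace ℝ (Fin n) → ℝ}
  {lam : ι → ℝ} (S : DirichletSystem Ω φ lam)
include S

theorem contDiff (i : ι) : ContDiff ℝ 2 (φ i) :=
  contDiff_iff_contDiffAt.2 fun x => (S.analytic i x (mem_univ x)).contDiffAt

theorem continuous_indicator (i : ι) : Continuous (Ω.indicator (φ i)) := by
  obtain ⟨L, hL⟩ := S.lipschitz i
  exact (lipschitzWith_indicator hL (S.boundary i)).continuous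

theorem laplacian_eq (i : ι) (x : EuclideanSpace ℝ (Fin n)) :
    Laplacian.laplacian (φ i) x = -lam i * φ i x := by
  obtain ⟨r, hr, hr'⟩ := S.isDiffEigen i
  refine tendsto_nhds_unique (tendsto_diffQuot_laplacian (S.contDiff i) x) ?_
  refine Tendsto.congr' ?_ ((hr.neg).mul_const (φ i x))
  filter_upwards [self_mem_nhdsWithin] with h hh
  exact (hr' h hh x).symm

theorem indicator_mem_eigenspace (i : ι) : Ω.indicator (φ i) ∈ eigenspace Ω (lam i) := by
  have hev : ∀ x ∈ Ω, Ω.indicator (φ i) =ᶠ[𝓝 x] φ i := fun x hx => by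
    filter_upwards [S.isOpen.mem_nhds hx] with y hy using indicator_of_mem hy _
  refine ⟨S.continuous_indicator i, fun x hx => indicator_of_notMem hx _, fun x hx => ?_,
    fun x hx => ?_⟩
  · exact ((S.contDiff i).contDiffAt).congr_of_eventuallyEq (hev x hx)
  · rw [(InnerProductSpace.laplacian_congr_nhds (hev x hx)).eq_of_nhds, S.laplacian_eq,
      indicator_of_mem hx]
    ring

theorem hasCompactSupport {f : EuclideanSpace ℝ (Fin n) → ℝ} (hf : ∀ x, x ∉ Ω → f x = 0) :
    HasCompactSupport f := hasCompactSupport_of_eq_zero S.bounded hf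

theorem integrable_mul {f g : EuclideanSpace ℝ (Fin n) → ℝ} (hf : Continuous f)
    (hg : Continuous g) (hg0 : ∀ x, x ∉ Ω → g x = 0) : Integrable fun x => g x * f x :=
  integrable_mul_of_continuous volume hf hg (S.hasCompactSupport hg0)

theorem abs_integral_mul_le {f g : EuclideanSpace ℝ (Fin n) → ℝ}
    (hg : Continuous g) (hg0 : ∀ x, x ∉ Ω → g x = 0) {ε : ℝ} (hfg : ∀ x ∈ Ω, |f x| ≤ ε) :
    |∫ x, g x * f x| ≤ ε * ∫ x, |g x| := by
  rw [← integral_const_mul, ← Real.norm_eq_abs]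
  refine norm_integral_le_of_norm_le
    (((hg.integrable_of_hasCompactSupport (S.hasCompactSupport hg0)).abs).const_mul ε)
    (ae_of_all _ fun x => ?_)
  rw [Real.norm_eq_abs, abs_mul, mul_comm]
  by_cases hx : x ∈ Ω
  · exact mul_le_mul_of_nonneg_right (hfg x hx) (abs_nonneg _)
  · simp [hg0 x hx]

/-- Green's formula for a classical eigenfunction `w` and a function of the system. Since `w` is
regular only inside `Ω`, it is replaced by the dilations `x ↦ w (p + s (x - p))`, `s < 1`, which are
regular in a neighbourhood of the closure and almost vanish at the boundary. -/
theorem sub_mul_integral_eq_zero {μ : ℝ} {w : EuclideanSpace ℝ (Fin n) → ℝ}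
    (hw : w ∈ eigenspace Ω μ) (i : ι) : (lam i - μ) * ∫ x, Ω.indicator (φ i) x * w x = 0 := by
  obtain ⟨hwc, hw0, hw2, hweq⟩ := hw
  obtain ⟨p, hp⟩ := S.nonempty
  obtain ⟨L, hL⟩ := S.lipschitz i
  obtain ⟨r, hr, hr'⟩ := S.isDiffEigen i
  obtain ⟨C, hC0, hC⟩ := exists_abs_integral_mul_diffQuot_indicator_add_le volume S.convex S.isOpen
    S.bounded hL (S.boundary i) norm_stdDir hr'
  obtain ⟨D, hD⟩ := S.bounded.subset_closedBall p
  have hD0 : 0 ≤ D := dist_nonneg.trans (hD hp)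
  set v := Ω.indicator (φ i) with hv
  have hvc : Continuous v := S.continuous_indicator i
  have hv0 : ∀ x, x ∉ Ω → v x = 0 := fun x hx => indicator_of_notMem hx _
  set T : ℝ → EuclideanSpace ℝ (Fin n) → EuclideanSpace ℝ (Fin n) :=
    fun s x => p + s • (x - p) with hT
  have hTd : ∀ s ∈ Ioo (0 : ℝ) 1, ∀ x, dist (T s x) x = (1 - s) * dist x p := by
    intro s hs x
    have : T s x - x = (1 - s) • (p - x) := by simp only [hT]; module
    rw [dist_eq_norm, this, norm_smul, Real.norm_of_nonneg (by linarith [hs.2]), dist_comm,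
      dist_eq_norm]
  set A : ℝ → ℝ := fun s => ∫ x, v x * w (T s x) with hA
  have hTc : ∀ s, Continuous (T s) := fun s => by simp only [hT]; fun_prop
  have huc : UniformContinuous w := (S.hasCompactSupport hw0).uniformContinuous_of_continuous hwc
  -- the limit of `A` as `s → 1`
  have hAlim : Tendsto A (𝓝[<] 1) (𝓝 (∫ x, v x * w x)) := by
    rw [Metric.tendsto_nhds]
    intro ε hε
    set M := ∫ x, |v x|
    have hM : 0 ≤ M := integral_nonneg fun x => abs_nonneg _
    obtain ⟨δ, hδ, hδ'⟩ := Metric.uniformContinuous_iff.1 huc (ε / (M + 1)) (by positivity)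
    have hnear : ∀ᶠ s in 𝓝[<] (1 : ℝ), s ∈ Ioo (max 0 (1 - δ / (D + 1))) 1 :=
      Ioo_mem_nhdsLT (by rw [max_lt_iff]; exact ⟨by norm_num, by
        have : 0 < δ / (D + 1) := by positivity
        linarith⟩)
    filter_upwards [hnear] with s hs
    have hs01 : s ∈ Ioo (0 : ℝ) 1 := ⟨(le_max_left _ _).trans_lt hs.1, hs.2⟩
    have hsδ : (1 - s) * (D + 1) < δ := by
      have := (le_max_right _ _).trans_lt hs.1
      rw [← lt_div_iff₀ (by positivity)]; linarith
    rw [Real.dist_eq]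
    simp only [hA]
    rw [← integral_sub (S.integrable_mul (f := fun x => w (T s x)) (hwc.comp (hTc s)) hvc hv0)
      (S.integrable_mul hwc hvc hv0)]
    simp only [← mul_sub]
    refine (S.abs_integral_mul_le hvc hv0 (ε := ε / (M + 1)) fun x hx => ?_).trans_lt ?_
    · have h1 : dist (T s x) x < δ := by
        rw [hTd s hs01]
        have : dist x p ≤ D := hD hx
        nlinarith [hs01.2]
      exact (hδ' h1).le
    · rw [div_mul_eq_mul_div, div_lt_iff₀ (by positivity)]
      nlinarith
  -- summation by parts for the dilated function, up to a small boundary term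
  have hmain : ∀ ε > 0, ∀ᶠ s in 𝓝[<] (1 : ℝ), |(lam i - s ^ 2 * μ) * A s| ≤ C * ε := by
    intro ε hε
    obtain ⟨δ, hδ, hδ'⟩ := eventually_strip_small S.bounded hwc hw0 hε
    have hnear : ∀ᶠ s in 𝓝[<] (1 : ℝ), s ∈ Ioo (max 0 (1 - δ / 2 / (D + 1))) 1 :=
      Ioo_mem_nhdsLT (by rw [max_lt_iff]; exact ⟨by norm_num, by
        have : 0 < δ / 2 / (D + 1) := by positivity
        linarith⟩)
    filter_upwards [hnear] with s hs
    have hs01 : s ∈ Ioo (0 : ℝ) 1 := ⟨(le_max_left _ _).trans_lt hs.1, hs.2⟩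
    have hsδ : (1 - s) * (D + 1) < δ / 2 := by
      have := (le_max_right _ _).trans_lt hs.1
      rw [← lt_div_iff₀ (by positivity)]; linarith
    have hs0 : s ≠ 0 := hs01.1.ne'
    have hwTc : Continuous fun x => w (T s x) := hwc.comp (hTc s)
    have hwTs : HasCompactSupport fun x => w (T s x) := by
      refine HasCompactSupport.intro (isCompact_closedBall p (D / s)) fun x hx => hw0 _ fun hxT => ?_
      have h1 : dist (T s x) p ≤ D := hD hxT
      have h2 : dist (T s x) p = s * dist x p := by
        have : T s x - p = s • (x - p) := by simp only [hT]; module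
        rw [dist_eq_norm, this, norm_smul, Real.norm_of_nonneg hs01.1.le, dist_eq_norm]
      apply hx
      rw [Metric.mem_closedBall, le_div_iff₀ hs01.1]
      linarith
    -- the compact set on which the regularity of `w` is used
    set K := T s '' closure Ω with hK
    have hKc : IsCompact K := S.bounded.isCompact_closure.image (hTc s)
    have hKΩ : K ⊆ Ω := by
      rintro _ ⟨x, hx, rfl⟩
      have h1 := S.convex.combo_interior_closure_mem_interior
        (by rwa [S.isOpen.interior_eq] : p ∈ interior Ω) hx
        (by linarith [hs01.2] : 0 < 1 - s) hs01.1.le (by ring)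
      rw [S.isOpen.interior_eq] at h1
      convert h1 using 1
      simp only [hT]; module
    have hscale : ∀ h x, diffQuot (stdDir n) h (fun x => w (T s x)) x =
        s ^ 2 * diffQuot (stdDir n) (s * h) w (T s x) := by
      intro h x
      have e1 : ∀ u, T s (x + u) = T s x + s • u := fun u => by simp only [hT]; module
      have e2 : ∀ u, T s (x - u) = T s x - s • u := fun u => by simp only [hT]; module
      simp only [diffQuot, secondDiff, e1, e2, smul_smul]
      rw [mul_pow, ← mul_div_assoc, mul_div_mul_left _ _ (pow_ne_zero 2 hs0)]
    have hlim1 : Tendsto (fun h => ∫ x, v x * diffQuot (stdDir n) h (fun x => w (T s x)) x)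
        (𝓝[≠] 0) (𝓝 (-(s ^ 2 * μ) * A s)) := by
      rw [Metric.tendsto_nhds]
      intro η hη
      set M := ∫ x, |v x|
      have hM : 0 ≤ M := integral_nonneg fun x => abs_nonneg _
      have hsh : Tendsto (fun h => s * h) (𝓝[≠] (0 : ℝ)) (𝓝[≠] 0) := by
        refine tendsto_nhdsWithin_iff.2 ⟨?_, ?_⟩
        · have : Tendsto (fun h => s * h) (𝓝 (0 : ℝ)) (𝓝 (s * 0)) :=
            (continuous_const_mul s).tendsto 0
          rw [mul_zero] at this
          exact this.mono_left nhdsWithin_le_nhds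
        · filter_upwards [self_mem_nhdsWithin] with h hh
          exact mul_ne_zero hs0 hh
      have hη' : 0 < η / (M + 1) := by positivity
      filter_upwards [hsh.eventually
        (eventually_abs_diffQuot_sub_laplacian_le S.isOpen hw2 hKc hKΩ hη')] with h hh
      rw [Real.dist_eq]
      simp only [hA]
      rw [← integral_const_mul, ← integral_sub
        (S.integrable_mul (continuous_diffQuot hwTc _ _) hvc hv0)
        ((S.integrable_mul hwTc hvc hv0).const_mul _)]
      have heq : ∀ x, v x * diffQuot (stdDir n) h (fun x => w (T s x)) x -
          -(s ^ 2 * μ) * (v x * w (T s x)) =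
          v x * (s ^ 2 * (diffQuot (stdDir n) (s * h) w (T s x) + μ * w (T s x))) := by
        intro x; rw [hscale]; ring
      simp only [heq]
      refine (S.abs_integral_mul_le hvc hv0 (ε := η / (M + 1)) fun x hx => ?_).trans_lt ?_
      · have hxK : T s x ∈ K := ⟨x, subset_closure hx, rfl⟩
        have h1 := hh _ hxK
        have h2 := hweq _ (hKΩ hxK)
        rw [← h2, ← sub_eq_add_neg, abs_mul, abs_of_nonneg (sq_nonneg s)]
        have h3 : s ^ 2 ≤ 1 := by nlinarith [hs01.1, hs01.2]
        calc s ^ 2 * _ ≤ 1 * (η / (M + 1)) := by gcongr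
          _ = η / (M + 1) := one_mul _
      · rw [div_mul_eq_mul_div, div_lt_iff₀ (by positivity)]
        nlinarith
    have hlim2 := (hlim1.add (hr.mul_const (A s))).abs
    have hlim3 : -(s ^ 2 * μ) * A s + lam i * A s = (lam i - s ^ 2 * μ) * A s := by ring
    rw [hlim3] at hlim2
    refine le_of_tendsto hlim2 ?_
    filter_upwards [eventually_abs_lt (show 0 < min 1 (δ / 2) by positivity), self_mem_nhdsWithin]
      with h hh hne
    have hh1 : |h| < 1 := hh.trans_le (min_le_left _ _)
    have hh2 : |h| < δ / 2 := hh.trans_le (min_le_right _ _)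
    have h1 := hC h (fun x => w (T s x)) ε hne hwTc hwTs hε.le fun x y hxy hx hy => by
      have hxp : dist x p ≤ D := hD hx
      have hyp : dist y p ≤ D + 1 := by
        have := dist_triangle y x p
        rw [dist_comm y x] at this
        linarith
      constructor
      · refine (hδ' (T s x) y ?_ hy).le
        have := dist_triangle (T s x) x y
        rw [hTd s hs01] at this
        nlinarith [hs01.2]
      · refine (hδ' (T s y) y ?_ hy).le
        rw [hTd s hs01]
        nlinarith [hs01.2]
    rw [integral_mul_diffQuot_comm volume hvc hwTc (S.hasCompactSupport hv0) hwTs] at h1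
    have h2 : ∫ x, w (T s x) * v x = A s := integral_congr_ae (ae_of_all _ fun x => mul_comm _ _)
    rw [h2] at h1
    exact h1
  have hfinal : ∀ ε > 0, |(lam i - μ) * ∫ x, v x * w x| ≤ C * ε := by
    intro ε hε
    have h1 : Tendsto (fun s : ℝ => (lam i - s ^ 2 * μ) * A s) (𝓝[<] 1)
        (𝓝 ((lam i - 1 ^ 2 * μ) * ∫ x, v x * w x)) := by
      refine Tendsto.mul ?_ hAlim
      refine Tendsto.mono_left ?_ nhdsWithin_le_nhds
      exact Continuous.tendsto (by fun_prop) 1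
    rw [one_pow, one_mul] at h1
    exact le_of_tendsto h1.abs (hmain ε hε)
  by_contra hne
  have hpos := abs_pos.2 hne
  have h1 := hfinal (|(lam i - μ) * ∫ x, v x * w x| / (2 * (C + 1))) (by positivity)
  rw [← mul_div_assoc, le_div_iff₀ (by positivity)] at h1
  nlinarith

end DirichletSystem

end DirichletSystem

/-! ### Expansion in a Dirichlet system; eigenspaces and the counting function -/

namespace DirichletSystem

variable {n : ℕ} {Ω : Set (EuclideanSpace ℝ (Fin n))} {ι : Type*}
  {φ : ι → EuclideanSpace ℝ (Fin n) → ℝ} {lam : ι → ℝ} (S : DirichletSystem Ω φ lam)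
include S

theorem indicator_eq_zero (i : ι) (x : EuclideanSpace ℝ (Fin n)) (hx : x ∉ Ω) :
    Ω.indicator (φ i) x = 0 := indicator_of_notMem hx _

theorem integral_self_pos (i : ι) : 0 < ∫ x, Ω.indicator (φ i) x * Ω.indicator (φ i) x := by
  obtain ⟨x, hx, hne⟩ := S.ne_zero i
  have hc := S.continuous_indicator i
  refine (hc.mul hc).integral_pos_of_hasCompactSupport_nonneg_nonzero (x := x)
    (S.hasCompactSupport fun y hy => by simp [hy])
    (fun y => mul_self_nonneg _) ?_
  simpa [hx] using hne

theorem continuous_sum (F : Finset ι) (a : ι → ℝ) :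
    Continuous fun x => ∑ i ∈ F, a i * Ω.indicator (φ i) x :=
  continuous_finsetSum _ fun i _ => continuous_const.mul (S.continuous_indicator i)

theorem sum_eq_zero (F : Finset ι) (a : ι → ℝ) (x : EuclideanSpace ℝ (Fin n)) (hx : x ∉ Ω) :
    ∑ i ∈ F, a i * Ω.indicator (φ i) x = 0 :=
  Finset.sum_eq_zero fun i _ => by simp [hx]

theorem integral_mul_sum (F : Finset ι) (a : ι → ℝ) {w : EuclideanSpace ℝ (Fin n) → ℝ}
    (hw : Continuous w) : ∫ x, w x * ∑ i ∈ F, a i * Ω.indicator (φ i) x =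
      ∑ i ∈ F, a i * ∫ x, Ω.indicator (φ i) x * w x := by
  simp only [Finset.mul_sum, ← integral_const_mul]
  rw [← integral_finsetSum]
  · refine integral_congr_ae (ae_of_all _ fun x => Finset.sum_congr rfl fun i _ => by ring)
  · exact fun i _ =>
      (S.integrable_mul hw (S.continuous_indicator i) (S.indicator_eq_zero i)).const_mul _

theorem integral_indicator_mul_sum [DecidableEq ι] (F : Finset ι) (a : ι → ℝ) (j : ι) :
    ∫ x, Ω.indicator (φ j) x * ∑ i ∈ F, a i * Ω.indicator (φ i) x =
      if j ∈ F then a j * ∫ x, Ω.indicator (φ j) x * Ω.indicator (φ j) x else 0 := by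
  rw [S.integral_mul_sum F a (S.continuous_indicator j)]
  split_ifs with hj
  · rw [Finset.sum_eq_single_of_mem j hj fun i _ hij => by rw [S.orthogonal i j hij, mul_zero]]
  · exact Finset.sum_eq_zero fun i hi => by
      rw [S.orthogonal i j fun h => hj (h ▸ hi), mul_zero]

theorem integral_sum_mul_sum [DecidableEq ι] (F : Finset ι) (a b : ι → ℝ) :
    ∫ x, (∑ i ∈ F, b i * Ω.indicator (φ i) x) * ∑ i ∈ F, a i * Ω.indicator (φ i) x =
      ∑ i ∈ F, a i * b i * ∫ x, Ω.indicator (φ i) x * Ω.indicator (φ i) x := by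
  rw [S.integral_mul_sum F a (S.continuous_sum F b)]
  refine Finset.sum_congr rfl fun i hi => ?_
  rw [S.integral_indicator_mul_sum, if_pos hi, mul_assoc]

theorem eq_zero_of_orthogonal {w : EuclideanSpace ℝ (Fin n) → ℝ} (hw : Continuous w)
    (hw0 : ∀ x, x ∉ Ω → w x = 0) (h : ∀ i, ∫ x, Ω.indicator (φ i) x * w x = 0) : w = 0 := by
  by_contra hne
  obtain ⟨x, hx⟩ := Function.ne_iff.1 hne
  have hpos : 0 < ∫ x, w x * w x :=
    (hw.mul hw).integral_pos_of_hasCompactSupport_nonneg_nonzero (x := x)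
      (S.hasCompactSupport fun y hy => by simp [hw0 y hy]) (fun y => mul_self_nonneg _)
      (mul_self_ne_zero.2 hx)
  set M := ∫ x, |w x|
  have hM : 0 ≤ M := integral_nonneg fun x => abs_nonneg _
  set ε := (∫ x, w x * w x) / (2 * (M + 1)) with hε
  have hε0 : 0 < ε := by positivity
  obtain ⟨p, hp, hwp⟩ := S.total w hw hw0 ε hε0
  obtain ⟨c, rfl⟩ := Finsupp.mem_span_range_iff_exists_finsupp.1 hp
  have h1 : ∫ x, w x * ∑ i ∈ c.support, c i * Ω.indicator (φ i) x = 0 := by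
    rw [S.integral_mul_sum _ _ hw]
    exact Finset.sum_eq_zero fun i _ => by rw [h, mul_zero]
  have h2 : ∫ x, w x * w x =
      ∫ x, w x * (w x - ∑ i ∈ c.support, c i * Ω.indicator (φ i) x) := by
    simp only [mul_sub]
    rw [integral_sub (S.integrable_mul hw hw hw0)
      (S.integrable_mul (S.continuous_sum _ _) hw hw0), h1, sub_zero]
  have h3 := S.abs_integral_mul_le (f := fun x => w x - ∑ i ∈ c.support, c i * Ω.indicator (φ i) x)
    hw hw0 (ε := ε) fun x hx => by
      have := hwp x hx
      simpa [Finsupp.sum, hx] using this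
  rw [← h2, abs_of_pos hpos] at h3
  have h4 : ε * M < ε * (2 * (M + 1)) := by nlinarith
  have h5 : ε * (2 * (M + 1)) = ∫ x, w x * w x := by
    rw [hε]; field_simp
  linarith

theorem eq_sum_of_orthogonal (F : Finset ι) {w : EuclideanSpace ℝ (Fin n) → ℝ}
    (hw : Continuous w) (hw0 : ∀ x, x ∉ Ω → w x = 0)
    (h : ∀ i ∉ F, ∫ x, Ω.indicator (φ i) x * w x = 0) :
    ∃ a : ι → ℝ, w = fun x => ∑ i ∈ F, a i * Ω.indicator (φ i) x := by
  classical
  set a : ι → ℝ := fun i => (∫ x, Ω.indicator (φ i) x * w x) /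
    ∫ x, Ω.indicator (φ i) x * Ω.indicator (φ i) x
  refine ⟨a, ?_⟩
  have h0 := S.eq_zero_of_orthogonal (w := fun x => w x - ∑ i ∈ F, a i * Ω.indicator (φ i) x)
    (hw.sub (S.continuous_sum F a))
    (fun x hx => by rw [hw0 x hx, S.sum_eq_zero F a x hx, sub_zero]) fun i => ?_
  · funext x
    exact sub_eq_zero.1 (congrFun h0 x)
  · simp only [mul_sub]
    rw [integral_sub (S.integrable_mul hw (S.continuous_indicator i) (S.indicator_eq_zero i))
      (S.integrable_mul (S.continuous_sum F a) (S.continuous_indicator i) (S.indicator_eq_zero i)),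
      S.integral_indicator_mul_sum]
    split_ifs with hi
    · rw [div_mul_cancel₀ _ (S.integral_self_pos i).ne', sub_self]
    · rw [h i hi, sub_zero]

/-- The indices of the functions of the system with eigenvalue `μ`. -/
def level (μ : ℝ) : Finset ι :=
  ((S.finite μ).subset fun i (h : lam i = μ) => h.le : {i | lam i = μ}.Finite).toFinset

@[simp] theorem mem_level {μ : ℝ} {i : ι} : i ∈ S.level μ ↔ lam i = μ :=
  Finite.mem_toFinset _

theorem sum_mem_eigenspace (μ : ℝ) (a : ι → ℝ) :
    (fun x => ∑ i ∈ S.level μ, a i * Ω.indicator (φ i) x) ∈ eigenspace Ω μ := by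
  have : (fun x => ∑ i ∈ S.level μ, a i * Ω.indicator (φ i) x) =
      ∑ i ∈ S.level μ, a i • Ω.indicator (φ i) := by
    funext x; simp [Finset.sum_apply]
  rw [this]
  refine Submodule.sum_mem _ fun i hi => Submodule.smul_mem _ _ ?_
  rw [← S.mem_level.1 hi]
  exact S.indicator_mem_eigenspace i

theorem mem_eigenspace_iff {μ : ℝ} {w : EuclideanSpace ℝ (Fin n) → ℝ} : w ∈ eigenspace Ω μ ↔
    ∃ a : ι → ℝ, w = fun x => ∑ i ∈ S.level μ, a i * Ω.indicator (φ i) x := by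
  refine ⟨fun hw => ?_, ?_⟩
  · refine S.eq_sum_of_orthogonal _ hw.1 hw.2.1 fun i hi => ?_
    have h := S.sub_mul_integral_eq_zero hw i
    exact (mul_eq_zero.1 h).resolve_left (sub_ne_zero.2 fun h => hi (S.mem_level.2 h))
  · rintro ⟨a, rfl⟩
    exact S.sum_mem_eigenspace μ a

theorem linearIndependent : LinearIndependent ℝ fun i => Ω.indicator (φ i) := by
  classical
  rw [linearIndependent_iff']
  intro F a h j hj
  have h1 := S.integral_indicator_mul_sum F a j
  have h2 : ∀ x, ∑ i ∈ F, a i * Ω.indicator (φ i) x = 0 := fun x => by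
    simpa using congrFun h x
  simp only [h2, mul_zero, integral_zero, if_pos hj] at h1
  exact (mul_eq_zero.1 h1.symm).resolve_right (S.integral_self_pos j).ne'

theorem eigenspace_eq_span (μ : ℝ) : eigenspace Ω μ =
    Submodule.span ℝ (range fun i : {i // i ∈ S.level μ} => Ω.indicator (φ i)) := by
  apply le_antisymm
  · intro w hw
    obtain ⟨a, rfl⟩ := S.mem_eigenspace_iff.1 hw
    have : (fun x => ∑ i ∈ S.level μ, a i * Ω.indicator (φ i) x) =
        ∑ i ∈ S.level μ, a i • Ω.indicator (φ i) := by
      funext x; simp [Finset.sum_apply]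
    rw [this]
    exact Submodule.sum_mem _ fun i hi =>
      Submodule.smul_mem _ _ (Submodule.subset_span ⟨⟨i, hi⟩, rfl⟩)
  · rw [Submodule.span_le]
    rintro _ ⟨⟨i, hi⟩, rfl⟩
    have := S.indicator_mem_eigenspace i
    rwa [S.mem_level.1 hi] at this

theorem finiteDimensional_eigenspace (μ : ℝ) : FiniteDimensional ℝ (eigenspace Ω μ) := by
  rw [S.eigenspace_eq_span μ]
  exact FiniteDimensional.span_of_finite ℝ (finite_range _)

theorem multiplicity_eq (μ : ℝ) : multiplicity Ω μ = (S.level μ).card := by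
  have h : LinearIndependent ℝ fun i : {i // i ∈ S.level μ} => Ω.indicator (φ i) :=
    S.linearIndependent.comp _ Subtype.val_injective
  rw [multiplicity, S.eigenspace_eq_span μ, finrank_span_eq_card h, Fintype.card_coe]

theorem isEigenvalue_iff {μ : ℝ} : IsEigenvalue Ω μ ↔ ∃ i, lam i = μ := by
  constructor
  · rintro ⟨w, hw, hne⟩
    by_contra! hcon
    obtain ⟨a, rfl⟩ := S.mem_eigenspace_iff.1 hw
    apply hne
    have : S.level μ = ∅ := Finset.eq_empty_of_forall_notMem fun i hi => hcon i (S.mem_level.1 hi)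
    funext x
    simp [this]
  · rintro ⟨i, rfl⟩
    exact ⟨_, S.indicator_mem_eigenspace i, S.linearIndependent.ne_zero i⟩

theorem lowerCount_eq (b : ℝ) : lowerCount Ω b = {i | lam i < b}.ncard := by
  classical
  have hfin : {i | lam i < b}.Finite := (S.finite b).subset fun i (hi : lam i < b) => hi.le
  have hsub : Function.support (fun μ => ∑ᶠ (_ : μ < b), multiplicity Ω μ) ⊆
      ((hfin.toFinset.image lam : Finset ℝ) : Set ℝ) := by
    intro μ hμ
    rw [Function.mem_support] at hμ
    by_cases hlt : μ < b
    · simp only [hlt, finsum_true] at hμ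
      rw [S.multiplicity_eq] at hμ
      obtain ⟨i, hi⟩ := Finset.card_pos.1 (Nat.pos_of_ne_zero hμ)
      rw [S.mem_level] at hi
      simp only [Finset.coe_image, Finite.coe_toFinset]
      exact ⟨i, by simpa [hi] using hlt, hi⟩
    · simp [hlt] at hμ
  rw [lowerCount, finsum_eq_sum_of_support_subset _ hsub, ncard_eq_toFinset_card _ hfin,
    Finset.card_eq_sum_card_image lam]
  refine Finset.sum_congr rfl fun μ hμ => ?_
  obtain ⟨i, hi, rfl⟩ := Finset.mem_image.1 hμ
  have hlt : lam i < b := by simpa using hi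
  simp only [hlt, finsum_true]
  rw [S.multiplicity_eq]
  congr 1
  ext j
  simp only [mem_level, Finset.mem_filter, Finite.mem_toFinset, mem_ofPred_eq]
  exact ⟨fun h => ⟨h ▸ hlt, h⟩, fun h => h.2⟩

theorem count_eq (i : ι) : count Ω (lam i) = {j | lam j < lam i}.ncard + 1 := by
  rw [count, if_pos (S.isEigenvalue_iff.2 ⟨i, rfl⟩), S.lowerCount_eq]

theorem finite_spectrum (b : ℝ) : {μ : ℝ | μ ≤ b ∧ IsEigenvalue Ω μ}.Finite := by
  refine ((S.finite b).image lam).subset ?_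
  rintro μ ⟨hμ, h⟩
  obtain ⟨i, rfl⟩ := S.isEigenvalue_iff.1 h
  exact ⟨i, hμ, rfl⟩

/-! ### The Dirichlet form and its minimizers -/

theorem integral_sub_mul_sub {w q : EuclideanSpace ℝ (Fin n) → ℝ} (hw : Continuous w)
    (hq : Continuous q) (hw0 : ∀ x, x ∉ Ω → w x = 0) (hq0 : ∀ x, x ∉ Ω → q x = 0) :
    ∫ x, (w x - q x) * (w x - q x) =
      (∫ x, w x * w x) - 2 * (∫ x, w x * q x) + ∫ x, q x * q x := by
  rw [← integral_const_mul, ← integral_sub' (S.integrable_mul hw hw hw0)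
    ((S.integrable_mul hq hw hw0).const_mul 2), ← integral_add'
    ((S.integrable_mul hw hw hw0).sub ((S.integrable_mul hq hw hw0).const_mul 2))
    (S.integrable_mul hq hq hq0)]
  refine integral_congr_ae (ae_of_all _ fun x => ?_)
  simp only [Pi.add_apply, Pi.sub_apply]
  ring

/-- Bessel's inequality. -/
theorem sum_sq_div_le_integral (F : Finset ι) {w : EuclideanSpace ℝ (Fin n) → ℝ}
    (hw : Continuous w) (hw0 : ∀ x, x ∉ Ω → w x = 0) :
    ∑ i ∈ F, (∫ x, Ω.indicator (φ i) x * w x) ^ 2 /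
      ∫ x, Ω.indicator (φ i) x * Ω.indicator (φ i) x ≤ ∫ x, w x * w x := by
  classical
  set t : ι → ℝ := fun i => (∫ x, Ω.indicator (φ i) x * w x) ^ 2 /
    ∫ x, Ω.indicator (φ i) x * Ω.indicator (φ i) x with ht
  set a : ι → ℝ := fun i => (∫ x, Ω.indicator (φ i) x * w x) /
    ∫ x, Ω.indicator (φ i) x * Ω.indicator (φ i) x with ha
  have hqc := S.continuous_sum F a
  have h2 : 0 ≤ ∫ x, (w x - ∑ i ∈ F, a i * Ω.indicator (φ i) x) *
      (w x - ∑ i ∈ F, a i * Ω.indicator (φ i) x) := integral_nonneg fun x => mul_self_nonneg _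
  rw [S.integral_sub_mul_sub hw hqc hw0 (S.sum_eq_zero F a), S.integral_mul_sum F a hw,
    S.integral_sum_mul_sum F a a] at h2
  have e1 : ∑ i ∈ F, a i * ∫ x, Ω.indicator (φ i) x * w x = ∑ i ∈ F, t i :=
    Finset.sum_congr rfl fun j _ => by simp only [ha, ht]; ring
  have e2 : ∑ i ∈ F, a i * a i * ∫ x, Ω.indicator (φ i) x * Ω.indicator (φ i) x =
      ∑ i ∈ F, t i := Finset.sum_congr rfl fun j _ => by
    have := (S.integral_self_pos j).ne'
    simp only [ha, ht]
    field_simp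
  rw [e1, e2] at h2
  linarith

/-- Parseval's identity, in the form needed here: finite partial sums come close to the norm. -/
theorem exists_integral_sub_le_sum (i₀ : ι) {w : EuclideanSpace ℝ (Fin n) → ℝ} (hw : Continuous w)
    (hw0 : ∀ x, x ∉ Ω → w x = 0) {ε : ℝ} (hε : 0 < ε) :
    ∃ F : Finset ι, i₀ ∈ F ∧ (∫ x, w x * w x) - ε ≤ ∑ i ∈ F, (∫ x, Ω.indicator (φ i) x * w x) ^ 2 /
      ∫ x, Ω.indicator (φ i) x * Ω.indicator (φ i) x := by
  classical
  set V := volume.real Ω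
  have hVfin : volume Ω ≠ ⊤ := S.bounded.measure_lt_top.ne
  have hV : 0 ≤ V := measureReal_nonneg
  set η := min 1 (ε / (V + 1)) with hη
  have hη0 : 0 < η := by positivity
  obtain ⟨p, hp, hwp⟩ := S.total w hw hw0 η hη0
  obtain ⟨c, rfl⟩ := Finsupp.mem_span_range_iff_exists_finsupp.1 hp
  set F := insert i₀ c.support with hF
  refine ⟨F, Finset.mem_insert_self _ _, ?_⟩
  set q : EuclideanSpace ℝ (Fin n) → ℝ := fun x => ∑ i ∈ F, c i * Ω.indicator (φ i) x with hq
  have hqc : Continuous q := S.continuous_sum F c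
  have hq0 : ∀ x, x ∉ Ω → q x = 0 := S.sum_eq_zero F c
  have hwq : ∀ x, (w x - q x) * (w x - q x) ≤ Ω.indicator (fun _ => η ^ 2) x := by
    intro x
    by_cases hx : x ∈ Ω
    · have h1 := hwp x hx
      have h2 : q x = (c.sum fun i a => a • φ i) x := by
        simp only [hq, Finsupp.sum, Finset.sum_apply, Pi.smul_apply, smul_eq_mul,
          indicator_of_mem hx, hF]
        refine (Finset.sum_subset (Finset.subset_insert _ _) fun i _ hi => ?_).symm
        rw [Finsupp.notMem_support_iff.1 hi, zero_mul]
      rw [indicator_of_mem hx, h2, ← sq, ← sq_abs]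
      gcongr
    · rw [hw0 x hx, hq0 x hx, indicator_of_notMem hx]; simp
  have hwqc : Continuous fun x => w x - q x := hw.sub hqc
  have hwq0 : ∀ x, x ∉ Ω → w x - q x = 0 := fun x hx => by rw [hw0 x hx, hq0 x hx, sub_zero]
  have h1 : ∫ x, (w x - q x) * (w x - q x) ≤ ε := by
    have hint : Integrable (Ω.indicator fun _ => η ^ 2) (volume : Measure (EuclideanSpace ℝ (Fin n))) :=
      (integrable_indicator_iff S.isOpen.measurableSet).2 (integrableOn_const hVfin)
    refine (integral_mono (S.integrable_mul hwqc hwqc hwq0) hint hwq).trans ?_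
    rw [integral_indicator_const _ S.isOpen.measurableSet, smul_eq_mul]
    have hη1 : η ≤ 1 := min_le_left _ _
    have hη2 : η ≤ ε / (V + 1) := min_le_right _ _
    rw [le_div_iff₀ (by positivity)] at hη2
    change V * η ^ 2 ≤ ε
    nlinarith [mul_nonneg hV hη0.le]
  rw [S.integral_sub_mul_sub hw hqc hw0 hq0, S.integral_mul_sum F c hw, S.integral_sum_mul_sum F c c] at h1
  have h3 : ∀ i ∈ F, 2 * (c i * ∫ x, Ω.indicator (φ i) x * w x) -
      c i * c i * ∫ x, Ω.indicator (φ i) x * Ω.indicator (φ i) x ≤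
      (∫ x, Ω.indicator (φ i) x * w x) ^ 2 / ∫ x, Ω.indicator (φ i) x * Ω.indicator (φ i) x := by
    intro i _
    rw [le_div_iff₀ (S.integral_self_pos i)]
    set b := ∫ x, Ω.indicator (φ i) x * w x
    set m := ∫ x, Ω.indicator (φ i) x * Ω.indicator (φ i) x
    nlinarith [sq_nonneg (b - c i * m)]
  have h4 := Finset.sum_le_sum h3
  rw [Finset.sum_sub_distrib, ← Finset.mul_sum] at h4
  linarith

theorem tendsto_integral_mul_diffQuot_sum (F : Finset ι) (a : ι → ℝ)
    {g : EuclideanSpace ℝ (Fin n) → ℝ} (hg : Continuous g) (hg0 : ∀ x, x ∉ Ω → g x = 0) :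
    Tendsto (fun h => ∫ x, g x *
      diffQuot (stdDir n) h (fun x => ∑ i ∈ F, a i * Ω.indicator (φ i) x) x) (𝓝[≠] 0)
      (𝓝 (∑ i ∈ F, a i * (-lam i * ∫ x, Ω.indicator (φ i) x * g x))) := by
  have hlin : ∀ h x, diffQuot (stdDir n) h (fun x => ∑ i ∈ F, a i * Ω.indicator (φ i) x) x =
      ∑ i ∈ F, a i * diffQuot (stdDir n) h (Ω.indicator (φ i)) x := by
    intro h x
    simp only [diffQuot, secondDiff, mul_div_assoc']
    rw [← Finset.sum_div]
    congr 1
    simp only [Finset.mul_sum]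
    rw [Finset.sum_comm]
    simp only [← Finset.sum_add_distrib, ← Finset.sum_sub_distrib]
    refine Finset.sum_congr rfl fun k _ => Finset.sum_congr rfl fun i _ => by ring
  have heq : ∀ h, ∫ x, g x *
      diffQuot (stdDir n) h (fun x => ∑ i ∈ F, a i * Ω.indicator (φ i) x) x =
      ∑ i ∈ F, a i * ∫ x, g x * diffQuot (stdDir n) h (Ω.indicator (φ i)) x := by
    intro h
    simp only [hlin, Finset.mul_sum, ← integral_const_mul]
    rw [← integral_finsetSum]
    · refine integral_congr_ae (ae_of_all _ fun x => Finset.sum_congr rfl fun i _ => by ring)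
    · exact fun i _ =>
        (S.integrable_mul (continuous_diffQuot (S.continuous_indicator i) _ _) hg hg0).const_mul _
  simp only [heq]
  refine tendsto_finsetSum _ fun i _ => Tendsto.const_mul _ ?_
  obtain ⟨L, hL⟩ := S.lipschitz i
  have := tendsto_integral_mul_diffQuot_indicator volume S.convex S.isOpen S.bounded hL
    (S.boundary i) norm_stdDir (S.isDiffEigen i) hg hg0
  simpa only [mul_comm (g _)] using this

end DirichletSystem

section Dirichlet

variable {E : Type*} [NormedAddCommGroup E] [NormedSpace ℝ E] {κ : Type*} [Fintype κ]
  [MeasurableSpace E] [BorelSpace E] [FiniteDimensional ℝ E] (μ : Measure E) [μ.IsAddHaarMeasure]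

theorem integral_mul_secondDiff_eq_neg {f g : E → ℝ} (hf : Continuous f) (hg : Continuous g)
    (hg' : HasCompactSupport g) (u : E) : ∫ x, g x * secondDiff u f x ∂μ =
      -∫ x, (g (x + u) - g x) * (f (x + u) - f x) ∂μ := by
  have i1 := integrable_mul_of_continuous μ (show Continuous fun x => f (x + u) - f x by fun_prop)
    hg hg'
  have i2 := integrable_mul_of_continuous μ (show Continuous fun x => f x - f (x - u) by fun_prop)
    hg hg'
  have i3 : Integrable (fun x => g (x + u) * (f (x + u) - f x)) μ := by
    have := i2.comp_add_right u
    simpa using this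
  have e1 : ∫ x, g (x + u) * (f (x + u) - f x) ∂μ = ∫ x, g x * (f x - f (x - u)) ∂μ := by
    rw [← integral_add_right_eq_self (fun x => g x * (f x - f (x - u))) u]
    simp
  have e2 : ∫ x, (g (x + u) - g x) * (f (x + u) - f x) ∂μ =
      ∫ x, g (x + u) * (f (x + u) - f x) ∂μ - ∫ x, g x * (f (x + u) - f x) ∂μ := by
    rw [← integral_sub i3 i1]
    simp only [sub_mul]
  rw [e2, e1, ← integral_sub i2 i1, ← integral_neg]
  refine integral_congr_ae (ae_of_all _ fun x => ?_)
  simp only [secondDiff]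
  ring

theorem integral_mul_diffQuot_eq_neg {f g : E → ℝ} (hf : Continuous f) (hg : Continuous g)
    (hg' : HasCompactSupport g) (e : κ → E) (h : ℝ) : ∫ x, g x * diffQuot e h f x ∂μ =
      -((∑ k, ∫ x, (g (x + h • e k) - g x) * (f (x + h • e k) - f x) ∂μ) / h ^ 2) := by
  rw [integral_mul_diffQuot μ hf hg hg', ← neg_div, ← Finset.sum_neg_distrib]
  simp only [integral_mul_secondDiff_eq_neg μ hf hg hg']

end Dirichlet

/-! ### Multiplying by functions that are constant on nodal domains -/

section PiecewiseMultiples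

variable {E : Type*} [NormedAddCommGroup E] [NormedSpace ℝ E]

/-- `c` is constant along segments that avoid the zeros of `f`. -/
def ConstOffZeros (f c : E → ℝ) : Prop :=
  ∀ x y, c x ≠ c y → ∃ z ∈ segment ℝ x y, f z = 0

theorem ConstOffZeros.comp {f c : E → ℝ} (h : ConstOffZeros f c) (F : ℝ → ℝ) :
    ConstOffZeros f fun x => F (c x) :=
  fun x y hxy => h x y fun hc => hxy (congrArg F hc)

theorem abs_le_of_zero_mem_segment {f : E → ℝ} {L : ℝ≥0} (hf : LipschitzWith L f) {x y z : E}
    (hz : z ∈ segment ℝ x y) (hfz : f z = 0) :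
    |f x| + |f y| ≤ L * dist x y ∧ |f x| ≤ L * dist x y ∧ |f y| ≤ L * dist x y := by
  have h1 := hf.dist_le_mul x z
  have h2 := hf.dist_le_mul y z
  have h3 := dist_add_dist_of_mem_segment hz
  rw [hfz, Real.dist_0_eq_abs] at h1 h2
  rw [dist_comm z y] at h3
  have h4 : |f x| + |f y| ≤ L * dist x y := by
    rw [← h3, mul_add]; exact add_le_add h1 h2
  exact ⟨h4, by linarith [abs_nonneg (f y)], by linarith [abs_nonneg (f x)]⟩

theorem ConstOffZeros.lipschitzWith {f c : E → ℝ} (h : ConstOffZeros f c) {L B : ℝ≥0}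
    (hf : LipschitzWith L f) (hc : ∀ x, |c x| ≤ B) : LipschitzWith (B * L) fun x => c x * f x := by
  refine LipschitzWith.of_dist_le_mul fun x y => ?_
  rw [Real.dist_eq, NNReal.coe_mul, mul_assoc]
  by_cases hxy : c x = c y
  · rw [← hxy, ← mul_sub, abs_mul]
    have := hf.dist_le_mul x y
    rw [Real.dist_eq] at this
    exact mul_le_mul (hc x) this (abs_nonneg _) B.2
  · obtain ⟨z, hz, hfz⟩ := h x y hxy
    have h1 := (abs_le_of_zero_mem_segment hf hz hfz).1
    calc |c x * f x - c y * f y| ≤ |c x * f x| + |c y * f y| := abs_sub _ _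
      _ = |c x| * |f x| + |c y| * |f y| := by rw [abs_mul, abs_mul]
      _ ≤ B * |f x| + B * |f y| := by gcongr <;> exact hc _
      _ = B * (|f x| + |f y|) := by ring
      _ ≤ B * (L * dist x y) := by gcongr

end PiecewiseMultiples

namespace DirichletSystem

variable {n : ℕ} {Ω : Set (EuclideanSpace ℝ (Fin n))} {ι : Type*}
  {φ : ι → EuclideanSpace ℝ (Fin n) → ℝ} {lam : ι → ℝ} (S : DirichletSystem Ω φ lam)
include S

/-- If the Dirichlet energy of `w`, as a limit of difference quotients, is at most `B`, then so is
the sum of the energies of the Fourier components of `w`. -/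
theorem sum_energy_le {w : EuclideanSpace ℝ (Fin n) → ℝ} (hw : Continuous w)
    (hw0 : ∀ x, x ∉ Ω → w x = 0) {B : ℝ}
    (hB : ∀ η > 0, ∀ᶠ h in 𝓝[≠] (0 : ℝ), -∫ x, w x * diffQuot (stdDir n) h w x ≤ B + η)
    (F : Finset ι) : ∑ i ∈ F, lam i * ((∫ x, Ω.indicator (φ i) x * w x) ^ 2 /
      ∫ x, Ω.indicator (φ i) x * Ω.indicator (φ i) x) ≤ B := by
  classical
  set b : ι → ℝ := fun i => ∫ x, Ω.indicator (φ i) x * w x with hb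
  set m : ι → ℝ := fun i => ∫ x, Ω.indicator (φ i) x * Ω.indicator (φ i) x with hm
  set a : ι → ℝ := fun i => b i / m i with ha
  set q : EuclideanSpace ℝ (Fin n) → ℝ := fun x => ∑ i ∈ F, a i * Ω.indicator (φ i) x with hq
  have hqc : Continuous q := S.continuous_sum F a
  have hq0 : ∀ x, x ∉ Ω → q x = 0 := S.sum_eq_zero F a
  have hm0 : ∀ i, m i ≠ 0 := fun i => (S.integral_self_pos i).ne'
  have t1 := S.tendsto_integral_mul_diffQuot_sum F a hw hw0
  have t2 := S.tendsto_integral_mul_diffQuot_sum F a hqc hq0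
  set X := ∑ i ∈ F, lam i * (b i ^ 2 / m i) with hX
  have e1 : ∑ i ∈ F, a i * (-lam i * ∫ x, Ω.indicator (φ i) x * w x) = -X := by
    rw [hX, ← Finset.sum_neg_distrib]
    refine Finset.sum_congr rfl fun i _ => ?_
    change b i / m i * (-lam i * b i) = _
    ring
  have e2 : ∑ i ∈ F, a i * (-lam i * ∫ x, Ω.indicator (φ i) x * q x) = -X := by
    rw [hX, ← Finset.sum_neg_distrib]
    refine Finset.sum_congr rfl fun i hi => ?_
    rw [S.integral_indicator_mul_sum, if_pos hi]
    change b i / m i * (-lam i * (b i / m i * m i)) = _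
    rw [div_mul_cancel₀ _ (hm0 i)]
    ring
  rw [e1] at t1
  rw [e2] at t2
  have hwq0 : ∀ x, x ∉ Ω → w x - q x = 0 := fun x hx => by rw [hw0 x hx, hq0 x hx, sub_zero]
  have hwqc : Continuous fun x => w x - q x := hw.sub hqc
  -- the energy of `w - q` is nonnegative
  have hexp : ∀ h : ℝ, 0 ≤ -(∫ x, w x * diffQuot (stdDir n) h w x) +
      2 * (∫ x, w x * diffQuot (stdDir n) h q x) - ∫ x, q x * diffQuot (stdDir n) h q x := by
    intro h
    have hlin : ∀ x, diffQuot (stdDir n) h (fun x => w x - q x) x =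
        diffQuot (stdDir n) h w x - diffQuot (stdDir n) h q x := by
      intro x
      simp only [diffQuot, secondDiff]
      rw [← sub_div, ← Finset.sum_sub_distrib]
      congr 1
      exact Finset.sum_congr rfl fun k _ => by ring
    have h1 : 0 ≤ -∫ x, (w x - q x) * diffQuot (stdDir n) h (fun x => w x - q x) x := by
      rw [integral_mul_diffQuot_eq_neg volume hwqc hwqc (S.hasCompactSupport hwq0), neg_neg]
      exact div_nonneg (Finset.sum_nonneg fun k _ => integral_nonneg fun x => mul_self_nonneg _)
        (sq_nonneg h)
    have hcomm : ∫ x, q x * diffQuot (stdDir n) h w x = ∫ x, w x * diffQuot (stdDir n) h q x :=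
      integral_mul_diffQuot_comm volume hw hqc (S.hasCompactSupport hw0) (S.hasCompactSupport hq0)
        _ _
    have i1 := S.integrable_mul (continuous_diffQuot hw (stdDir n) h) hw hw0
    have i2 := S.integrable_mul (continuous_diffQuot hqc (stdDir n) h) hw hw0
    have i3 := S.integrable_mul (continuous_diffQuot hw (stdDir n) h) hqc hq0
    have i4 := S.integrable_mul (continuous_diffQuot hqc (stdDir n) h) hqc hq0
    have h2 : ∫ x, (w x - q x) * diffQuot (stdDir n) h (fun x => w x - q x) x =
        ((∫ x, w x * diffQuot (stdDir n) h w x) - ∫ x, w x * diffQuot (stdDir n) h q x) -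
        ((∫ x, q x * diffQuot (stdDir n) h w x) - ∫ x, q x * diffQuot (stdDir n) h q x) := by
      rw [← integral_sub' i1 i2, ← integral_sub' i3 i4, ← integral_sub' (i1.sub i2) (i3.sub i4)]
      refine integral_congr_ae (ae_of_all _ fun x => ?_)
      simp only [hlin, Pi.sub_apply]
      ring
    rw [hcomm] at h2
    linarith
  refine le_of_forall_pos_le_add fun η hη => ?_
  have t3 : Tendsto (fun h => B + η + 2 * (∫ x, w x * diffQuot (stdDir n) h q x) -
      ∫ x, q x * diffQuot (stdDir n) h q x) (𝓝[≠] 0) (𝓝 (B + η + 2 * (-X) - (-X))) :=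
    (tendsto_const_nhds.add (t1.const_mul 2)).sub t2
  have h0 : 0 ≤ B + η + 2 * (-X) - (-X) := by
    refine ge_of_tendsto t3 ?_
    filter_upwards [hB η hη] with h hh
    linarith [hexp h]
  linarith

/-- A minimizer of the Dirichlet form on the orthogonal complement of the lower eigenspaces is an
eigenfunction. -/
theorem eq_sum_level_of_energy_le {w : EuclideanSpace ℝ (Fin n) → ℝ} (hw : Continuous w)
    (hw0 : ∀ x, x ∉ Ω → w x = 0) {μ : ℝ}
    (hE : ∀ η > 0, ∀ᶠ h in 𝓝[≠] (0 : ℝ),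
      -∫ x, w x * diffQuot (stdDir n) h w x ≤ μ * (∫ x, w x * w x) + η)
    (horth : ∀ i, lam i < μ → ∫ x, Ω.indicator (φ i) x * w x = 0) :
    ∃ a : ι → ℝ, w = fun x => ∑ i ∈ S.level μ, a i * Ω.indicator (φ i) x := by
  classical
  refine S.eq_sum_of_orthogonal _ hw hw0 fun i hi => ?_
  rw [S.mem_level] at hi
  rcases lt_or_gt_of_ne hi with hlt | hgt
  · exact horth i hlt
  by_contra hne
  set t : ι → ℝ := fun i => (∫ x, Ω.indicator (φ i) x * w x) ^ 2 /
    ∫ x, Ω.indicator (φ i) x * Ω.indicator (φ i) x with ht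
  have htn : ∀ j, 0 ≤ t j := fun j => div_nonneg (sq_nonneg _) (S.integral_self_pos j).le
  have hti : 0 < t i := div_pos (by positivity) (S.integral_self_pos i)
  set η := (lam i - μ) * t i with hη
  have hη0 : 0 < η := mul_pos (by linarith) hti
  obtain ⟨F, hiF, hF⟩ := S.exists_integral_sub_le_sum i hw hw0
    (show 0 < η / (2 * (|μ| + 1)) by positivity)
  change _ ≤ ∑ i ∈ F, t i at hF
  have h1 := S.sum_energy_le hw hw0 hE F
  change ∑ i ∈ F, lam i * t i ≤ _ at h1
  have hbessel : ∑ i ∈ F, t i ≤ ∫ x, w x * w x := S.sum_sq_div_le_integral F hw hw0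
  have h2 : ∑ j ∈ F, lam j * t j ≥ ∑ j ∈ F, (μ * t j + if j = i then η else 0) := by
    refine Finset.sum_le_sum fun j _ => ?_
    split_ifs with hji
    · subst hji; rw [hη]; linarith
    · rw [add_zero]
      rcases lt_or_ge (lam j) μ with h | h
      · have : t j = 0 := by simp only [ht, horth j h]; simp
        simp [this]
      · exact mul_le_mul_of_nonneg_right h (htn j)
  rw [Finset.sum_add_distrib, ← Finset.mul_sum, Finset.sum_ite_eq' F i, if_pos hiF] at h2
  have h3 : μ * ((∫ x, w x * w x) - ∑ j ∈ F, t j) ≤ |μ| * (η / (2 * (|μ| + 1))) :=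
    mul_le_mul (le_abs_self μ) (by linarith) (by linarith) (abs_nonneg μ)
  have h4 : |μ| * (η / (2 * (|μ| + 1))) < η := by
    rw [← mul_div_assoc, div_lt_iff₀ (by positivity)]
    nlinarith [abs_nonneg μ]
  linarith

/-- The energy of a piecewise multiple `c f` of an eigenfunction `f` with eigenvalue `μ` is at most
`μ ‖c f‖²`. In the identity
`(c' f' - c f)² = (c'² f' - c² f) (f' - f) + f f' (c - c')²`
the first term sums to `μ ∫ c² f²` in the limit, and the last one is positive only at
points where `0 < |f| = O(h)`. -/
theorem energy_piecewise_le {μ : ℝ} {f c : EuclideanSpace ℝ (Fin n) → ℝ} (hf : f ∈ eigenspace Ω μ)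
    (hc : ConstOffZeros f c) {B : ℝ≥0} (hB : ∀ x, |c x| ≤ B) {L : ℝ≥0} (hL : LipschitzWith L f) :
    ∀ η > 0, ∀ᶠ h in 𝓝[≠] (0 : ℝ),
      -∫ x, (c x * f x) * diffQuot (stdDir n) h (fun x => c x * f x) x ≤
        μ * (∫ x, (c x * f x) * (c x * f x)) + η := by
  obtain ⟨a, ha⟩ := S.mem_eigenspace_iff.1 hf
  have hfc : Continuous f := hf.1
  have hf0 : ∀ x, x ∉ Ω → f x = 0 := hf.2.1
  set w : EuclideanSpace ℝ (Fin n) → ℝ := fun x => c x * f x with hw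
  set g : EuclideanSpace ℝ (Fin n) → ℝ := fun x => c x ^ 2 * f x with hg
  have hwc : Continuous w := (hc.lipschitzWith hL hB).continuous
  have hgc : Continuous g := ((hc.comp (· ^ 2)).lipschitzWith (B := B ^ 2) hL fun x => by
    rw [abs_pow, NNReal.coe_pow]; gcongr; exact hB x).continuous
  have hw0 : ∀ x, x ∉ Ω → w x = 0 := fun x hx => by simp [hw, hf0 x hx]
  have hg0 : ∀ x, x ∉ Ω → g x = 0 := fun x hx => by simp [hg, hf0 x hx]
  have t1 : Tendsto (fun h => -∫ x, g x * diffQuot (stdDir n) h f x) (𝓝[≠] 0)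
      (𝓝 (μ * ∫ x, w x * w x)) := by
    have h1 := (S.tendsto_integral_mul_diffQuot_sum (S.level μ) a hgc hg0).neg
    have h2 : -∑ i ∈ S.level μ, a i * (-lam i * ∫ x, Ω.indicator (φ i) x * g x) =
        μ * ∫ x, w x * w x := by
      have h3 : ∫ x, w x * w x = ∫ x, g x * f x :=
        integral_congr_ae (ae_of_all _ fun x => by simp only [hw, hg]; ring)
      rw [h3]
      conv_rhs => rw [ha]
      rw [S.integral_mul_sum _ _ hgc, Finset.mul_sum, ← Finset.sum_neg_distrib]
      refine Finset.sum_congr rfl fun i hi => ?_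
      rw [S.mem_level.1 hi]
      ring
    rw [h2, ← ha] at h1
    exact h1
  -- the set of points where the error term can be positive
  set Z : ℝ → Set (EuclideanSpace ℝ (Fin n)) := fun h => {x | f x ≠ 0 ∧ |f x| ≤ L * |h|} with hZ
  have hZm : ∀ h, MeasurableSet (Z h) := fun h =>
    ((isOpen_ne_fun hfc continuous_const).measurableSet).inter
      (isClosed_le hfc.abs continuous_const).measurableSet
  have hZΩ : ∀ h, Z h ⊆ Ω := fun h x hx => by
    by_contra hxΩ
    exact hx.1 (hf0 x hxΩ)
  have hΩfin : volume Ω ≠ ⊤ := S.bounded.measure_lt_top.ne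
  have hΩint : Integrable (Ω.indicator fun _ => (1 : ℝ))
      (volume : Measure (EuclideanSpace ℝ (Fin n))) :=
    (integrable_indicator_iff S.isOpen.measurableSet).2 (integrableOn_const hΩfin)
  have hZint : ∀ h, Integrable ((Z h).indicator fun _ => (1 : ℝ))
      (volume : Measure (EuclideanSpace ℝ (Fin n))) := fun h =>
    (integrable_indicator_iff (hZm h)).2
      (integrableOn_const (ne_top_of_le_ne_top hΩfin (measure_mono (hZΩ h))))
  have t2 : Tendsto (fun h => ∫ x, (Z h).indicator (fun _ => (1 : ℝ)) x) (𝓝[≠] 0) (𝓝 0) := by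
    suffices h : Tendsto (fun h => ∫ x, (Z h).indicator (fun _ => (1 : ℝ)) x) (𝓝[≠] 0)
        (𝓝 (∫ _x : EuclideanSpace ℝ (Fin n), (0 : ℝ))) by simpa only [integral_zero] using h
    refine tendsto_integral_filter_of_dominated_convergence (Ω.indicator fun _ => (1 : ℝ))
      (Eventually.of_forall fun h => (hZint h).aestronglyMeasurable)
      (Eventually.of_forall fun h => ae_of_all _ fun x => ?_) hΩint (ae_of_all _ fun x => ?_)
    · rw [Real.norm_of_nonneg (indicator_nonneg (fun _ _ => zero_le_one) _)]
      exact indicator_le_indicator_of_subset (hZΩ h) (fun _ => zero_le_one) x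
    · refine tendsto_const_nhds.congr' ?_
      by_cases hfx : f x = 0
      · exact Eventually.of_forall fun h => by simp [hZ, hfx]
      · have hpos : 0 < |f x| / (L + 1) := by positivity
        filter_upwards [eventually_abs_lt hpos] with h hh
        rw [lt_div_iff₀ (by positivity)] at hh
        rw [indicator_of_notMem]
        rintro ⟨-, hx⟩
        nlinarith [abs_nonneg h]
  set M : ℝ := n * (4 * B ^ 2 * L ^ 2) with hM
  have t3 : Tendsto (fun h => (-∫ x, g x * diffQuot (stdDir n) h f x) +
      M * ∫ x, (Z h).indicator (fun _ => (1 : ℝ)) x) (𝓝[≠] 0)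
      (𝓝 (μ * (∫ x, w x * w x) + M * 0)) := t1.add (t2.const_mul M)
  rw [mul_zero, add_zero] at t3
  intro η hη
  filter_upwards [t3.eventually (gt_mem_nhds (lt_add_of_pos_right _ hη)), self_mem_nhdsWithin]
    with h hh hne
  refine le_trans ?_ hh.le
  have hne' : h ≠ 0 := hne
  rw [integral_mul_diffQuot_eq_neg volume hwc hwc (S.hasCompactSupport hw0),
    integral_mul_diffQuot_eq_neg volume hfc hgc (S.hasCompactSupport hg0), neg_neg, neg_neg,
    div_le_iff₀ (by positivity), add_mul, div_mul_cancel₀ _ (by positivity)]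
  have hdist : ∀ (x : EuclideanSpace ℝ (Fin n)) (k : Fin n), dist x (x + h • stdDir n k) = |h| := by
    intro x k
    rw [dist_self_add_right, norm_smul, norm_stdDir, mul_one, Real.norm_eq_abs]
  have hk : ∀ k, ∫ x, (w (x + h • stdDir n k) - w x) * (w (x + h • stdDir n k) - w x) ≤
      (∫ x, (g (x + h • stdDir n k) - g x) * (f (x + h • stdDir n k) - f x)) +
      4 * B ^ 2 * (L * h) ^ 2 * ∫ x, (Z h).indicator (fun _ => (1 : ℝ)) x := by
    intro k
    set u := h • stdDir n k with hu
    have hsupp : ∀ {p : EuclideanSpace ℝ (Fin n) → ℝ}, (∀ x, x ∉ Ω → p x = 0) →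
        HasCompactSupport fun x => p (x + u) - p x := fun hp => by
      have h1 : HasCompactSupport fun x => _ :=
        (S.hasCompactSupport hp).comp_homeomorph (Homeomorph.addRight u)
      exact h1.sub (S.hasCompactSupport hp)
    have hdc : ∀ {p : EuclideanSpace ℝ (Fin n) → ℝ}, Continuous p →
        Continuous fun x => p (x + u) - p x := fun hp => by fun_prop
    have i1 : Integrable fun x => (w (x + u) - w x) * (w (x + u) - w x) :=
      integrable_mul_of_continuous volume (hdc hwc) (hdc hwc) (hsupp hw0)
    have i2 : Integrable fun x => (g (x + u) - g x) * (f (x + u) - f x) :=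
      integrable_mul_of_continuous volume (hdc hfc) (hdc hgc) (hsupp hg0)
    rw [← integral_const_mul, ← integral_add i2 ((hZint h).const_mul _)]
    refine integral_mono i1 (i2.add ((hZint h).const_mul _)) fun x => ?_
    have hid : (w (x + u) - w x) * (w (x + u) - w x) =
        (g (x + u) - g x) * (f (x + u) - f x) + f x * f (x + u) * (c x - c (x + u)) ^ 2 := by
      simp only [hw, hg]; ring
    simp only [hid]
    refine add_le_add le_rfl ?_
    have hnn : 0 ≤ 4 * (B : ℝ) ^ 2 * (L * h) ^ 2 * (Z h).indicator (fun _ => (1 : ℝ)) x :=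
      mul_nonneg (by positivity) (indicator_nonneg (fun _ _ => zero_le_one) _)
    by_cases hfx : f x = 0
    · simpa [hfx] using hnn
    by_cases hcx : c x = c (x + u)
    · simpa [hcx] using hnn
    obtain ⟨z, hz, hfz⟩ := hc x (x + u) hcx
    obtain ⟨-, h1, h2⟩ := abs_le_of_zero_mem_segment hL hz hfz
    rw [hdist] at h1 h2
    have hxZ : x ∈ Z h := ⟨hfx, h1⟩
    rw [indicator_of_mem hxZ, mul_one]
    have h3 : f x * f (x + u) ≤ (L * h) ^ 2 := by
      calc f x * f (x + u) ≤ |f x * f (x + u)| := le_abs_self _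
        _ = |f x| * |f (x + u)| := abs_mul _ _
        _ ≤ (L * |h|) * (L * |h|) := by gcongr
        _ = (L * h) ^ 2 := by rw [mul_pow, ← sq_abs h]; ring
    have h4 : (c x - c (x + u)) ^ 2 ≤ 4 * (B : ℝ) ^ 2 := by
      have h5 : |c x - c (x + u)| ≤ 2 * B := by
        refine (abs_sub _ _).trans ?_
        linarith [hB x, hB (x + u)]
      calc (c x - c (x + u)) ^ 2 = |c x - c (x + u)| ^ 2 := (sq_abs _).symm
        _ ≤ (2 * B) ^ 2 := by gcongr
        _ = 4 * (B : ℝ) ^ 2 := by ring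
    calc f x * f (x + u) * (c x - c (x + u)) ^ 2 ≤ (L * h) ^ 2 * (c x - c (x + u)) ^ 2 := by
          gcongr
      _ ≤ (L * h) ^ 2 * (4 * (B : ℝ) ^ 2) := by gcongr
      _ = 4 * (B : ℝ) ^ 2 * (L * h) ^ 2 := by ring
  refine (Finset.sum_le_sum fun k _ => hk k).trans (le_of_eq ?_)
  rw [Finset.sum_add_distrib]
  simp only [Finset.sum_const, Finset.card_univ, Fintype.card_fin, nsmul_eq_mul, hM]
  ring

end DirichletSystem

/-! ### Courant's nodal domain theorem -/

section NodalDomainSets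

variable {n : ℕ} {Ω : Set (EuclideanSpace ℝ (Fin n))} {f : EuclideanSpace ℝ (Fin n) → ℝ}

/-- The nodal domain `D`, as a set of points of the space. -/
def domainSet (D : NodalDomains Ω f) : Set (EuclideanSpace ℝ (Fin n)) :=
  {x | ∃ h : x ∈ Ω ∧ f x ≠ 0, (ConnectedComponents.mk ⟨x, h⟩ : NodalDomains Ω f) = D}

theorem mem_domainSet_of_segment {D : NodalDomains Ω f} {x y : EuclideanSpace ℝ (Fin n)}
    (hx : x ∈ domainSet D) (hseg : ∀ z ∈ segment ℝ x y, z ∈ Ω ∧ f z ≠ 0) : y ∈ domainSet D := by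
  obtain ⟨hx', rfl⟩ := hx
  refine ⟨hseg y (right_mem_segment ℝ x y), ?_⟩
  have hpre : IsPreconnected {z : {x // x ∈ Ω ∧ f x ≠ 0} | z.1 ∈ segment ℝ x y} := by
    have himg : Subtype.val '' {z : {x // x ∈ Ω ∧ f x ≠ 0} | z.1 ∈ segment ℝ x y} =
        segment ℝ x y := by
      ext z
      constructor
      · rintro ⟨w, hw, rfl⟩; exact hw
      · intro hz; exact ⟨⟨z, hseg z hz⟩, hz, rfl⟩
    refine (Topology.IsInducing.isPreconnected_image (f := Subtype.val) ⟨rfl⟩).1 ?_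
    rw [himg]
    exact (convex_segment x y).isPreconnected
  rw [ConnectedComponents.coe_eq_coe']
  exact hpre.subset_connectedComponent (left_mem_segment ℝ x y) (right_mem_segment ℝ x y)

theorem constOffZeros_domainSet (hf0 : ∀ x, x ∉ Ω → f x = 0) {κ : Type*} (F : Finset κ)
    (D : κ → NodalDomains Ω f) (α : κ → ℝ) :
    ConstOffZeros f fun x => ∑ k ∈ F, α k * (domainSet (D k)).indicator (fun _ => 1) x := by
  intro x y hxy
  by_contra! hcon
  have hseg : ∀ z ∈ segment ℝ x y, z ∈ Ω ∧ f z ≠ 0 := fun z hz =>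
    ⟨by_contra fun h => hcon z hz (hf0 z h), hcon z hz⟩
  refine hxy (Finset.sum_congr rfl fun k _ => ?_)
  have hiff : x ∈ domainSet (D k) ↔ y ∈ domainSet (D k) :=
    ⟨fun h => mem_domainSet_of_segment h hseg,
      fun h => mem_domainSet_of_segment h fun z hz => hseg z (by rwa [segment_symm])⟩
  by_cases hx : x ∈ domainSet (D k)
  · simp [hx, hiff.1 hx]
  · simp [hx, mt hiff.2 hx]

theorem exists_mem_domainSet (D : NodalDomains Ω f) : ∃ x, x ∈ domainSet D := by
  obtain ⟨⟨x, hx⟩, rfl⟩ := ConnectedComponents.surjective_coe D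
  exact ⟨x, hx, rfl⟩

theorem eq_of_mem_domainSet {D D' : NodalDomains Ω f} {x : EuclideanSpace ℝ (Fin n)}
    (h : x ∈ domainSet D) (h' : x ∈ domainSet D') : D = D' := by
  obtain ⟨_, rfl⟩ := h
  obtain ⟨_, rfl⟩ := h'
  rfl

theorem domainSet_mem_nhds (hΩ : IsOpen Ω) (hf : Continuous f) {D : NodalDomains Ω f}
    {x : EuclideanSpace ℝ (Fin n)} (hx : x ∈ domainSet D) : domainSet D ∈ 𝓝 x := by
  have hopen : IsOpen (Ω ∩ {x | f x ≠ 0}) := hΩ.inter (isOpen_ne_fun hf continuous_const)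
  obtain ⟨h, -⟩ := id hx
  obtain ⟨r, hr, hball⟩ := Metric.isOpen_iff.1 hopen x h
  filter_upwards [Metric.ball_mem_nhds x hr] with y hy
  exact mem_domainSet_of_segment hx fun z hz =>
    hball ((convex_ball x r).segment_subset (Metric.mem_ball_self hr) hy hz)

end NodalDomainSets

namespace DirichletSystem

variable {n : ℕ} {Ω : Set (EuclideanSpace ℝ (Fin n))} {ι : Type*}
  {φ : ι → EuclideanSpace ℝ (Fin n) → ℝ} {lam : ι → ℝ} (S : DirichletSystem Ω φ lam)
include S

theorem exists_lipschitzWith {μ : ℝ} {f : EuclideanSpace ℝ (Fin n) → ℝ}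
    (hf : f ∈ eigenspace Ω μ) : ∃ L, LipschitzWith L f := by
  obtain ⟨a, rfl⟩ := S.mem_eigenspace_iff.1 hf
  have : ∀ F : Finset ι, ∃ L, LipschitzWith L fun x => ∑ i ∈ F, a i * Ω.indicator (φ i) x := by
    classical
    intro F
    induction F using Finset.induction_on with
    | empty => exact ⟨0, by simp⟩
    | insert i F hi ih =>
      obtain ⟨L, hL⟩ := ih
      obtain ⟨L', hL'⟩ := S.lipschitz i
      have h1 := (lipschitzWith_smul (a i)).comp (lipschitzWith_indicator hL' (S.boundary i))
      refine ⟨‖a i‖₊ * L' + L, ?_⟩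
      simp only [Finset.sum_insert hi]
      exact h1.add hL
  exact this _

/-- If an eigenfunction `f` with eigenvalue `μ` had two nodal domains more than there are functions
of the system with smaller eigenvalue, a combination of `f` restricted to all but one of these
domains would minimize the Dirichlet form among functions orthogonal to the lower eigenspaces. It
would be an eigenfunction that vanishes on an open set. -/
theorem not_injective_nodalDomains {μ : ℝ} {f : EuclideanSpace ℝ (Fin n) → ℝ}
    (hf : f ∈ eigenspace Ω μ) {d : ℕ} (hd : {i | lam i < μ}.ncard = d)
    (D : Fin (d + 2) → NodalDomains Ω f) : ¬ Function.Injective D := by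
  classical
  intro hD
  have hfin : {i | lam i < μ}.Finite := (S.finite μ).subset fun i (hi : lam i < μ) => hi.le
  have hfc : Continuous f := hf.1
  have hf0 : ∀ x, x ∉ Ω → f x = 0 := hf.2.1
  obtain ⟨L, hL⟩ := S.exists_lipschitzWith hf
  have : Fintype {i | lam i < μ} := hfin.fintype
  have hone : ∀ (k : Fin (d + 2)) x, |(domainSet (D k)).indicator (fun _ => (1 : ℝ)) x| ≤ 1 := by
    intro k x
    by_cases hx : x ∈ domainSet (D k) <;> simp [hx]
  have huc : ∀ k, Continuous fun x => (domainSet (D k)).indicator (fun _ => (1 : ℝ)) x * f x := by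
    intro k
    have h1 := constOffZeros_domainSet hf0 {k} D (fun _ => 1)
    simp only [Finset.sum_singleton, one_mul] at h1
    exact (h1.lipschitzWith (B := 1) hL (hone k)).continuous
  -- a nontrivial combination orthogonal to the lower eigenspaces
  let A : (Fin (d + 1) → ℝ) →ₗ[ℝ] ({i | lam i < μ} → ℝ) :=
    Matrix.mulVecLin (Matrix.of fun i k => ∫ x, Ω.indicator (φ i) x *
      ((domainSet (D (Fin.castSucc k))).indicator (fun _ => (1 : ℝ)) x * f x))
  have hker : LinearMap.ker A ≠ ⊥ := by
    apply LinearMap.ker_ne_bot_of_finrank_lt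
    have hc : Fintype.card {i | lam i < μ} = d := by
      rw [← hd, ← Nat.card_coe_set_eq, Nat.card_eq_fintype_card]
    simp only [Module.finrank_fintype_fun_eq_card, Fintype.card_fin]
    omega
  obtain ⟨α, hα, hα0⟩ := Submodule.exists_mem_ne_zero_of_ne_bot hker
  set c : EuclideanSpace ℝ (Fin n) → ℝ := fun x => ∑ k ∈ Finset.univ, α k *
    (domainSet (D (Fin.castSucc k))).indicator (fun _ => 1) x with hc
  have hcf : ConstOffZeros f c := constOffZeros_domainSet hf0 Finset.univ (D ∘ Fin.castSucc) α
  have hcB : ∀ x, |c x| ≤ ((∑ k, ‖α k‖₊ : ℝ≥0) : ℝ) := by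
    intro x
    refine (Finset.abs_sum_le_sum_abs _ _).trans ?_
    rw [NNReal.coe_sum]
    refine Finset.sum_le_sum fun k _ => ?_
    rw [abs_mul, coe_nnnorm, Real.norm_eq_abs]
    exact mul_le_of_le_one_right (abs_nonneg _) (hone _ x)
  have hwc : Continuous fun x => c x * f x := (hcf.lipschitzWith hL hcB).continuous
  have hw0 : ∀ x, x ∉ Ω → c x * f x = 0 := fun x hx => by rw [hf0 x hx, mul_zero]
  have horth : ∀ i, lam i < μ → ∫ x, Ω.indicator (φ i) x * (c x * f x) = 0 := by
    intro i hi
    have h1 := congrFun (LinearMap.mem_ker.1 hα) ⟨i, hi⟩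
    simp only [A, Matrix.mulVecLin_apply, Matrix.mulVec, dotProduct, Matrix.of_apply,
      Pi.zero_apply] at h1
    rw [← h1]
    simp only [← integral_mul_const]
    rw [← integral_finsetSum]
    · refine integral_congr_ae (ae_of_all _ fun x => ?_)
      simp only [hc, Finset.sum_mul, Finset.mul_sum]
      exact Finset.sum_congr rfl fun k _ => by ring
    · exact fun k _ => (S.integrable_mul (huc _) (S.continuous_indicator i)
        (S.indicator_eq_zero i)).mul_const _
  obtain ⟨a, ha⟩ := S.eq_sum_level_of_energy_le hwc hw0 (S.energy_piecewise_le hf hcf hcB hL) horth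
  -- the combination agrees on `Ω` with an analytic function, which vanishes on the last domain
  set q : EuclideanSpace ℝ (Fin n) → ℝ := fun x => ∑ i ∈ S.level μ, a i * φ i x with hq
  have hqa : AnalyticOnNhd ℝ q univ := by
    have := Finset.analyticOnNhd_fun_sum (S.level μ) (f := fun i x => a i * φ i x) (s := univ)
      (𝕜 := ℝ) fun i _ => analyticOnNhd_const.mul (S.analytic i)
    exact this
  have hqw : ∀ x ∈ Ω, q x = c x * f x := fun x hx => by
    rw [congrFun ha x]; simp [hq, hx]
  obtain ⟨x₀, hx₀⟩ := exists_mem_domainSet (D (Fin.last (d + 1)))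
  have hq0 : q =ᶠ[𝓝 x₀] fun _ => 0 := by
    filter_upwards [domainSet_mem_nhds S.isOpen hfc hx₀] with x hx
    obtain ⟨⟨hxΩ, -⟩, -⟩ := id hx
    rw [hqw x hxΩ]
    have : c x = 0 := Finset.sum_eq_zero fun k _ => by
      rw [indicator_of_notMem, mul_zero]
      intro hk
      exact (Fin.castSucc_lt_last k).ne (hD (eq_of_mem_domainSet hk hx))
    rw [this, zero_mul]
  have hqz : q = fun _ => 0 := hqa.eq_of_eventuallyEq analyticOnNhd_const hq0
  apply hα0
  funext k
  obtain ⟨x, hx⟩ := exists_mem_domainSet (D (Fin.castSucc k))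
  obtain ⟨⟨hxΩ, hfx⟩, -⟩ := id hx
  have h1 := hqw x hxΩ
  rw [hqz] at h1
  have h2 : c x = α k := by
    simp only [hc]
    rw [Finset.sum_eq_single_of_mem k (Finset.mem_univ k), indicator_of_mem hx, mul_one]
    intro j _ hj
    rw [indicator_of_notMem, mul_zero]
    intro hxj
    exact hj (Fin.castSucc_injective _ (hD (eq_of_mem_domainSet hxj hx)))
  rw [h2] at h1
  exact (mul_eq_zero.1 h1.symm).resolve_right hfx

/-- Courant's nodal domain theorem. -/
theorem finite_nodalDomains_and_le {μ : ℝ} {f : EuclideanSpace ℝ (Fin n) → ℝ}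
    (hf : f ∈ eigenspace Ω μ) :
    Finite (NodalDomains Ω f) ∧ nodalCount Ω f ≤ {i | lam i < μ}.ncard + 1 := by
  have hfin : Finite (NodalDomains Ω f) := by
    by_contra hinf
    rw [not_finite_iff_infinite] at hinf
    exact S.not_injective_nodalDomains hf rfl
      (fun k => Infinite.natEmbedding (NodalDomains Ω f) k)
      ((Infinite.natEmbedding _).injective.comp Fin.val_injective)
  refine ⟨hfin, ?_⟩
  by_contra! hlt
  rw [nodalCount] at hlt
  have e := Finite.equivFin (NodalDomains Ω f)
  exact S.not_injective_nodalDomains hf rfl (fun k => e.symm (Fin.castLE hlt k))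
    (e.symm.injective.comp (Fin.castLE_injective _))

theorem nodalCount_le_count {μ : ℝ} {f : EuclideanSpace ℝ (Fin n) → ℝ}
    (hf : IsEigenfunction Ω μ f) : nodalCount Ω f ≤ count Ω μ := by
  obtain ⟨i, rfl⟩ := S.isEigenvalue_iff.1 ⟨f, hf⟩
  rw [S.count_eq]
  exact (S.finite_nodalDomains_and_le hf.1).2

theorem deficiencyWellDefined (i : ι) : DeficiencyWellDefined Ω (lam i) where
  finite_spectrum := S.finite_spectrum _
  finite_multiplicity := fun μ _ => S.finiteDimensional_eigenspace μ
  finite_nodalDomains := fun f hf => (S.finite_nodalDomains_and_le hf.1).1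
  isLeast := by
    obtain ⟨f, hf⟩ := S.isEigenvalue_iff.2 ⟨i, rfl⟩
    have hne : (deficiencySet Ω (lam i)).Nonempty := ⟨_, f, hf, rfl⟩
    have hbdd : BddBelow (deficiencySet Ω (lam i)) := by
      refine ⟨0, ?_⟩
      rintro _ ⟨g, hg, rfl⟩
      have := S.nodalCount_le_count hg
      rw [eigenfunctionDeficiency]
      omega
    exact ⟨Int.csInf_mem hne hbdd, fun d hd => csInf_le hbdd hd⟩

theorem nodalDeficiency_nonneg (i : ι) : 0 ≤ nodalDeficiency Ω (lam i) := by
  obtain ⟨f, hf, h⟩ := (S.deficiencyWellDefined i).isLeast.1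
  have := S.nodalCount_le_count hf
  rw [← h, eigenfunctionDeficiency]
  omega

end DirichletSystem

/-! ### Completeness from Stone–Weierstrass -/

theorem continuous_of_locally_zero_div {X : Type*} [TopologicalSpace X] {w f : X → ℝ}
    (hw : Continuous w) (hf : Continuous f) (hne : ∀ x, w x ≠ 0 → f x ≠ 0) {δ : ℝ} (hδ : 0 < δ) :
    Continuous fun x => (w x - max (-δ) (min (w x) δ)) / f x := by
  rw [continuous_iff_continuousAt]
  intro x
  by_cases hx : w x = 0
  · have hev : (fun x => (w x - max (-δ) (min (w x) δ)) / f x) =ᶠ[𝓝 x] fun _ => 0 := by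
      have : ∀ᶠ y in 𝓝 x, w y ∈ Ioo (-δ) δ :=
        hw.continuousAt (Ioo_mem_nhds (by rw [hx]; linarith) (by rw [hx]; linarith))
      filter_upwards [this] with y hy
      rw [min_eq_left hy.2.le, max_eq_right hy.1.le, sub_self, zero_div]
    exact continuousAt_const.congr hev.symm
  · exact ContinuousAt.div (by fun_prop) hf.continuousAt (hne x hx)

/-- A family of continuous functions is total among the continuous functions on `closure Ω` that
vanish outside `Ω`, if its span is stable under multiplication by functions that separate the points
of `closure Ω`, and one of its members has no zeros in `Ω`. -/
theorem exists_mem_span_near {E : Type*} [PseudoMetricSpace E] [ProperSpace E] {Ω : Set E}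
    (hbdd : Bornology.IsBounded Ω) {ι : Type*} {φ : ι → E → ℝ} (hφ : ∀ i, Continuous (φ i))
    (G : Set (E → ℝ)) (hGc : ∀ g ∈ G, Continuous g)
    (hGmul : ∀ g ∈ G, ∀ i, g * φ i ∈ Submodule.span ℝ (range φ))
    (hGsep : ∀ x ∈ closure Ω, ∀ y ∈ closure Ω, x ≠ y → ∃ g ∈ G, g x ≠ g y)
    (i₀ : ι) (hi₀ : ∀ x ∈ Ω, φ i₀ x ≠ 0) (w : E → ℝ) (hw : Continuous w)
    (hw0 : ∀ x, x ∉ Ω → w x = 0) (ε : ℝ) (hε : 0 < ε) :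
    ∃ p ∈ Submodule.span ℝ (range φ), ∀ x ∈ Ω, |w x - p x| ≤ ε := by
  have hK : IsCompact (closure Ω) := hbdd.isCompact_closure
  have : CompactSpace (closure Ω) := isCompact_iff_compactSpace.1 hK
  -- the continuous multipliers of the span, restricted to the closure
  let A : Subalgebra ℝ C(closure Ω, ℝ) :=
    { carrier := {h | ∃ g : E → ℝ, (∀ x : closure Ω, h x = g x) ∧
        ∀ p ∈ Submodule.span ℝ (range φ), g * p ∈ Submodule.span ℝ (range φ)}
      mul_mem' := by
        rintro h k ⟨g, hg, hg'⟩ ⟨g₂, hg₂, hg₂'⟩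
        exact ⟨g * g₂, fun x => by simp [hg, hg₂], fun p hp => by
          rw [mul_assoc]; exact hg' _ (hg₂' _ hp)⟩
      add_mem' := by
        rintro h k ⟨g, hg, hg'⟩ ⟨g₂, hg₂, hg₂'⟩
        exact ⟨g + g₂, fun x => by simp [hg, hg₂], fun p hp => by
          rw [add_mul]; exact Submodule.add_mem _ (hg' _ hp) (hg₂' _ hp)⟩
      algebraMap_mem' := fun r => ⟨fun _ => r, fun x => rfl, fun p hp => by
        have : (fun _ => r) * p = r • p := by funext x; simp
        rw [this]; exact Submodule.smul_mem _ _ hp⟩ }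
  have hGA : ∀ g (hg : g ∈ G),
      (⟨fun x : closure Ω => g x, (hGc g hg).comp continuous_subtype_val⟩ : C(closure Ω, ℝ)) ∈ A := by
    intro g hg
    refine ⟨g, fun x => rfl, fun p hp => ?_⟩
    induction hp using Submodule.span_induction with
    | mem p hp => obtain ⟨i, rfl⟩ := hp; exact hGmul g hg i
    | zero => rw [mul_zero]; exact Submodule.zero_mem _
    | add p q _ _ hp hq => rw [mul_add]; exact Submodule.add_mem _ hp hq
    | smul c p _ hp => rw [mul_smul_comm]; exact Submodule.smul_mem _ _ hp
  have hsep : A.SeparatesPoints := by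
    intro x y hxy
    obtain ⟨g, hg, hgxy⟩ := hGsep x x.2 y y.2 fun h => hxy (Subtype.ext h)
    exact ⟨_, ⟨_, hGA g hg, rfl⟩, hgxy⟩
  obtain ⟨M, hM⟩ := hK.exists_bound_of_continuousOn (hφ i₀).continuousOn
  set δ := ε / 2 with hδ
  have hδ0 : 0 < δ := half_pos hε
  set F : ℝ → ℝ := fun t => t - max (-δ) (min t δ) with hF
  have hFd : ∀ t, |t - F t| ≤ δ := by
    intro t
    simp only [hF, sub_sub_cancel]
    exact abs_le.2 ⟨le_max_left _ _, max_le (by linarith) (min_le_right _ _)⟩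
  have hF0 : F 0 = 0 := by
    simp only [hF]
    rw [min_eq_left hδ0.le, max_eq_right (by linarith), sub_zero]
  have hqc : Continuous fun x : closure Ω => F (w x) / φ i₀ x :=
    continuous_of_locally_zero_div (hw.comp continuous_subtype_val)
      ((hφ i₀).comp continuous_subtype_val)
      (fun x hx => hi₀ x.1 (by_contra fun h => hx (hw0 x.1 h))) hδ0
  obtain ⟨⟨h, g, hg, hg'⟩, hhq⟩ :=
    ContinuousMap.exists_mem_subalgebra_near_continuous_of_separatesPoints A hsep _ hqc
      (δ / (|M| + 1)) (by positivity)
  refine ⟨g * φ i₀, hg' _ (Submodule.subset_span ⟨i₀, rfl⟩), fun x hx => ?_⟩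
  have hx' : x ∈ closure Ω := subset_closure hx
  have h1 := hhq ⟨x, hx'⟩
  simp only [hg] at h1
  have hne := hi₀ x hx
  have h2 : |F (w x) - g x * φ i₀ x| ≤ δ := by
    have h3 : F (w x) - g x * φ i₀ x = -((g x - F (w x) / φ i₀ x) * φ i₀ x) := by
      field_simp; ring
    rw [h3, abs_neg, abs_mul]
    have h4 : |φ i₀ x| ≤ |M| := (hM x hx').trans (le_abs_self M)
    rw [Real.norm_eq_abs, lt_div_iff₀ (by positivity)] at h1
    calc _ ≤ |g x - F (w x) / φ i₀ x| * (|M| + 1) := by gcongr; linarith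
      _ ≤ δ := h1.le
  calc |w x - (g * φ i₀) x| = |(w x - F (w x)) + (F (w x) - g x * φ i₀ x)| := by
        congr 1; simp
    _ ≤ δ + δ := (abs_add_le _ _).trans (add_le_add (hFd _) h2)
    _ = ε := by rw [hδ]; ring

/-! ### Products of sines on boxes -/

theorem LipschitzWith.mul_of_abs_le_one {E : Type*} [PseudoMetricSpace E] {f g : E → ℝ} {K L : ℝ≥0}
    (hf : LipschitzWith K f) (hg : LipschitzWith L g) (hf1 : ∀ x, |f x| ≤ 1) (hg1 : ∀ x, |g x| ≤ 1) :
    LipschitzWith (K + L) fun x => f x * g x := by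
  refine LipschitzWith.of_dist_le_mul fun x y => ?_
  have h1 := hf.dist_le_mul x y
  have h2 := hg.dist_le_mul x y
  rw [Real.dist_eq] at *
  rw [NNReal.coe_add, add_mul]
  calc |f x * g x - f y * g y| = |(f x - f y) * g x + f y * (g x - g y)| := by congr 1; ring
    _ ≤ |f x - f y| * |g x| + |f y| * |g x - g y| := by
        rw [← abs_mul, ← abs_mul]; exact abs_add_le _ _
    _ ≤ |f x - f y| * 1 + 1 * |g x - g y| := by gcongr; exacts [hg1 x, hf1 y]
    _ ≤ _ := by rw [mul_one, one_mul]; exact add_le_add h1 h2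

section Box

variable {n : ℕ}

/-- The open box with edges `π / a j`. -/
def boxDomain (a : Fin n → ℝ) : Set (EuclideanSpace ℝ (Fin n)) :=
  {x | ∀ j, 0 < x j ∧ x j < Real.pi / a j}

/-- The product of the functions `sin (a j * m j * x j)`. -/
def sinProd (a : Fin n → ℝ) (m : Fin n → ℕ) (x : EuclideanSpace ℝ (Fin n)) : ℝ :=
  ∏ j, Real.sin (a j * m j * x j)

theorem continuous_sinProd (a : Fin n → ℝ) (m : Fin n → ℕ) : Continuous (sinProd a m) := by
  unfold sinProd
  fun_prop

theorem analyticOnNhd_sinProd (a : Fin n → ℝ) (m : Fin n → ℕ) :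
    AnalyticOnNhd ℝ (sinProd a m) univ := by
  have h1 : ∀ j : Fin n, AnalyticOnNhd ℝ
      (fun x : EuclideanSpace ℝ (Fin n) => Real.sin (a j * m j * x j)) univ := by
    intro j x _
    have h2 : AnalyticAt ℝ (fun x : EuclideanSpace ℝ (Fin n) => x j) x :=
      (EuclideanSpace.proj (𝕜 := ℝ) j).analyticAt x
    exact Real.analyticAt_sin.fun_comp (analyticAt_const.mul h2)
  exact Finset.analyticOnNhd_fun_prod _ fun j _ => h1 j

theorem exists_lipschitzWith_sinProd (a : Fin n → ℝ) (m : Fin n → ℕ) :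
    ∃ L, LipschitzWith L (sinProd a m) := by
  classical
  have h : ∀ F : Finset (Fin n), (∃ L, LipschitzWith L
      fun x : EuclideanSpace ℝ (Fin n) => ∏ j ∈ F, Real.sin (a j * m j * x j)) ∧
      ∀ x : EuclideanSpace ℝ (Fin n), |∏ j ∈ F, Real.sin (a j * m j * x j)| ≤ 1 := by
    intro F
    induction F using Finset.induction_on with
    | empty => exact ⟨⟨0, by simp⟩, by simp⟩
    | insert j F hj ih =>
      obtain ⟨⟨L, hL⟩, hb⟩ := ih
      simp only [Finset.prod_insert hj]
      refine ⟨⟨‖a j * m j‖₊ * 1 + L, ?_⟩, fun x => ?_⟩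
      · refine LipschitzWith.mul_of_abs_le_one ?_ hL (fun x => Real.abs_sin_le_one _) hb
        have h1 : LipschitzWith 1 fun x : EuclideanSpace ℝ (Fin n) => x j :=
          LipschitzWith.of_dist_le_mul fun x y => by
            rw [NNReal.coe_one, one_mul, dist_eq_norm, dist_eq_norm]
            exact PiLp.norm_apply_le (x - y) j
        have h2 := (lipschitzWith_smul (a j * (m j : ℝ))).comp h1
        have h3 := Real.lipschitzWith_sin.comp h2
        rwa [one_mul] at h3
      · rw [abs_mul]
        exact mul_le_one₀ (Real.abs_sin_le_one _) (abs_nonneg _) (hb x)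
  exact (h Finset.univ).1

theorem secondDiff_sinProd (a : Fin n → ℝ) (m : Fin n → ℕ) (j : Fin n) (h : ℝ)
    (x : EuclideanSpace ℝ (Fin n)) : secondDiff (h • stdDir n j) (sinProd a m) x =
      -(2 * Real.sin (a j * m j * h / 2)) ^ 2 * sinProd a m x := by
  classical
  have hsplit : ∀ t : ℝ, sinProd a m (x + t • stdDir n j) =
      Real.sin (a j * m j * (x j + t)) *
        ∏ i ∈ Finset.univ.erase j, Real.sin (a i * m i * x i) := by
    intro t
    rw [sinProd, ← Finset.mul_prod_erase _ _ (Finset.mem_univ j)]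
    congr 1
    · simp [stdDir]
    · refine Finset.prod_congr rfl fun i hi => ?_
      have : i ≠ j := Finset.ne_of_mem_erase hi
      simp [stdDir, this]
  have h0 := hsplit 0
  have h1 := hsplit h
  have h2 := hsplit (-h)
  rw [zero_smul, add_zero, add_zero] at h0
  rw [neg_smul, ← sub_eq_add_neg, ← sub_eq_add_neg] at h2
  rw [secondDiff, h0, h1, h2]
  have key : ∀ s t : ℝ, Real.sin (s + 2 * t) + Real.sin (s - 2 * t) - 2 * Real.sin s =
      -(2 * Real.sin t) ^ 2 * Real.sin s := by
    intro s t
    rw [Real.sin_add, Real.sin_sub, Real.cos_two_mul]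
    have := Real.sin_sq_add_cos_sq t
    linear_combination (4 * Real.sin s) * this
  have e1 := key (a j * m j * x j) (a j * m j * h / 2)
  rw [show a j * m j * (x j + h) = a j * m j * x j + 2 * (a j * m j * h / 2) by ring,
    show a j * m j * (x j - h) = a j * m j * x j - 2 * (a j * m j * h / 2) by ring]
  linear_combination (∏ i ∈ Finset.univ.erase j, Real.sin (a i * m i * x i)) * e1

theorem tendsto_sin_div_sq (c : ℝ) :
    Tendsto (fun h : ℝ => (2 * Real.sin (c * h / 2)) ^ 2 / h ^ 2) (𝓝[≠] 0) (𝓝 (c ^ 2)) := by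
  have h1 : HasDerivAt (fun h : ℝ => 2 * Real.sin (c * h / 2)) c 0 := by
    have h2 : HasDerivAt (fun h : ℝ => c * h / 2) (c / 2) 0 := by
      simpa using ((hasDerivAt_id (0 : ℝ)).const_mul c).div_const 2
    have h3 := (h2.sin).const_mul 2
    refine h3.congr_deriv ?_
    simp
    ring
  have h2 := (hasDerivAt_iff_tendsto_slope_zero.1 h1).pow 2
  refine h2.congr fun h => ?_
  simp
  ring

theorem diffQuot_sinProd (a : Fin n → ℝ) (m : Fin n → ℕ) (h : ℝ)
    (x : EuclideanSpace ℝ (Fin n)) : diffQuot (stdDir n) h (sinProd a m) x =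
      -(∑ j, (2 * Real.sin (a j * m j * h / 2)) ^ 2 / h ^ 2) * sinProd a m x := by
  rw [diffQuot, ← Finset.sum_div]
  simp only [secondDiff_sinProd, ← Finset.sum_mul, Finset.sum_neg_distrib]
  ring

theorem isDiffEigen_sinProd (a : Fin n → ℝ) (m : Fin n → ℕ) :
    IsDiffEigen (stdDir n) (sinProd a m) (∑ j, (a j * m j) ^ 2) :=
  ⟨_, tendsto_finsetSum _ fun _ _ => tendsto_sin_div_sq _, fun h _ x => diffQuot_sinProd a m h x⟩

theorem isDiffEigen_sinProd_single (a : Fin n → ℝ) (m : Fin n → ℕ) (j : Fin n) :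
    IsDiffEigen (fun _ : Unit => stdDir n j) (sinProd a m) ((a j * m j) ^ 2) :=
  ⟨_, tendsto_sin_div_sq _, fun h _ x => by
    rw [diffQuot]
    simp only [secondDiff_sinProd, Finset.univ_unique, Finset.sum_singleton]
    ring⟩

variable {a : Fin n → ℝ}

theorem convex_boxDomain : Convex ℝ (boxDomain a) := by
  intro x hx y hy s t hs ht hst j
  have h1 := hx j
  have h2 := hy j
  have h3 : (s • x + t • y) j ∈ Ioo 0 (Real.pi / a j) := by
    have := (convex_Ioo (0 : ℝ) (Real.pi / a j)) h1 h2 hs ht hst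
    simpa using this
  exact h3

theorem isOpen_boxDomain : IsOpen (boxDomain a) := by
  have : boxDomain a = ⋂ j, {x : EuclideanSpace ℝ (Fin n) | 0 < x j ∧ x j < Real.pi / a j} := by
    ext x; simp [boxDomain]
  rw [this]
  refine isOpen_iInter_of_finite fun j => ?_
  have hc : Continuous fun x : EuclideanSpace ℝ (Fin n) => x j := by fun_prop
  exact (isOpen_lt continuous_const hc).inter (isOpen_lt hc continuous_const)

theorem closure_boxDomain_subset :
    closure (boxDomain a) ⊆ {x | ∀ j, 0 ≤ x j ∧ x j ≤ Real.pi / a j} := by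
  refine closure_minimal (fun x hx j => ⟨(hx j).1.le, (hx j).2.le⟩) ?_
  have : {x : EuclideanSpace ℝ (Fin n) | ∀ j, 0 ≤ x j ∧ x j ≤ Real.pi / a j} =
      ⋂ j, {x : EuclideanSpace ℝ (Fin n) | 0 ≤ x j ∧ x j ≤ Real.pi / a j} := by
    ext x; simp
  rw [this]
  refine isClosed_iInter fun j => ?_
  have hc : Continuous fun x : EuclideanSpace ℝ (Fin n) => x j := by fun_prop
  exact (isClosed_le continuous_const hc).inter (isClosed_le hc continuous_const)

theorem isBounded_of_forall_abs_le {s : Set (EuclideanSpace ℝ (Fin n))} {C : ℝ}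
    (h : ∀ x ∈ s, ∀ j, |x j| ≤ C) : Bornology.IsBounded s := by
  refine isBounded_iff_forall_norm_le.2 ⟨Real.sqrt (∑ _j : Fin n, C ^ 2), fun x hx => ?_⟩
  rw [EuclideanSpace.norm_eq]
  refine Real.sqrt_le_sqrt (Finset.sum_le_sum fun j _ => ?_)
  rw [Real.norm_eq_abs]
  have := h x hx j
  gcongr

theorem isBounded_boxDomain : Bornology.IsBounded (boxDomain a) := by
  refine isBounded_of_forall_abs_le (C := ∑ j, |Real.pi / a j|) fun x hx j => ?_
  rw [abs_of_pos (hx j).1]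
  refine ((hx j).2.le.trans (le_abs_self _)).trans ?_
  exact Finset.single_le_sum (f := fun j => |Real.pi / a j|) (fun i _ => abs_nonneg _)
    (Finset.mem_univ j)

theorem sinProd_eq_zero_of_mem_frontier (ha : ∀ j, 0 < a j) (m : Fin n → ℕ)
    {x : EuclideanSpace ℝ (Fin n)} (hx : x ∈ frontier (boxDomain a)) : sinProd a m x = 0 := by
  have hcl := closure_boxDomain_subset (frontier_subset_closure hx)
  have hx' : x ∉ boxDomain a := by
    rw [isOpen_boxDomain.frontier_eq] at hx
    exact hx.2
  have : ∃ j, x j = 0 ∨ x j = Real.pi / a j := by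
    by_contra! hcon
    exact hx' fun j => ⟨lt_of_le_of_ne (hcl j).1 (hcon j).1.symm,
      lt_of_le_of_ne (hcl j).2 (hcon j).2⟩
  obtain ⟨j, hj⟩ := this
  refine Finset.prod_eq_zero (Finset.mem_univ j) ?_
  rcases hj with hj | hj
  · simp [hj]
  · have := (ha j).ne'
    rw [hj, show a j * m j * (Real.pi / a j) = m j * Real.pi by field_simp]
    exact Real.sin_nat_mul_pi _

theorem orthogonal_sinProd (ha : ∀ j, 0 < a j) {m m' : Fin n → ℕ} (hne : m ≠ m') :
    ∫ x, (boxDomain a).indicator (sinProd a m) x * (boxDomain a).indicator (sinProd a m') x = 0 := by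
  obtain ⟨j, hj⟩ := Function.ne_iff.1 hne
  obtain ⟨L, hL⟩ := exists_lipschitzWith_sinProd a m
  obtain ⟨L', hL'⟩ := exists_lipschitzWith_sinProd a m'
  refine integral_mul_eq_zero_of_isDiffEigen volume convex_boxDomain isOpen_boxDomain
    isBounded_boxDomain hL (fun x => sinProd_eq_zero_of_mem_frontier ha m) hL'
    (fun x => sinProd_eq_zero_of_mem_frontier ha m') (fun _ => norm_stdDir j)
    (isDiffEigen_sinProd_single a m j) (isDiffEigen_sinProd_single a m' j) fun h => hj ?_
  have h1 := (sq_eq_sq₀ (mul_nonneg (ha j).le (Nat.cast_nonneg _))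
    (mul_nonneg (ha j).le (Nat.cast_nonneg _))).1 h
  exact_mod_cast mul_left_cancel₀ (ha j).ne' h1

theorem cos_mul_sin_succ (t : ℝ) (k : ℕ) : Real.cos t * Real.sin ((k + 1 : ℕ) * t) =
    (Real.sin ((k + 2 : ℕ) * t) + Real.sin (k * t)) / 2 := by
  have e1 : ((k + 2 : ℕ) : ℝ) * t = (k + 1 : ℕ) * t + t := by push_cast; ring
  have e2 : (k : ℝ) * t = (k + 1 : ℕ) * t - t := by push_cast; ring
  rw [e1, e2, Real.sin_add, Real.sin_sub]
  ring

theorem finite_sum_sq_le (ha : ∀ j, 0 < a j) (b : ℝ) :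
    {m : Fin n → ℕ | ∑ j, (a j * m j) ^ 2 ≤ b}.Finite := by
  refine (finite_Iic fun j => ⌈b / a j ^ 2⌉₊).subset fun m (hm : ∑ j, (a j * m j) ^ 2 ≤ b) j => ?_
  have h1 : (a j * m j) ^ 2 ≤ b :=
    (Finset.single_le_sum (f := fun j => (a j * (m j : ℝ)) ^ 2) (fun i _ => sq_nonneg _)
      (Finset.mem_univ j)).trans hm
  have h2 : (m j : ℝ) ^ 2 ≤ b / a j ^ 2 := by
    rw [le_div_iff₀ (pow_pos (ha j) 2)]
    linarith [mul_pow (a j) (m j : ℝ) 2]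
  have h3 : (m j : ℝ) ≤ (m j : ℝ) ^ 2 := by exact_mod_cast Nat.le_self_pow two_ne_zero _
  exact_mod_cast (h3.trans h2).trans (Nat.le_ceil _)

theorem dirichletSystem_box (ha : ∀ j, 0 < a j) : DirichletSystem (boxDomain a)
    (fun m : {m : Fin n → ℕ // ∀ j, 1 ≤ m j} => sinProd a m)
    (fun m => ∑ j, (a j * m.1 j) ^ 2) where
  convex := convex_boxDomain
  isOpen := isOpen_boxDomain
  bounded := isBounded_boxDomain
  nonempty := ⟨WithLp.toLp 2 fun j => Real.pi / a j / 2, fun j => by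
    have : 0 < Real.pi / a j := div_pos Real.pi_pos (ha j)
    exact ⟨half_pos this, half_lt_self this⟩⟩
  analytic := fun m => analyticOnNhd_sinProd a m
  lipschitz := fun m => exists_lipschitzWith_sinProd a m
  boundary := fun m x => sinProd_eq_zero_of_mem_frontier ha m
  isDiffEigen := fun m => isDiffEigen_sinProd a m
  orthogonal := fun m m' hne => orthogonal_sinProd ha fun h => hne (Subtype.ext h)
  ne_zero := fun m => by
    refine ⟨WithLp.toLp 2 fun j => Real.pi / a j / (2 * m.1 j), fun j => ?_, ?_⟩
    · have h1 : 0 < Real.pi / a j := div_pos Real.pi_pos (ha j)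
      have h2 : (1 : ℝ) ≤ m.1 j := by exact_mod_cast m.2 j
      exact ⟨by positivity, div_lt_self h1 (by linarith)⟩
    · refine Finset.prod_ne_zero_iff.2 fun j _ => ?_
      have h1 := (ha j).ne'
      have h2 : (m.1 j : ℝ) ≠ 0 := by have := m.2 j; positivity
      have h3 : a j * m.1 j * (Real.pi / a j / (2 * m.1 j)) = Real.pi / 2 := by field_simp
      simp [h3]
  total := by
    classical
    have hpi : ∀ j, 0 < Real.pi / a j := fun j => div_pos Real.pi_pos (ha j)
    refine exists_mem_span_near isBounded_boxDomain (fun m => continuous_sinProd a m)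
      (range fun (j : Fin n) (x : EuclideanSpace ℝ (Fin n)) => Real.cos (a j * x j)) ?_ ?_ ?_
      ⟨fun _ => 1, fun _ => le_rfl⟩ ?_
    · rintro _ ⟨j, rfl⟩
      fun_prop
    · rintro _ ⟨j, rfl⟩ ⟨m, hm⟩
      obtain ⟨k, hk⟩ : ∃ k, m j = k + 1 := ⟨m j - 1, by have := hm j; omega⟩
      have heq : (fun x : EuclideanSpace ℝ (Fin n) => Real.cos (a j * x j)) * sinProd a m =
          (1 / 2 : ℝ) • sinProd a (Function.update m j (k + 2)) +
          (1 / 2 : ℝ) • sinProd a (Function.update m j k) := by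
        funext x
        have hupd : ∀ l : ℕ, sinProd a (Function.update m j l) x = Real.sin (l * (a j * x j)) *
            ∏ i ∈ Finset.univ.erase j, Real.sin (a i * m i * x i) := by
          intro l
          rw [sinProd, ← Finset.mul_prod_erase _ _ (Finset.mem_univ j)]
          congr 1
          · rw [Function.update_self]; congr 1; ring
          · exact Finset.prod_congr rfl fun i hi => by
              rw [Function.update_of_ne (Finset.ne_of_mem_erase hi)]
        have h0 := hupd (k + 1)
        rw [← hk, Function.update_eq_self, hk] at h0
        simp only [Pi.mul_apply, Pi.add_apply, Pi.smul_apply, smul_eq_mul, hupd, h0]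
        rw [← mul_assoc, cos_mul_sin_succ]
        ring
      have hmem : ∀ l : ℕ, sinProd a (Function.update m j l) ∈
          Submodule.span ℝ (range fun m : {m : Fin n → ℕ // ∀ j, 1 ≤ m j} => sinProd a m) := by
        intro l
        rcases Nat.eq_zero_or_pos l with rfl | hl
        · have : sinProd a (Function.update m j 0) = 0 := by
            funext x
            exact Finset.prod_eq_zero (Finset.mem_univ j) (by simp)
          rw [this]
          exact Submodule.zero_mem _
        · refine Submodule.subset_span ⟨⟨Function.update m j l, fun i => ?_⟩, rfl⟩
          by_cases hij : i = j
          · subst hij; rw [Function.update_self]; exact hl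
          · rw [Function.update_of_ne hij]; exact hm i
      rw [heq]
      exact Submodule.add_mem _ (Submodule.smul_mem _ _ (hmem _)) (Submodule.smul_mem _ _ (hmem _))
    · intro x hx y hy hxy
      have hx' := closure_boxDomain_subset hx
      have hy' := closure_boxDomain_subset hy
      obtain ⟨j, hj⟩ : ∃ j, x j ≠ y j := by
        by_contra! hcon
        exact hxy (by ext j; exact hcon j)
      refine ⟨_, ⟨j, rfl⟩, fun h => hj ?_⟩
      have hmem : ∀ z : EuclideanSpace ℝ (Fin n), (0 ≤ z j ∧ z j ≤ Real.pi / a j) →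
          a j * z j ∈ Icc 0 Real.pi := fun z hz =>
        ⟨mul_nonneg (ha j).le hz.1, by
          have := (le_div_iff₀ (ha j)).1 hz.2
          linarith⟩
      exact mul_left_cancel₀ (ha j).ne' (Real.injOn_cos (hmem x (hx' j)) (hmem y (hy' j)) h)
    · intro x hx
      refine (Finset.prod_pos fun j _ => Real.sin_pos_of_pos_of_lt_pi ?_ ?_).ne'
      · simpa using mul_pos (ha j) (hx j).1
      · have := (lt_div_iff₀ (ha j)).1 (hx j).2
        simp only [Nat.cast_one, mul_one]
        linarith
  finite := fun b => (finite_sum_sq_le ha b).preimage Subtype.val_injective.injOn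

end Box

/-! ### The isosceles right triangle -/

section Triangle

/-- The open triangle `0 < y < x < π`. -/
def triDomain : Set (EuclideanSpace ℝ (Fin 2)) := {x | 0 < x 1 ∧ x 1 < x 0 ∧ x 0 < Real.pi}

/-- The antisymmetric combination `sin (p x) sin (q y) - sin (q x) sin (p y)`, for `(p, q) = m`. -/
def triFun (m : Fin 2 → ℕ) (x : EuclideanSpace ℝ (Fin 2)) : ℝ :=
  sinProd (fun _ => 1) m x - sinProd (fun _ => 1) (m ∘ Equiv.swap 0 1) x

theorem triFun_apply (m : Fin 2 → ℕ) (x : EuclideanSpace ℝ (Fin 2)) : triFun m x =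
    Real.sin (m 0 * x 0) * Real.sin (m 1 * x 1) - Real.sin (m 1 * x 0) * Real.sin (m 0 * x 1) := by
  simp [triFun, sinProd]

theorem convex_triDomain : Convex ℝ triDomain := by
  rintro x ⟨h1, h2, h3⟩ y ⟨k1, k2, k3⟩ s t hs ht hst
  rcases hs.eq_or_lt with rfl | hs'
  · obtain rfl : t = 1 := by linarith
    simpa using ⟨k1, k2, k3⟩
  · have e : s * Real.pi + t * Real.pi = Real.pi := by rw [← add_mul, hst, one_mul]
    refine ⟨?_, ?_, ?_⟩ <;> simp only [PiLp.add_apply, PiLp.smul_apply, smul_eq_mul] <;> nlinarith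

theorem isOpen_triDomain : IsOpen triDomain := by
  have hc : ∀ j, Continuous fun x : EuclideanSpace ℝ (Fin 2) => x j := fun j => by fun_prop
  exact (isOpen_lt continuous_const (hc 1)).inter
    ((isOpen_lt (hc 1) (hc 0)).inter (isOpen_lt (hc 0) continuous_const))

theorem closure_triDomain_subset :
    closure triDomain ⊆ {x | 0 ≤ x 1 ∧ x 1 ≤ x 0 ∧ x 0 ≤ Real.pi} := by
  have hc : ∀ j, Continuous fun x : EuclideanSpace ℝ (Fin 2) => x j := fun j => by fun_prop
  exact closure_minimal (fun x hx => ⟨hx.1.le, hx.2.1.le, hx.2.2.le⟩)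
    ((isClosed_le continuous_const (hc 1)).inter
      ((isClosed_le (hc 1) (hc 0)).inter (isClosed_le (hc 0) continuous_const)))

theorem isBounded_triDomain : Bornology.IsBounded triDomain := by
  refine isBounded_of_forall_abs_le (C := Real.pi) fun x hx j => ?_
  obtain ⟨h1, h2, h3⟩ := hx
  fin_cases j
  · exact abs_le.2 ⟨by simp; linarith, by simp; linarith⟩
  · exact abs_le.2 ⟨by simp; linarith, by simp; linarith⟩

theorem triFun_eq_zero_of_mem_frontier (m : Fin 2 → ℕ) {x : EuclideanSpace ℝ (Fin 2)}
    (hx : x ∈ frontier triDomain) : triFun m x = 0 := by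
  obtain ⟨h1, h2, h3⟩ := closure_triDomain_subset (frontier_subset_closure hx)
  have hx' : x ∉ triDomain := by
    rw [isOpen_triDomain.frontier_eq] at hx
    exact hx.2
  rw [triFun_apply]
  rcases h1.eq_or_lt with h | h1
  · simp [← h]
  rcases h2.eq_or_lt with h | h2
  · rw [h]; ring
  rcases h3.eq_or_lt with h | h3
  · rw [h, Real.sin_nat_mul_pi, Real.sin_nat_mul_pi]; ring
  exact absurd ⟨h1, h2, h3⟩ hx'

theorem isDiffEigen_triFun (m : Fin 2 → ℕ) :
    IsDiffEigen (stdDir 2) (triFun m) ((m 0 : ℝ) ^ 2 + (m 1 : ℝ) ^ 2) := by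
  refine ⟨fun h => (2 * Real.sin (m 0 * h / 2)) ^ 2 / h ^ 2 +
    (2 * Real.sin (m 1 * h / 2)) ^ 2 / h ^ 2, (tendsto_sin_div_sq _).add (tendsto_sin_div_sq _),
    fun h _ x => ?_⟩
  have h1 : diffQuot (stdDir 2) h (triFun m) x = diffQuot (stdDir 2) h (sinProd (fun _ => 1) m) x -
      diffQuot (stdDir 2) h (sinProd (fun _ => 1) (m ∘ Equiv.swap 0 1)) x := by
    simp only [diffQuot, secondDiff, triFun]
    rw [← sub_div, ← Finset.sum_sub_distrib]
    congr 1
    exact Finset.sum_congr rfl fun k _ => by ring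
  rw [h1, diffQuot_sinProd, diffQuot_sinProd, triFun]
  simp only [Fin.sum_univ_two, Function.comp_apply, Equiv.swap_apply_left, Equiv.swap_apply_right,
    one_mul]
  ring

/-- The reflection at the diagonal of the square. -/
def diagSwap : EuclideanSpace ℝ (Fin 2) ≃ₗᵢ[ℝ] EuclideanSpace ℝ (Fin 2) :=
  LinearIsometryEquiv.piLpCongrLeft 2 ℝ ℝ (Equiv.swap 0 1)

theorem diagSwap_apply (x : EuclideanSpace ℝ (Fin 2)) :
    diagSwap x 0 = x 1 ∧ diagSwap x 1 = x 0 := by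
  constructor <;> simp [diagSwap, LinearIsometryEquiv.piLpCongrLeft_apply, Equiv.piCongrLeft']

/-- Unfolding the triangle to the square turns the orthogonality of products of sines into
orthogonality on the triangle. -/
theorem orthogonal_triFun {m m' : Fin 2 → ℕ} (hm : m 1 < m 0) (hm' : m' 1 < m' 0) (hne : m ≠ m') :
    ∫ x, triDomain.indicator (triFun m) x * triDomain.indicator (triFun m') x = 0 := by
  set Q : Set (EuclideanSpace ℝ (Fin 2)) := boxDomain fun _ => 1 with hQ
  have ho : ∀ p q : Fin 2 → ℕ, p ≠ q → ∫ x, Q.indicator (sinProd (fun _ => 1) p) x *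
      Q.indicator (sinProd (fun _ => 1) q) x = 0 := fun p q hpq =>
    orthogonal_sinProd (fun _ => one_pos) hpq
  have S := dirichletSystem_box (n := 2) (a := fun _ => 1) fun _ => one_pos
  have hc : ∀ p : Fin 2 → ℕ, Continuous (Q.indicator (sinProd (fun _ => 1) p)) := fun p => by
    obtain ⟨L, hL⟩ := exists_lipschitzWith_sinProd (fun _ : Fin 2 => (1 : ℝ)) p
    exact (lipschitzWith_indicator hL
      fun x => sinProd_eq_zero_of_mem_frontier (fun _ => one_pos) p).continuous
  have hi : ∀ p q : Fin 2 → ℕ, Integrable fun x => Q.indicator (sinProd (fun _ => 1) p) x *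
      Q.indicator (sinProd (fun _ => 1) q) x := fun p q =>
    S.integrable_mul (hc q) (hc p) fun x hx => indicator_of_notMem hx _
  set σ : Equiv.Perm (Fin 2) := Equiv.swap 0 1
  have hne1 : m ≠ m' ∘ σ := by
    intro h
    have h0 : m 0 = m' 1 := by rw [h]; simp [σ]
    have h1 : m 1 = m' 0 := by rw [h]; simp [σ]
    omega
  have hne2 : m ∘ σ ≠ m' := by
    intro h
    have h0 : m' 0 = m 1 := by rw [← h]; simp [σ]
    have h1 : m' 1 = m 0 := by rw [← h]; simp [σ]
    omega
  have hne3 : m ∘ σ ≠ m' ∘ σ := fun h => hne (σ.surjective.injective_comp_right h)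
  have hsq : ∫ x, Q.indicator (triFun m) x * Q.indicator (triFun m') x = 0 := by
    have hexp : ∀ x, Q.indicator (triFun m) x * Q.indicator (triFun m') x =
        (Q.indicator (sinProd (fun _ => 1) m) x * Q.indicator (sinProd (fun _ => 1) m') x -
          Q.indicator (sinProd (fun _ => 1) m) x * Q.indicator (sinProd (fun _ => 1) (m' ∘ σ)) x) -
        (Q.indicator (sinProd (fun _ => 1) (m ∘ σ)) x * Q.indicator (sinProd (fun _ => 1) m') x -
          Q.indicator (sinProd (fun _ => 1) (m ∘ σ)) x *
            Q.indicator (sinProd (fun _ => 1) (m' ∘ σ)) x) := by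
      intro x
      by_cases hx : x ∈ Q
      · simp only [indicator_of_mem hx, triFun, σ]; ring
      · simp [hx]
    simp only [hexp]
    have hi2 : ∀ p q r s : Fin 2 → ℕ, Integrable fun x => Q.indicator (sinProd (fun _ => 1) p) x *
        Q.indicator (sinProd (fun _ => 1) q) x - Q.indicator (sinProd (fun _ => 1) r) x *
        Q.indicator (sinProd (fun _ => 1) s) x := fun p q r s => (hi p q).sub (hi r s)
    rw [integral_sub (hi2 _ _ _ _) (hi2 _ _ _ _), integral_sub (hi _ _) (hi _ _),
      integral_sub (hi _ _) (hi _ _), ho _ _ hne, ho _ _ hne1, ho _ _ hne2, ho _ _ hne3]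
    simp
  set F : EuclideanSpace ℝ (Fin 2) → ℝ := fun x =>
    triDomain.indicator (triFun m) x * triDomain.indicator (triFun m') x with hF
  have hFc : ∀ p, Continuous (triDomain.indicator (triFun p)) := fun p => by
    refine continuous_indicator (fun x hx => triFun_eq_zero_of_mem_frontier p hx) ?_
    exact ((continuous_sinProd _ _).sub (continuous_sinProd _ _)).continuousOn
  have hFi : Integrable F := integrable_mul_of_continuous volume (hFc m') (hFc m)
    (hasCompactSupport_of_eq_zero isBounded_triDomain fun x hx => indicator_of_notMem hx _)
  have hmp : MeasurePreserving (diagSwap : EuclideanSpace ℝ (Fin 2) → EuclideanSpace ℝ (Fin 2)) :=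
    diagSwap.measurePreserving
  have hunfold : ∀ x, Q.indicator (triFun m) x * Q.indicator (triFun m') x = F x + F (diagSwap x) := by
    intro x
    obtain ⟨e0, e1⟩ := diagSwap_apply x
    have hsw : ∀ p, triFun p (diagSwap x) = -triFun p x := fun p => by
      rw [triFun_apply, triFun_apply, e0, e1]; ring
    have hQx : x ∈ Q ↔ (0 < x 0 ∧ x 0 < Real.pi) ∧ 0 < x 1 ∧ x 1 < Real.pi := by
      simp [hQ, boxDomain, Fin.forall_fin_two]
    have hTx : x ∈ triDomain ↔ 0 < x 1 ∧ x 1 < x 0 ∧ x 0 < Real.pi := Iff.rfl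
    have hTs : diagSwap x ∈ triDomain ↔ 0 < x 0 ∧ x 0 < x 1 ∧ x 1 < Real.pi := by
      change 0 < diagSwap x 1 ∧ diagSwap x 1 < diagSwap x 0 ∧ diagSwap x 0 < Real.pi ↔ _
      rw [e0, e1]
    simp only [hF]
    by_cases h1 : x ∈ triDomain
    · have h2 : diagSwap x ∉ triDomain := by rw [hTs]; rw [hTx] at h1; intro h; linarith [h.2.1]
      have h3 : x ∈ Q := by rw [hQx]; rw [hTx] at h1; obtain ⟨a, b, c⟩ := h1; constructor <;>
        constructor <;> linarith
      simp [h1, h2, h3]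
    · by_cases h2 : diagSwap x ∈ triDomain
      · have h3 : x ∈ Q := by rw [hQx]; rw [hTs] at h2; obtain ⟨a, b, c⟩ := h2; constructor <;>
          constructor <;> linarith
        simp [h1, h2, h3, hsw]
      · by_cases h3 : x ∈ Q
        · -- the points of the square that remain lie on the diagonal
          have h4 : x 0 = x 1 := by
            rw [hQx] at h3; rw [hTx] at h1; rw [hTs] at h2
            rcases lt_trichotomy (x 0) (x 1) with h | h | h
            · exact absurd ⟨h3.1.1, h, h3.2.2⟩ h2
            · exact h
            · exact absurd ⟨h3.2.1, h, h3.1.2⟩ h1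
          have h5 : triFun m x = 0 := by rw [triFun_apply, h4]; ring
          simp [h1, h2, h3, h5]
        · simp [h1, h2, h3]
  simp only [hunfold] at hsq
  have hFi' : Integrable fun x => F (diagSwap x) := hmp.integrable_comp_of_integrable hFi
  rw [integral_add hFi hFi',
    hmp.integral_comp diagSwap.toHomeomorph.measurableEmbedding F] at hsq
  linarith

/-- The quantum numbers of the triangle. -/
abbrev TriIndex : Type := {m : Fin 2 → ℕ // 1 ≤ m 1 ∧ m 1 < m 0}

theorem triFun_mem_span (p q : ℕ) :
    triFun ![p, q] ∈ Submodule.span ℝ (range fun m : TriIndex => triFun m) := by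
  have hpos : ∀ p q : ℕ, 1 ≤ q → q < p →
      triFun ![p, q] ∈ Submodule.span ℝ (range fun m : TriIndex => triFun m) := fun p q h1 h2 =>
    Submodule.subset_span ⟨⟨![p, q], by simpa using ⟨h1, h2⟩⟩, rfl⟩
  have hzero : ∀ p q : ℕ, (p = 0 ∨ q = 0 ∨ p = q) → triFun ![p, q] = 0 := by
    intro p q h
    funext x
    rw [triFun_apply]
    rcases h with rfl | rfl | rfl <;> simp
  by_cases h : p = 0 ∨ q = 0 ∨ p = q
  · rw [hzero p q h]; exact Submodule.zero_mem _
  · push Not at h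
    obtain ⟨h1, h2, h3⟩ := h
    rcases lt_or_gt_of_ne h3 with h3 | h3
    · have : triFun ![p, q] = -triFun ![q, p] := by
        funext x; simp [triFun_apply]
      rw [this]
      exact Submodule.neg_mem _ (hpos q p (by omega) h3)
    · exact hpos p q (by omega) h3

theorem dirichletSystem_triangle : DirichletSystem triDomain (fun m : TriIndex => triFun m)
    (fun m => (m.1 0 : ℝ) ^ 2 + (m.1 1 : ℝ) ^ 2) where
  convex := convex_triDomain
  isOpen := isOpen_triDomain
  bounded := isBounded_triDomain
  nonempty := ⟨!₂[2, 1], by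
    have := Real.pi_gt_three
    refine ⟨?_, ?_, ?_⟩ <;> simp; linarith⟩
  analytic := fun m => (analyticOnNhd_sinProd _ _).sub (analyticOnNhd_sinProd _ _)
  lipschitz := fun m => by
    obtain ⟨L, hL⟩ := exists_lipschitzWith_sinProd (fun _ : Fin 2 => (1 : ℝ)) m.1
    obtain ⟨L', hL'⟩ := exists_lipschitzWith_sinProd (fun _ : Fin 2 => (1 : ℝ))
      (m.1 ∘ Equiv.swap 0 1)
    exact ⟨_, hL.sub hL'⟩
  boundary := fun m x => triFun_eq_zero_of_mem_frontier m
  isDiffEigen := fun m => isDiffEigen_triFun m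
  orthogonal := fun m m' hne => orthogonal_triFun m.2.2 m'.2.2 fun h => hne (Subtype.ext h)
  ne_zero := fun m => by
    -- the second product is `sin (q π / p)` and the first one vanishes, at `(π / p, π / (2 p))`
    obtain ⟨m, h1, h2⟩ := m
    have hq : (1 : ℝ) ≤ m 1 := by exact_mod_cast h1
    have hqp : (m 1 : ℝ) < m 0 := by exact_mod_cast h2
    have hp : (0 : ℝ) < m 0 := by linarith
    have hπ := Real.pi_pos
    refine ⟨!₂[Real.pi / m 0, Real.pi / (2 * m 0)], ⟨?_, ?_, ?_⟩, ?_⟩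
    · simp only [Matrix.cons_val_one, Matrix.cons_val_zero]
      positivity
    · simp only [Matrix.cons_val_one, Matrix.cons_val_zero]
      exact div_lt_div_of_pos_left hπ hp (by linarith)
    · simp only [Matrix.cons_val_zero]
      exact div_lt_self hπ (by linarith)
    · change triFun m _ ≠ 0
      rw [triFun_apply]
      simp only [Matrix.cons_val_one, Matrix.cons_val_zero]
      have e1 : (m 0 : ℝ) * (Real.pi / m 0) = Real.pi := by field_simp
      have e2 : (m 0 : ℝ) * (Real.pi / (2 * m 0)) = Real.pi / 2 := by field_simp
      rw [e1, e2, Real.sin_pi, Real.sin_pi_div_two, zero_mul, zero_sub, mul_one]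
      refine neg_ne_zero.2 (Real.sin_pos_of_pos_of_lt_pi (by positivity) ?_).ne'
      rw [← mul_div_assoc, div_lt_iff₀ hp]
      nlinarith
  total := by
    refine exists_mem_span_near isBounded_triDomain
      (fun m => (continuous_sinProd _ _).sub (continuous_sinProd _ _))
      {fun x => Real.cos (x 0) + Real.cos (x 1), fun x => Real.cos (x 0) * Real.cos (x 1)}
      ?_ ?_ ?_ ⟨![2, 1], by simp⟩ ?_
    · rintro _ (rfl | rfl) <;> fun_prop
    · rintro g hg ⟨m, hm⟩
      obtain ⟨k, hk⟩ : ∃ k, m 0 = k + 1 := ⟨m 0 - 1, by have := hm.1; have := hm.2; omega⟩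
      obtain ⟨l, hl⟩ : ∃ l, m 1 = l + 1 := ⟨m 1 - 1, by have := hm.1; omega⟩
      have hcomb : ∀ p₁ q₁ p₂ q₂ p₃ q₃ p₄ q₄ : ℕ, ∀ c : ℝ,
          c • (triFun ![p₁, q₁] + triFun ![p₂, q₂] + triFun ![p₃, q₃] + triFun ![p₄, q₄]) ∈
          Submodule.span ℝ (range fun m : TriIndex => triFun m) := fun _ _ _ _ _ _ _ _ c =>
        Submodule.smul_mem _ _ (Submodule.add_mem _ (Submodule.add_mem _ (Submodule.add_mem _
          (triFun_mem_span _ _) (triFun_mem_span _ _)) (triFun_mem_span _ _))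
          (triFun_mem_span _ _))
      rcases hg with rfl | rfl
      · convert hcomb (k + 2) (l + 1) k (l + 1) (k + 1) (l + 2) (k + 1) l (1 / 2) using 1
        funext x
        simp only [Pi.mul_apply, Pi.add_apply, Pi.smul_apply, smul_eq_mul, triFun_apply, hk, hl,
          Matrix.cons_val_zero, Matrix.cons_val_one]
        have a1 := cos_mul_sin_succ (x 0) k
        have a2 := cos_mul_sin_succ (x 0) l
        have a3 := cos_mul_sin_succ (x 1) k
        have a4 := cos_mul_sin_succ (x 1) l
        linear_combination Real.sin ((l + 1 : ℕ) * x 1) * a1 - Real.sin ((k + 1 : ℕ) * x 1) * a2 -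
          Real.sin ((l + 1 : ℕ) * x 0) * a3 + Real.sin ((k + 1 : ℕ) * x 0) * a4
      · convert hcomb (k + 2) (l + 2) (k + 2) l k (l + 2) k l (1 / 4) using 1
        funext x
        simp only [Pi.mul_apply, Pi.add_apply, Pi.smul_apply, smul_eq_mul, triFun_apply, hk, hl,
          Matrix.cons_val_zero, Matrix.cons_val_one]
        have a1 := cos_mul_sin_succ (x 0) k
        have a2 := cos_mul_sin_succ (x 0) l
        have a3 := cos_mul_sin_succ (x 1) k
        have a4 := cos_mul_sin_succ (x 1) l
        have b1 := congrArg₂ (· * ·) a1 a4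
        have b2 := congrArg₂ (· * ·) a2 a3
        simp only at b1 b2
        linear_combination b1 - b2
    · intro x hx y hy hxy
      obtain ⟨x1, x2, x3⟩ := closure_triDomain_subset hx
      obtain ⟨y1, y2, y3⟩ := closure_triDomain_subset hy
      by_contra! hcon
      have h1 : Real.cos (x 0) + Real.cos (x 1) = Real.cos (y 0) + Real.cos (y 1) :=
        hcon _ (Or.inl rfl)
      have h2 : Real.cos (x 0) * Real.cos (x 1) = Real.cos (y 0) * Real.cos (y 1) :=
        hcon _ (Or.inr rfl)
      have hx01 : Real.cos (x 0) ≤ Real.cos (x 1) :=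
        Real.cos_le_cos_of_nonneg_of_le_pi x1 x3 x2
      have hy01 : Real.cos (y 0) ≤ Real.cos (y 1) :=
        Real.cos_le_cos_of_nonneg_of_le_pi y1 y3 y2
      have h3 : (Real.cos (x 0) - Real.cos (y 0)) * (Real.cos (x 0) - Real.cos (y 1)) = 0 := by
        linear_combination (Real.cos (x 0)) * h1 - h2
      have h4 : Real.cos (x 0) = Real.cos (y 0) := by
        rcases mul_eq_zero.1 h3 with h | h <;> linarith
      have h5 : Real.cos (x 1) = Real.cos (y 1) := by linarith
      have e0 := Real.injOn_cos ⟨by linarith, x3⟩ ⟨by linarith, y3⟩ h4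
      have e1 := Real.injOn_cos ⟨x1, by linarith⟩ ⟨y1, by linarith⟩ h5
      exact hxy (by ext j; fin_cases j; exacts [e0, e1])
    · rintro x ⟨h1, h2, h3⟩
      rw [triFun_apply]
      have hs0 := Real.sin_pos_of_pos_of_lt_pi (by linarith : 0 < x 0) h3
      have hs1 := Real.sin_pos_of_pos_of_lt_pi h1 (by linarith : x 1 < Real.pi)
      have hc : Real.cos (x 0) < Real.cos (x 1) := Real.cos_lt_cos_of_nonneg_of_le_pi h1.le h3.le h2
      simp only [Matrix.cons_val_zero, Matrix.cons_val_one, Nat.cast_ofNat, Nat.cast_one, one_mul,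
        Real.sin_two_mul]
      have : 2 * Real.sin (x 0) * Real.cos (x 0) * Real.sin (x 1) -
          Real.sin (x 0) * (2 * Real.sin (x 1) * Real.cos (x 1)) =
          -(2 * (Real.sin (x 0) * Real.sin (x 1)) * (Real.cos (x 1) - Real.cos (x 0))) := by ring
      rw [this]
      exact neg_ne_zero.2 (mul_pos (by positivity) (by linarith)).ne'
  finite := fun b => by
    refine ((finite_sum_sq_le (a := fun _ : Fin 2 => (1 : ℝ)) (fun _ => one_pos) b).preimage
      (Subtype.val_injective (p := fun m : Fin 2 → ℕ => 1 ≤ m 1 ∧ m 1 < m 0)).injOn).subset ?_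
    intro m hm
    simpa [Fin.sum_univ_two] using hm

end Triangle

/-! ### Doubling the nodal domains by a reflection -/

section Doubling

/-- A homeomorphism induces a bijection of the connected components. -/
def connectedComponentsCongr {X Y : Type*} [TopologicalSpace X] [TopologicalSpace Y] (e : X ≃ₜ Y) :
    ConnectedComponents X ≃ ConnectedComponents Y where
  toFun := e.continuous.connectedComponentsMap
  invFun := e.symm.continuous.connectedComponentsMap
  left_inv := by
    intro c
    obtain ⟨x, rfl⟩ := ConnectedComponents.surjective_coe c
    change ConnectedComponents.mk (e.symm (e x)) = _
    rw [e.symm_apply_apply]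
  right_inv := by
    intro c
    obtain ⟨x, rfl⟩ := ConnectedComponents.surjective_coe c
    change ConnectedComponents.mk (e (e.symm x)) = _
    rw [e.apply_symm_apply]

variable {n : ℕ} {Ω : Set (EuclideanSpace ℝ (Fin n))}

/-- A domain that consists of two congruent halves `0 < s` and `s < 0`, exchanged by the reflection
`R`, such that the homeomorphism `A` maps the domain onto the half `0 < s`. -/
structure RepTiling (Ω : Set (EuclideanSpace ℝ (Fin n)))
    (A : EuclideanSpace ℝ (Fin n) ≃ₜ EuclideanSpace ℝ (Fin n))
    (R : EuclideanSpace ℝ (Fin n) → EuclideanSpace ℝ (Fin n)) (s : EuclideanSpace ℝ (Fin n) → ℝ) :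
    Prop where
  continuous_refl : Continuous R
  continuous_side : Continuous s
  mem_half : ∀ x, A x ∈ Ω ∧ 0 < s (A x) ↔ x ∈ Ω
  refl_refl : ∀ x, R (R x) = x
  refl_mem : ∀ x ∈ Ω, R x ∈ Ω
  side_refl : ∀ x, s (R x) = -s x
  refl_eq : ∀ x, s x = 0 → R x = x

namespace RepTiling

variable {A : EuclideanSpace ℝ (Fin n) ≃ₜ EuclideanSpace ℝ (Fin n)}
  {R : EuclideanSpace ℝ (Fin n) → EuclideanSpace ℝ (Fin n)} {s : EuclideanSpace ℝ (Fin n) → ℝ}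
  (hT : RepTiling Ω A R s)
include hT

theorem eq_zero_of_side_eq_zero {f : EuclideanSpace ℝ (Fin n) → ℝ}
    (hfR : ∀ x ∈ Ω, f (R x) = -f x) {x : EuclideanSpace ℝ (Fin n)} (hx : x ∈ Ω) (hs : s x = 0) :
    f x = 0 := by
  have h := hfR x hx
  rw [hT.refl_eq x hs] at h
  linarith

/-- A function that is odd under the reflection has twice as many nodal domains as its restriction
to one half. -/
theorem nodalCount_eq_two_mul {f g : EuclideanSpace ℝ (Fin n) → ℝ} (hfg : ∀ x ∈ Ω, f (A x) = g x)
    (hfR : ∀ x ∈ Ω, f (R x) = -f x) : nodalCount Ω f = 2 * nodalCount Ω g := by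
  set Z := {x : EuclideanSpace ℝ (Fin n) // x ∈ Ω ∧ f x ≠ 0} with hZ
  set U : Bool → Set Z := fun b => bif b then {z | 0 < s z.1} else {z | s z.1 < 0} with hU
  have hsc : Continuous fun z : Z => s z.1 := hT.continuous_side.comp continuous_subtype_val
  have hs : ∀ z : Z, s z.1 ≠ 0 := fun z h =>
    z.2.2 (hT.eq_zero_of_side_eq_zero hfR z.2.1 h)
  have hcompl : U false = (U true)ᶜ := by
    ext z
    simp only [hU, cond_false, cond_true, mem_ofPred_eq, mem_compl_iff, not_lt]
    exact ⟨le_of_lt, fun h => lt_of_le_of_ne h (hs z)⟩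
  have hopen : IsOpen (U true) := isOpen_lt continuous_const hsc
  have hopen' : IsOpen (U false) := isOpen_lt hsc continuous_const
  have hclopen : ∀ b, IsClopen (U b) := by
    rintro (_ | _)
    · exact ⟨by rw [hcompl]; exact hopen.isClosed_compl, hopen'⟩
    · exact ⟨by rw [← compl_compl (U true), ← hcompl]; exact hopen'.isClosed_compl, hopen⟩
  have hUz : ∀ z : U true, A.symm z.1.1 ∈ Ω := fun z =>
    (hT.mem_half _).1 (by rw [A.apply_symm_apply]; exact ⟨z.1.2.1, z.2⟩)
  -- the half `0 < s` is a copy of the domain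
  let e₁ : U true ≃ₜ {x : EuclideanSpace ℝ (Fin n) // x ∈ Ω ∧ g x ≠ 0} :=
    { toFun := fun z => ⟨A.symm z.1.1, hUz z, by
        rw [← hfg _ (hUz z), A.apply_symm_apply]; exact z.1.2.2⟩
      invFun := fun y => ⟨⟨A y.1, ((hT.mem_half _).2 y.2.1).1, by rw [hfg _ y.2.1]; exact y.2.2⟩,
        ((hT.mem_half _).2 y.2.1).2⟩
      left_inv := fun z => by simp
      right_inv := fun y => by simp
      continuous_toFun := (A.symm.continuous.comp
        (continuous_subtype_val.comp continuous_subtype_val)).subtype_mk _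
      continuous_invFun := ((A.continuous.comp continuous_subtype_val).subtype_mk _).subtype_mk _ }
  have hRf : ∀ z : Z, f (R z.1) ≠ 0 := fun z => by
    rw [hfR _ z.2.1]; exact neg_ne_zero.2 z.2.2
  have hRs : ∀ z : Z, s z.1 < 0 → 0 < s (R z.1) := fun z h => by
    rw [hT.side_refl]; exact neg_pos.2 h
  have hRs' : ∀ z : Z, 0 < s z.1 → s (R z.1) < 0 := fun z h => by
    rw [hT.side_refl]; exact neg_lt_zero.2 h
  let e₂ : U false ≃ₜ U true :=
    { toFun := fun z => ⟨⟨R z.1.1, hT.refl_mem _ z.1.2.1, hRf _⟩, hRs _ z.2⟩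
      invFun := fun z => ⟨⟨R z.1.1, hT.refl_mem _ z.1.2.1, hRf _⟩, hRs' _ z.2⟩
      left_inv := fun z => by simp [hT.refl_refl]
      right_inv := fun z => by simp [hT.refl_refl]
      continuous_toFun := ((hT.continuous_refl.comp
        (continuous_subtype_val.comp continuous_subtype_val)).subtype_mk _).subtype_mk _
      continuous_invFun := ((hT.continuous_refl.comp
        (continuous_subtype_val.comp continuous_subtype_val)).subtype_mk _).subtype_mk _ }
  have e : ∀ b, ConnectedComponents (U b) ≃ NodalDomains Ω g := by
    rintro (_ | _)
    · exact connectedComponentsCongr (e₂.trans e₁)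
    · exact connectedComponentsCongr e₁
  have E : NodalDomains Ω f ≃ Bool × NodalDomains Ω g := by
    refine (ConnectedComponents.equivOfIsClopen hclopen ?_ ?_).trans
      ((Equiv.sigmaCongrRight e).trans (Equiv.sigmaEquivProd _ _))
    · rintro (_ | _) (_ | _) h
      · exact absurd rfl h
      · rw [Function.onFun, hcompl]; exact disjoint_compl_left
      · rw [Function.onFun, hcompl]; exact disjoint_compl_right
      · exact absurd rfl h
    · refine iUnion_eq_univ_iff.2 fun z => ?_
      by_cases h : z ∈ U true
      · exact ⟨true, h⟩
      · exact ⟨false, by rw [hcompl]; exact h⟩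
  rw [nodalCount, Nat.card_congr E, Nat.card_prod, Nat.card_eq_fintype_card, Fintype.card_bool,
    nodalCount]

/-- If the functions `φ (σ i)` arise from the functions `φ i` by scaling and odd reflection, and are
all the functions of the system with eigenvalue `g * μ`, then the nodal deficiencies of the
eigenvalues `g * μ` and `μ` determine each other. -/
theorem nodalDeficiency_eq {ι : Type*} {φ : ι → EuclideanSpace ℝ (Fin n) → ℝ} {lam : ι → ℝ}
    (S : DirichletSystem Ω φ lam) {σ : ι → ι} {g : ℝ} (hg : g ≠ 0)
    (hσ : Function.Injective σ) (hlam : ∀ i, lam (σ i) = g * lam i)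
    (hφA : ∀ i x, φ (σ i) (A x) = φ i x) (hφR : ∀ i x, φ (σ i) (R x) = -φ (σ i) x) (j : ι)
    (heven : ∀ i, lam i = lam (σ j) → i ∈ range σ) :
    nodalDeficiency Ω (lam (σ j)) =
      2 * nodalDeficiency Ω (lam j) + (count Ω (lam (σ j)) : ℤ) - 2 * (count Ω (lam j) : ℤ) := by
  classical
  set F : (ι → ℝ) → EuclideanSpace ℝ (Fin n) → ℝ := fun a x =>
    ∑ i ∈ S.level (lam j), a i * Ω.indicator (φ (σ i)) x with hF
  set G : (ι → ℝ) → EuclideanSpace ℝ (Fin n) → ℝ := fun a x =>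
    ∑ i ∈ S.level (lam j), a i * Ω.indicator (φ i) x with hG
  have hlevel : S.level (lam (σ j)) = (S.level (lam j)).image σ := by
    ext i
    simp only [S.mem_level, Finset.mem_image]
    constructor
    · intro h
      obtain ⟨k, rfl⟩ := heven i h
      refine ⟨k, ?_, rfl⟩
      rw [hlam, hlam] at h
      exact mul_left_cancel₀ hg h
    · rintro ⟨k, hk, rfl⟩
      rw [hlam, hlam, hk]
  have hFsum : ∀ b : ι → ℝ, (fun x => ∑ i ∈ S.level (lam (σ j)), b i * Ω.indicator (φ i) x) =
      F (b ∘ σ) := by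
    intro b
    funext x
    rw [hlevel, Finset.sum_image fun x _ y _ h => hσ h]
    rfl
  have hfg : ∀ a, ∀ x ∈ Ω, F a (A x) = G a x := by
    intro a x hx
    have hAx := ((hT.mem_half x).2 hx).1
    simp only [hF, hG, indicator_of_mem hx, indicator_of_mem hAx, hφA]
  have hfR : ∀ a, ∀ x ∈ Ω, F a (R x) = -F a x := by
    intro a x hx
    simp only [hF, indicator_of_mem hx, indicator_of_mem (hT.refl_mem x hx), hφR,
      ← Finset.sum_neg_distrib, mul_neg]
  have hcount : ∀ a, nodalCount Ω (F a) = 2 * nodalCount Ω (G a) := fun a =>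
    hT.nodalCount_eq_two_mul (hfg a) (hfR a)
  have hF0 : ∀ a, ∀ x ∉ Ω, F a x = 0 := fun a x hx => by simp [hF, hx]
  have hG0 : ∀ a, ∀ x ∉ Ω, G a x = 0 := fun a x hx => by simp [hG, hx]
  have hne : ∀ a, F a ≠ 0 ↔ G a ≠ 0 := by
    intro a
    rw [not_iff_not]
    constructor
    · intro h
      funext x
      by_cases hx : x ∈ Ω
      · rw [← hfg a x hx, h]; rfl
      · exact hG0 a x hx
    · intro h
      have hpos : ∀ x ∈ Ω, 0 < s x → F a x = 0 := by
        intro x hx hs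
        have h1 : A.symm x ∈ Ω := (hT.mem_half _).1 (by rw [A.apply_symm_apply]; exact ⟨hx, hs⟩)
        have h2 := hfg a _ h1
        rw [A.apply_symm_apply] at h2
        rw [h2, h]; rfl
      funext x
      by_cases hx : x ∈ Ω
      · rcases lt_trichotomy (s x) 0 with hs | hs | hs
        · have h3 := hpos (R x) (hT.refl_mem x hx) (by rw [hT.side_refl]; linarith)
          rw [hfR a x hx] at h3
          exact neg_eq_zero.1 h3
        · exact hT.eq_zero_of_side_eq_zero (hfR a) hx hs
        · exact hpos x hx hs
      · exact hF0 a x hx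
  have hGmem : ∀ a, G a ∈ eigenspace Ω (lam j) := fun a => S.sum_mem_eigenspace _ a
  have hFmem : ∀ a, F a ∈ eigenspace Ω (lam (σ j)) := by
    intro a
    have h1 := hFsum (fun i => if h : i ∈ range σ then a h.choose else 0)
    have h2 : (fun i => if h : i ∈ range σ then a h.choose else 0) ∘ σ = a := by
      funext i
      have hi : σ i ∈ range σ := mem_range_self i
      simp only [Function.comp_apply, dif_pos hi]
      rw [hσ hi.choose_spec]
    rw [h2] at h1
    rw [← h1]
    exact S.sum_mem_eigenspace _ _
  have W := (S.deficiencyWellDefined (σ j)).isLeast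
  have W' := (S.deficiencyWellDefined j).isLeast
  apply le_antisymm
  · obtain ⟨w, ⟨hw, hw0⟩, hd⟩ := W'.1
    obtain ⟨a, rfl⟩ := S.mem_eigenspace_iff.1 hw
    refine W.2 ⟨F a, ⟨hFmem a, (hne a).2 hw0⟩, ?_⟩
    rw [← hd, eigenfunctionDeficiency, eigenfunctionDeficiency, hcount a]
    push_cast
    ring
  · obtain ⟨w, ⟨hw, hw0⟩, hd⟩ := W.1
    obtain ⟨b, rfl⟩ := S.mem_eigenspace_iff.1 hw
    rw [hFsum b] at hd hw0
    have h1 := W'.2 ⟨G (b ∘ σ), ⟨hGmem _, (hne _).1 hw0⟩, rfl⟩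
    rw [eigenfunctionDeficiency] at h1 hd
    rw [hcount] at hd
    push_cast at hd
    linarith

end RepTiling

end Doubling

/-! ### The triangle as a rep-tile -/

section TriangleTiling

/-- The similarity `(x, y) ↦ ((x + y) / 2, (x - y) / 2)`. -/
def triHalf : EuclideanSpace ℝ (Fin 2) ≃ₜ EuclideanSpace ℝ (Fin 2) where
  toFun x := !₂[(x 0 + x 1) / 2, (x 0 - x 1) / 2]
  invFun x := !₂[x 0 + x 1, x 0 - x 1]
  left_inv x := by
    ext j; fin_cases j <;> simp <;> ring
  right_inv x := by
    ext j; fin_cases j <;> simp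
  continuous_toFun := by fun_prop
  continuous_invFun := by fun_prop

/-- The reflection at the symmetry axis of the triangle. -/
def triRefl (x : EuclideanSpace ℝ (Fin 2)) : EuclideanSpace ℝ (Fin 2) :=
  !₂[Real.pi - x 1, Real.pi - x 0]

theorem repTiling_triangle :
    RepTiling triDomain triHalf triRefl fun x => Real.pi - x 0 - x 1 where
  continuous_refl := by unfold triRefl; fun_prop
  continuous_side := by fun_prop
  mem_half x := by
    simp only [triHalf, triDomain, mem_ofPred_eq, Homeomorph.homeomorph_mk_coe, Equiv.coe_fn_mk,
      Matrix.cons_val_zero, Matrix.cons_val_one]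
    constructor
    · rintro ⟨⟨h1, h2, h3⟩, h4⟩
      refine ⟨?_, ?_, ?_⟩ <;> linarith
    · rintro ⟨h1, h2, h3⟩
      refine ⟨⟨?_, ?_, ?_⟩, ?_⟩ <;> linarith
  refl_refl x := by
    ext j; fin_cases j <;> simp [triRefl]
  refl_mem x := by
    rintro ⟨h1, h2, h3⟩
    refine ⟨?_, ?_, ?_⟩ <;> simp [triRefl] <;> linarith
  side_refl x := by simp [triRefl]
  refl_eq x hx := by
    ext j; fin_cases j <;> simp [triRefl] <;> linarith

/-- The bijection of the quantum numbers onto the even ones that corresponds to `triHalf`. -/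
def triShift (m : Fin 2 → ℕ) : Fin 2 → ℕ := ![m 0 + m 1, m 0 - m 1]

theorem triFun_triShift_triHalf {m : Fin 2 → ℕ} (hm : m 1 < m 0) (x : EuclideanSpace ℝ (Fin 2)) :
    triFun (triShift m) (triHalf x) = triFun m x := by
  have hs : ∀ a b : ℝ, Real.sin a * Real.sin b = (Real.cos (a - b) - Real.cos (a + b)) / 2 :=
    fun a b => by rw [Real.cos_sub, Real.cos_add]; ring
  rw [triFun_apply, triFun_apply]
  simp only [triShift, triHalf, Homeomorph.homeomorph_mk_coe, Equiv.coe_fn_mk,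
    Matrix.cons_val_zero, Matrix.cons_val_one, Nat.cast_add, Nat.cast_sub hm.le, hs]
  set p : ℝ := (m 0 : ℝ)
  set q : ℝ := (m 1 : ℝ)
  have e1 : (p + q) * ((x 0 + x 1) / 2) - (p - q) * ((x 0 - x 1) / 2) = q * x 0 + p * x 1 := by ring
  have e2 : (p + q) * ((x 0 + x 1) / 2) + (p - q) * ((x 0 - x 1) / 2) = p * x 0 + q * x 1 := by ring
  have e3 : (p - q) * ((x 0 + x 1) / 2) - (p + q) * ((x 0 - x 1) / 2) =
      -(q * x 0 - p * x 1) := by ring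
  have e4 : (p - q) * ((x 0 + x 1) / 2) + (p + q) * ((x 0 - x 1) / 2) = p * x 0 - q * x 1 := by ring
  rw [e1, e2, e3, e4, Real.cos_neg]
  ring

theorem triFun_triRefl {m : Fin 2 → ℕ} (hm : m 0 ≡ m 1 [MOD 2]) (x : EuclideanSpace ℝ (Fin 2)) :
    triFun m (triRefl x) = -triFun m x := by
  have hs : ∀ (k : ℕ) (t : ℝ), Real.sin (k * (Real.pi - t)) = -((-1) ^ k * Real.sin (k * t)) :=
    fun k t => by rw [mul_sub, Real.sin_nat_mul_pi_sub]
  have hsq : ((-1 : ℝ)) ^ m 0 * (-1) ^ m 1 = 1 := by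
    rw [← pow_add]
    exact Even.neg_one_pow (by rw [Nat.even_add]; simp only [Nat.even_iff]; rw [hm])
  rw [triFun_apply, triFun_apply]
  simp only [triRefl, Matrix.cons_val_zero, Matrix.cons_val_one, hs]
  linear_combination (Real.sin (m 0 * x 1) * Real.sin (m 1 * x 0) -
    Real.sin (m 1 * x 1) * Real.sin (m 0 * x 0)) * hsq

theorem triShift_injective : InjOn triShift {m | m 1 < m 0} := by
  intro m hm m' hm' h
  have h0 := congrFun h 0
  have h1 := congrFun h 1
  simp only [triShift, Matrix.cons_val_zero, Matrix.cons_val_one] at h0 h1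
  have h2 : m 1 < m 0 := hm
  have h3 : m' 1 < m' 0 := hm'
  funext j
  fin_cases j
  · change m 0 = m' 0; omega
  · change m 1 = m' 1; omega

theorem triShift_mem {m : Fin 2 → ℕ} (hm : 1 ≤ m 1 ∧ m 1 < m 0) :
    (1 ≤ triShift m 1 ∧ triShift m 1 < triShift m 0) ∧ triShift m 0 ≡ triShift m 1 [MOD 2] := by
  simp only [triShift, Matrix.cons_val_zero, Matrix.cons_val_one, Nat.ModEq]
  omega

theorem exists_triShift_eq {m : Fin 2 → ℕ} (hm : 1 ≤ m 1 ∧ m 1 < m 0) (he : m 0 ≡ m 1 [MOD 2]) :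
    ∃ k : Fin 2 → ℕ, (1 ≤ k 1 ∧ k 1 < k 0) ∧ triShift k = m := by
  refine ⟨![(m 0 + m 1) / 2, (m 0 - m 1) / 2], ?_, ?_⟩
  · simp only [Matrix.cons_val_zero, Matrix.cons_val_one]
    rw [Nat.ModEq] at he
    omega
  · rw [Nat.ModEq] at he
    funext j
    fin_cases j
    · simp [triShift]; omega
    · simp [triShift]; omega

theorem triShift_sq_add_sq {m : Fin 2 → ℕ} (hm : m 1 < m 0) :
    (triShift m 0 : ℝ) ^ 2 + (triShift m 1 : ℝ) ^ 2 = 2 * ((m 0 : ℝ) ^ 2 + (m 1 : ℝ) ^ 2) := by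
  simp only [triShift, Matrix.cons_val_zero, Matrix.cons_val_one, Nat.cast_add, Nat.cast_sub hm.le]
  ring

theorem modEq_of_sq_add_sq_eq {m k : Fin 2 → ℕ} (hk : k 0 ≡ k 1 [MOD 2])
    (h : (m 0 : ℝ) ^ 2 + (m 1 : ℝ) ^ 2 = (k 0 : ℝ) ^ 2 + (k 1 : ℝ) ^ 2) : m 0 ≡ m 1 [MOD 2] := by
  have h' : m 0 ^ 2 + m 1 ^ 2 = k 0 ^ 2 + k 1 ^ 2 := by exact_mod_cast h
  have h2 : Even (k 0 ^ 2 + k 1 ^ 2) := by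
    rw [Nat.even_add, Nat.even_pow' two_ne_zero, Nat.even_pow' two_ne_zero, Nat.even_iff,
      Nat.even_iff, hk]
  rw [← h', Nat.even_add, Nat.even_pow' two_ne_zero, Nat.even_pow' two_ne_zero, Nat.even_iff,
    Nat.even_iff] at h2
  rw [Nat.ModEq]
  omega

end TriangleTiling

/-! ### The box as a rep-tile -/

section BoxTiling

variable {k : ℕ} {γ : ℝ}

/-- The cyclic permutation of the coordinates followed by the contraction with factor `γ⁻¹`. -/
def boxHalf (hγ : γ ≠ 0) :
    EuclideanSpace ℝ (Fin (k + 2)) ≃ₜ EuclideanSpace ℝ (Fin (k + 2)) :=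
  (LinearIsometryEquiv.piLpCongrLeft 2 ℝ ℝ (finRotate (k + 2))).toHomeomorph.trans
    (Homeomorph.smulOfNeZero γ⁻¹ (inv_ne_zero hγ))

theorem boxHalf_finRotate (hγ : γ ≠ 0) (x : EuclideanSpace ℝ (Fin (k + 2))) (j : Fin (k + 2)) :
    boxHalf hγ x (finRotate (k + 2) j) = γ⁻¹ * x j := by
  simp [boxHalf, LinearIsometryEquiv.piLpCongrLeft_apply, Equiv.piCongrLeft']

/-- The reflection of the first coordinate. -/
def boxRefl (x : EuclideanSpace ℝ (Fin (k + 2))) : EuclideanSpace ℝ (Fin (k + 2)) :=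
  WithLp.toLp 2 (Function.update x 0 (Real.pi - x 0))

theorem boxRefl_zero (x : EuclideanSpace ℝ (Fin (k + 2))) : boxRefl x 0 = Real.pi - x 0 := by
  simp [boxRefl]

theorem boxRefl_of_ne (x : EuclideanSpace ℝ (Fin (k + 2))) {j : Fin (k + 2)} (hj : j ≠ 0) :
    boxRefl x j = x j := by
  simp [boxRefl, hj]

/-- The cyclic shift of the quantum numbers with doubling of the new first entry. -/
def boxShift (m : Fin (k + 2) → ℕ) (j : Fin (k + 2)) : ℕ :=
  (if j = 0 then 2 else 1) * m ((finRotate (k + 2)).symm j)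

theorem boxShift_finRotate (m : Fin (k + 2) → ℕ) (j : Fin (k + 2)) :
    boxShift m (finRotate (k + 2) j) = (if finRotate (k + 2) j = 0 then 2 else 1) * m j := by
  simp [boxShift]

/-- The compatibility of the weights `γ ^ j` with the cyclic shift. -/
theorem pow_finRotate (hγ2 : γ ^ (k + 2) = 2) (j : Fin (k + 2)) :
    γ ^ (finRotate (k + 2) j : ℕ) * ((if finRotate (k + 2) j = 0 then 2 else 1 : ℕ) : ℝ) =
      γ * γ ^ (j : ℕ) := by
  rcases Fin.eq_castSucc_or_eq_last j with ⟨i, rfl⟩ | rfl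
  · have h : finRotate (k + 2) i.castSucc = i.succ := by
      rw [finRotate_apply]
      simp
    rw [h, if_neg (Fin.succ_ne_zero i)]
    simp [pow_succ']
  · simp only [finRotate_last, Fin.val_zero, pow_zero, if_true, one_mul, Fin.val_last]
    rw [← pow_succ', hγ2]
    norm_num

theorem sinProd_boxShift_boxHalf (hγ : γ ≠ 0) (hγ2 : γ ^ (k + 2) = 2) (m : Fin (k + 2) → ℕ)
    (x : EuclideanSpace ℝ (Fin (k + 2))) :
    sinProd (fun j => γ ^ (j : ℕ)) (boxShift m) (boxHalf hγ x) =
      sinProd (fun j => γ ^ (j : ℕ)) m x := by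
  unfold sinProd
  rw [← Equiv.prod_comp (finRotate (k + 2))]
  refine Finset.prod_congr rfl fun j _ => ?_
  congr 1
  rw [boxHalf_finRotate, boxShift_finRotate, Nat.cast_mul, ← mul_assoc (γ ^ _), pow_finRotate hγ2]
  field_simp

theorem sum_boxShift (hγ2 : γ ^ (k + 2) = 2) (m : Fin (k + 2) → ℕ) :
    ∑ j : Fin (k + 2), (γ ^ (j : ℕ) * (boxShift m j : ℝ)) ^ 2 =
      γ ^ 2 * ∑ j : Fin (k + 2), (γ ^ (j : ℕ) * (m j : ℝ)) ^ 2 := by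
  rw [← Equiv.sum_comp (finRotate (k + 2)), Finset.mul_sum]
  refine Finset.sum_congr rfl fun j _ => ?_
  rw [boxShift_finRotate, Nat.cast_mul, ← mul_assoc, pow_finRotate hγ2]
  ring

theorem repTiling_box (hγ : 0 < γ) (hγ2 : γ ^ (k + 2) = 2) :
    RepTiling (boxDomain fun j : Fin (k + 2) => γ ^ (j : ℕ)) (boxHalf hγ.ne') boxRefl
      fun x => Real.pi / 2 - x 0 where
  continuous_refl := by
    refine (PiLp.continuous_toLp 2 _).comp ?_
    refine Continuous.update ?_ 0 ?_ <;> fun_prop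
  continuous_side := by fun_prop
  mem_half x := by
    have hπ := Real.pi_pos
    -- the upper bound for the coordinate `j` of `x` is one for the next coordinate of its image
    have hkey : ∀ j, x j < Real.pi / γ ^ (j : ℕ) ↔ boxHalf hγ.ne' x (finRotate (k + 2) j) <
        Real.pi / (γ ^ (finRotate (k + 2) j : ℕ) *
          ((if finRotate (k + 2) j = 0 then 2 else 1 : ℕ) : ℝ)) := by
      intro j
      rw [boxHalf_finRotate, pow_finRotate hγ2, lt_div_iff₀ (by positivity),
        lt_div_iff₀ (by positivity)]
      have : γ⁻¹ * x j * (γ * γ ^ (j : ℕ)) = x j * γ ^ (j : ℕ) := by field_simp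
      rw [this]
    have hpos : ∀ j, 0 < x j ↔ 0 < boxHalf hγ.ne' x (finRotate (k + 2) j) := by
      intro j
      rw [boxHalf_finRotate, mul_pos_iff_of_pos_left (inv_pos.2 hγ)]
    constructor
    · rintro ⟨h1, h2⟩ j
      refine ⟨(hpos j).2 (h1 _).1, (hkey j).2 ?_⟩
      by_cases hj : finRotate (k + 2) j = 0
      · rw [hj]
        simp only [Fin.val_zero, pow_zero, one_mul, if_true, Nat.cast_ofNat]
        linarith
      · rw [if_neg hj, Nat.cast_one, mul_one]
        exact (h1 _).2
    · intro h
      have h0 : boxHalf hγ.ne' x 0 < Real.pi / 2 := by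
        have h1 := (hkey (Fin.last (k + 1))).1 (h _).2
        rw [finRotate_last] at h1
        simpa using h1
      refine ⟨fun i => ?_, by linarith⟩
      obtain ⟨j, rfl⟩ := (finRotate (k + 2)).surjective i
      refine ⟨(hpos j).1 (h j).1, ?_⟩
      by_cases hj : finRotate (k + 2) j = 0
      · rw [hj]
        simp only [Fin.val_zero, pow_zero, div_one]
        linarith
      · have h1 := (hkey j).1 (h j).2
        rwa [if_neg hj, Nat.cast_one, mul_one] at h1
  refl_refl x := by
    ext j
    by_cases hj : j = 0
    · subst hj; rw [boxRefl_zero, boxRefl_zero]; ring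
    · rw [boxRefl_of_ne _ hj, boxRefl_of_ne _ hj]
  refl_mem x hx := by
    intro j
    by_cases hj : j = 0
    · subst hj
      have := hx 0
      simp only [Fin.val_zero, pow_zero, div_one] at this ⊢
      rw [boxRefl_zero]
      constructor <;> linarith
    · rw [boxRefl_of_ne _ hj]
      exact hx j
  side_refl x := by
    rw [boxRefl_zero]; ring
  refl_eq x hx := by
    ext j
    by_cases hj : j = 0
    · subst hj; rw [boxRefl_zero]; linarith
    · rw [boxRefl_of_ne _ hj]

theorem sinProd_boxRefl {m : Fin (k + 2) → ℕ} (hm : m 0 ≡ 0 [MOD 2])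
    (x : EuclideanSpace ℝ (Fin (k + 2))) :
    sinProd (fun j => γ ^ (j : ℕ)) m (boxRefl x) = -sinProd (fun j => γ ^ (j : ℕ)) m x := by
  unfold sinProd
  rw [Fin.prod_univ_succ, Fin.prod_univ_succ (n := k + 1) (fun j => Real.sin (_ * _ * x j)), ← neg_mul]
  congr 1
  · simp only [Fin.val_zero, pow_zero, one_mul]
    rw [boxRefl_zero, mul_sub, Real.sin_nat_mul_pi_sub, Even.neg_one_pow (Nat.even_iff.2 hm),
      one_mul]

theorem boxShift_injective : Function.Injective (boxShift (k := k)) := by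
  intro m m' h
  funext j
  have h1 := congrFun h (finRotate (k + 2) j)
  rw [boxShift_finRotate, boxShift_finRotate] at h1
  exact Nat.eq_of_mul_eq_mul_left (by split_ifs <;> norm_num) h1

theorem boxShift_mem {m : Fin (k + 2) → ℕ} (hm : ∀ j, 1 ≤ m j) :
    (∀ j, 1 ≤ boxShift m j) ∧ boxShift m 0 ≡ 0 [MOD 2] := by
  refine ⟨fun j => Nat.mul_pos (by split_ifs <;> norm_num) (hm _), ?_⟩
  simp [boxShift, Nat.ModEq]

theorem exists_boxShift_eq {m : Fin (k + 2) → ℕ} (hm : ∀ j, 1 ≤ m j) (he : m 0 ≡ 0 [MOD 2]) :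
    ∃ l : Fin (k + 2) → ℕ, (∀ j, 1 ≤ l j) ∧ boxShift l = m := by
  have h0 := hm 0
  rw [Nat.ModEq] at he
  refine ⟨fun j => m (finRotate (k + 2) j) / (if finRotate (k + 2) j = 0 then 2 else 1),
    fun j => ?_, ?_⟩
  · by_cases h : finRotate (k + 2) j = 0
    · simp only [h, if_true]; omega
    · simp only [h, if_false, Nat.div_one]; exact hm _
  · funext j
    by_cases h : j = 0
    · subst h; simp [boxShift]; omega
    · simp [boxShift, h]

/-- The parity of the first quantum number is determined by the eigenvalue: otherwise `γ ^ 2` would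
divide an odd number in the ring of algebraic integers. -/
theorem modEq_of_sum_eq (hγ2 : γ ^ (k + 2) = 2) {m l : Fin (k + 2) → ℕ} (hl : l 0 ≡ 0 [MOD 2])
    (h : ∑ j : Fin (k + 2), (γ ^ (j : ℕ) * (m j : ℝ)) ^ 2 =
      ∑ j : Fin (k + 2), (γ ^ (j : ℕ) * (l j : ℝ)) ^ 2) : m 0 ≡ 0 [MOD 2] := by
  set θ : ℝ := γ ^ 2 with hθ
  have hθn : θ ^ (k + 2) = 4 := by rw [hθ, ← pow_mul, mul_comm, pow_mul, hγ2]; norm_num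
  have hint : IsIntegral ℤ θ := by
    refine IsIntegral.of_pow (n := k + 2) (by omega) ?_
    rw [hθn]
    exact_mod_cast isIntegral_algebraMap (R := ℤ) (x := (4 : ℤ)) (A := ℝ)
  set d : Fin (k + 2) → ℤ := fun j => (m j : ℤ) ^ 2 - (l j : ℤ) ^ 2 with hd
  set B : ℝ := ∑ j : Fin (k + 1), θ ^ (j : ℕ) * (d j.succ : ℝ) with hB
  have hBint : IsIntegral ℤ B := IsIntegral.sum _ fun j _ =>
    (hint.pow _).mul (isIntegral_algebraMap (R := ℤ) (x := d j.succ) (A := ℝ))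
  have h0 : (d 0 : ℝ) = -(θ * B) := by
    have h1 : ∑ j : Fin (k + 2), θ ^ (j : ℕ) * (d j : ℝ) = 0 := by
      rw [← sub_eq_zero, ← Finset.sum_sub_distrib] at h
      rw [← h]
      refine Finset.sum_congr rfl fun j _ => ?_
      simp only [hd, hθ]
      push_cast
      ring
    rw [Fin.sum_univ_succ] at h1
    simp only [Fin.val_zero, pow_zero, one_mul, Fin.val_succ, pow_succ'] at h1
    have h2 : ∑ j : Fin (k + 1), θ * θ ^ (j : ℕ) * (d j.succ : ℝ) = θ * B := by
      rw [hB, Finset.mul_sum]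
      exact Finset.sum_congr rfl fun j _ => by ring
    linarith
  have h3 : (d 0 : ℝ) ^ (k + 2) = 4 * (-B) ^ (k + 2) := by
    rw [h0, ← mul_neg, mul_pow, hθn]
  have h4 : IsIntegral ℤ (((d 0 : ℚ) ^ (k + 2) / 4 : ℚ) : ℝ) := by
    have : ((((d 0 : ℚ) ^ (k + 2) / 4 : ℚ)) : ℝ) = (-B) ^ (k + 2) := by
      push_cast
      rw [h3]; ring
    rw [this]
    exact hBint.neg.pow _
  have h5 : IsIntegral ℤ ((d 0 : ℚ) ^ (k + 2) / 4 : ℚ) :=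
    (isIntegral_algebraMap_iff (A := ℚ) (B := ℝ) (algebraMap ℚ ℝ).injective).1 h4
  obtain ⟨c, hc⟩ := IsIntegrallyClosed.isIntegral_iff.1 h5
  have h6 : (d 0) ^ (k + 2) = 4 * c := by
    have : ((d 0 : ℚ)) ^ (k + 2) = 4 * c := by
      rw [eq_intCast] at hc
      rw [hc]; ring
    exact_mod_cast this
  have h7 : Even (d 0) := by
    have : Even ((d 0) ^ (k + 2)) := by rw [h6]; exact ⟨2 * c, by ring⟩
    exact (Int.even_pow.1 this).1
  have h8 : Even (l 0) := Nat.even_iff.2 hl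
  simp only [hd, Int.even_sub, Int.even_pow, Int.even_coe_nat, ne_eq, OfNat.ofNat_ne_zero,
    not_false_eq_true, and_true, h8, iff_true] at h7
  exact Nat.even_iff.1 h7

end BoxTiling

/-! ### Counting quantum numbers -/

namespace RepTile

/-- The right neighbour of a quantum number. -/
def step (T : RepTile) (m : Fin T.dim → ℕ) : Fin T.dim → ℕ :=
  Function.update m T.first (m T.first + 1)

theorem step_first (T : RepTile) (m : Fin T.dim → ℕ) : T.step m T.first = m T.first + 1 :=
  Function.update_self ..

theorem step_of_ne (T : RepTile) (m : Fin T.dim → ℕ) {j : Fin T.dim} (hj : j ≠ T.first) :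
    T.step m j = m j :=
  Function.update_of_ne hj ..

theorem step_injective (T : RepTile) : Function.Injective T.step := by
  intro m m' h
  funext j
  have hj := congrFun h j
  by_cases hj0 : j = T.first
  · subst hj0
    rw [step_first, step_first] at hj
    exact Nat.succ_injective hj
  · rwa [step_of_ne _ _ hj0, step_of_ne _ _ hj0] at hj

theorem exists_step_eq (T : RepTile) {m : Fin T.dim → ℕ} (hm : 1 ≤ m T.first) :
    ∃ l, T.step l = m := by
  refine ⟨Function.update m T.first (m T.first - 1), ?_⟩
  funext j
  by_cases hj : j = T.first
  · subst hj
    rw [step_first, Function.update_self]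
    omega
  · rw [step_of_ne _ _ hj, Function.update_of_ne hj]

theorem γ_pos (T : RepTile) : 0 < T.γ := by
  cases T with
  | triangle => exact Real.sqrt_pos.2 two_pos
  | box n hn => exact Real.rpow_pos_of_pos two_pos _

theorem box_γ_pow (n : ℕ) (hn : 2 ≤ n) : (box n hn).γ ^ n = 2 := by
  change ((2 : ℝ) ^ ((1 : ℝ) / n)) ^ n = 2
  rw [one_div]
  exact Real.rpow_inv_natCast_pow two_pos.le (by omega)

theorem quantumNumbers_eq_union (T : RepTile) :
    T.quantumNumbers = T.evenNumbers ∪ T.oddNumbers := by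
  cases T with
  | triangle =>
    ext m
    refine ⟨fun h => ?_, fun h => h.elim And.left And.left⟩
    by_cases h2 : m (0 : Fin 2) ≡ m (1 : Fin 2) [MOD 2]
    · exact Or.inl ⟨h, h2⟩
    · exact Or.inr ⟨h, h2⟩
  | box n hn =>
    ext m
    refine ⟨fun h => ?_, fun h => h.elim And.left And.left⟩
    rcases Nat.mod_two_eq_zero_or_one (m (box n hn).first) with h2 | h2
    · exact Or.inl ⟨h, h2⟩
    · exact Or.inr ⟨h, h2⟩

theorem disjoint_even_odd (T : RepTile) : Disjoint T.evenNumbers T.oddNumbers := by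
  rw [Set.disjoint_left]
  cases T with
  | triangle => exact fun m h h' => h'.2 h.2
  | box n hn =>
    rintro m ⟨-, h⟩ ⟨-, h'⟩
    exact absurd (h.symm.trans h') (by decide)

theorem step_mem_evenNumbers (T : RepTile) {m : Fin T.dim → ℕ} (hm : m ∈ T.oddNumbers) :
    T.step m ∈ T.evenNumbers := by
  have h0 := T.step_first m
  cases T with
  | triangle =>
    obtain ⟨⟨h1, h2⟩, h3⟩ := hm
    have h4 : triangle.step m (1 : Fin 2) = m (1 : Fin 2) :=
      step_of_ne triangle m (show (1 : Fin 2) ≠ 0 by decide)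
    replace h0 : triangle.step m (0 : Fin 2) = m (0 : Fin 2) + 1 := h0
    refine ⟨⟨?_, ?_⟩, ?_⟩
    · rw [h4]; exact h1
    · rw [h4, h0]; exact h2.trans (Nat.lt_succ_self _)
    · rw [h4, h0, Nat.ModEq]
      rw [Nat.ModEq] at h3
      generalize m (0 : Fin 2) = a at *
      generalize m (1 : Fin 2) = b at *
      omega
  | box n hn =>
    obtain ⟨h1, h3⟩ := hm
    refine ⟨fun j => ?_, ?_⟩
    · by_cases hj : j = (box n hn).first
      · rw [hj, h0]; exact Nat.le_add_left ..
      · exact (h1 j).trans_eq (step_of_ne (box n hn) m hj).symm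
    · rw [h0, Nat.ModEq]
      rw [Nat.ModEq] at h3
      omega

theorem exists_step_eq_of_mem_evenNumbers (T : RepTile) {m : Fin T.dim → ℕ}
    (hm : m ∈ T.evenNumbers) : ∃ l ∈ T.oddNumbers, T.step l = m := by
  cases T with
  | triangle =>
    obtain ⟨⟨h1, h2⟩, h3⟩ := hm
    obtain ⟨l, rfl⟩ := exists_step_eq triangle (m := m) (h1.trans h2.le)
    have h4 : triangle.step l (1 : Fin 2) = l (1 : Fin 2) :=
      step_of_ne triangle l (show (1 : Fin 2) ≠ 0 by decide)
    have h0 : triangle.step l (0 : Fin 2) = l (0 : Fin 2) + 1 := triangle.step_first l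
    rw [h4] at h1
    rw [h4, h0] at h2 h3
    refine ⟨l, ⟨⟨h1, ?_⟩, ?_⟩, rfl⟩
    · rw [Nat.ModEq] at h3
      generalize l (0 : Fin 2) = a at *
      generalize l (1 : Fin 2) = b at *
      omega
    · rw [Nat.ModEq] at h3 ⊢
      generalize l (0 : Fin 2) = a at *
      generalize l (1 : Fin 2) = b at *
      omega
  | box n hn =>
    obtain ⟨h1, h3⟩ := hm
    obtain ⟨l, rfl⟩ := exists_step_eq (box n hn) (h1 (box n hn).first)
    have h0 := (box n hn).step_first l
    rw [h0, Nat.ModEq] at h3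
    refine ⟨l, ⟨fun j => ?_, ?_⟩, rfl⟩
    · by_cases hj : j = (box n hn).first
      · rw [hj]
        omega
      · exact (h1 j).trans_eq (step_of_ne (box n hn) l hj)
    · rw [Nat.ModEq]
      omega

theorem eigenvalue_lt_step (T : RepTile) (m : Fin T.dim → ℕ) :
    T.eigenvalue m < T.eigenvalue (T.step m) := by
  have h0 := T.step_first m
  cases T with
  | triangle =>
    have h4 : triangle.step m (1 : Fin 2) = m (1 : Fin 2) :=
      step_of_ne triangle m (show (1 : Fin 2) ≠ 0 by decide)
    replace h0 : triangle.step m (0 : Fin 2) = m (0 : Fin 2) + 1 := h0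
    change ((m (0 : Fin 2) : ℕ) : ℝ) ^ 2 + ((m (1 : Fin 2) : ℕ) : ℝ) ^ 2 <
      ((triangle.step m (0 : Fin 2) : ℕ) : ℝ) ^ 2 + ((triangle.step m (1 : Fin 2) : ℕ) : ℝ) ^ 2
    rw [h0, h4]
    push_cast
    nlinarith [Nat.cast_nonneg (α := ℝ) (m (0 : Fin 2))]
  | box n hn =>
    refine Finset.sum_lt_sum (fun j _ => ?_) ⟨(box n hn).first, Finset.mem_univ _, ?_⟩
    · have := (box n hn).γ_pos
      gcongr
      by_cases hj : j = (box n hn).first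
      · rw [hj, h0]; exact Nat.le_succ _
      · exact (step_of_ne (box n hn) m hj).ge
    · have := (box n hn).γ_pos
      gcongr
      rw [h0]; exact Nat.lt_succ_self _

/-- The contribution of the odd boundary points is at least one: the left neighbour of an even
quantum number of the eigenvalue `lam` is such a point. -/
theorem exists_mem_boundary (T : RepTile) {lam : ℝ} (hlam : lam ∈ T.evenSpectrum) :
    (T.rightBoundary (T.quantumNumbersBelow lam) ∩ T.oddNumbers).Nonempty := by
  obtain ⟨m, hm, rfl⟩ := hlam
  obtain ⟨l, hl, rfl⟩ := T.exists_step_eq_of_mem_evenNumbers hm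
  refine ⟨l, ⟨⟨?_, T.eigenvalue_lt_step l⟩, fun h => lt_irrefl _ h.2⟩, hl⟩
  rw [T.quantumNumbers_eq_union]
  exact Or.inr hl

/-- The odd quantum numbers below `lam` that are not on the right boundary are the left neighbours of
the even quantum numbers below `lam`. -/
theorem ncard_quantumNumbersBelow (T : RepTile) {lam : ℝ}
    (hfin : (T.quantumNumbersBelow lam).Finite) :
    (T.quantumNumbersBelow lam).ncard =
      2 * (T.quantumNumbersBelow lam ∩ T.evenNumbers).ncard + T.oddBoundaryCount lam := by
  set Q := T.quantumNumbersBelow lam with hQ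
  have h1 : Q = (Q ∩ T.evenNumbers) ∪ (Q ∩ T.oddNumbers) := by
    rw [← inter_union_distrib_left, ← T.quantumNumbers_eq_union]
    exact (inter_eq_left.2 fun m hm => hm.1).symm
  have h2 : Q ∩ T.oddNumbers = (Q ∩ T.oddNumbers) ∩ T.step ⁻¹' Q ∪
      (T.rightBoundary Q ∩ T.oddNumbers) := by
    ext m
    by_cases h : T.step m ∈ Q
    · refine ⟨fun hm => Or.inl ⟨hm, h⟩, ?_⟩
      rintro (hm | hm)
      · exact hm.1
      · exact ⟨hm.1.1, hm.2⟩
    · refine ⟨fun hm => Or.inr ⟨⟨hm.1, h⟩, hm.2⟩, ?_⟩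
      rintro (hm | hm)
      · exact hm.1
      · exact ⟨hm.1.1, hm.2⟩
  have h3 : T.step '' ((Q ∩ T.oddNumbers) ∩ T.step ⁻¹' Q) = Q ∩ T.evenNumbers := by
    ext m
    constructor
    · rintro ⟨l, ⟨⟨_, hl⟩, hl'⟩, rfl⟩
      exact ⟨hl', T.step_mem_evenNumbers hl⟩
    · rintro ⟨hm, hm'⟩
      obtain ⟨l, hl, rfl⟩ := T.exists_step_eq_of_mem_evenNumbers hm'
      refine ⟨l, ⟨⟨⟨?_, (T.eigenvalue_lt_step l).trans hm.2⟩, hl⟩, hm⟩, rfl⟩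
      rw [T.quantumNumbers_eq_union]
      exact Or.inr hl
  have h4 : (Q ∩ T.oddNumbers).ncard = (Q ∩ T.evenNumbers).ncard + T.oddBoundaryCount lam := by
    rw [h2, ncard_union_eq ?_ ((hfin.inter_of_left _).inter_of_left _)
      (hfin.subset fun _ hm => hm.1.1), ← h3, ncard_image_of_injective _ T.step_injective]
    · rfl
    · exact Set.disjoint_left.2 fun m hm hm' => hm'.1.2 hm.2
  rw [h1, ncard_union_eq ?_ (hfin.inter_of_left _) (hfin.inter_of_left _), ← h1, h4]
  · ring
  · exact (T.disjoint_even_odd.inter_left' _).inter_right' _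

/-! ### The spectral theory of the rep-tiles -/

theorem exists_dirichletSystem_triangle :
    ∃ (φ : triangle.quantumNumbers → EuclideanSpace ℝ (Fin triangle.dim) → ℝ)
      (σ : triangle.quantumNumbers → triangle.quantumNumbers),
      DirichletSystem triangle.domain φ (fun m => triangle.eigenvalue m) ∧
      Function.Injective σ ∧ range σ = {m | m.1 ∈ triangle.evenNumbers} ∧
      (∀ m, triangle.eigenvalue (σ m) = triangle.γ ^ 2 * triangle.eigenvalue m) ∧
      ∀ j, nodalDeficiency triangle.domain (triangle.eigenvalue (σ j)) =
        2 * nodalDeficiency triangle.domain (triangle.eigenvalue j) +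
          (count triangle.domain (triangle.eigenvalue (σ j)) : ℤ) -
          2 * (count triangle.domain (triangle.eigenvalue j) : ℤ) := by
  have hγ : triangle.γ ^ 2 = 2 := Real.sq_sqrt two_pos.le
  let σ : TriIndex → TriIndex := fun m => ⟨triShift m.1, (triShift_mem m.2).1⟩
  have hσ : Function.Injective σ := fun m m' h =>
    Subtype.ext (triShift_injective m.2.2 m'.2.2 (congrArg Subtype.val h))
  have hrange : ∀ m : TriIndex, m.1 0 ≡ m.1 1 [MOD 2] → m ∈ range σ := fun m hm => by
    obtain ⟨l, hl, h⟩ := exists_triShift_eq m.2 hm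
    exact ⟨⟨l, hl⟩, Subtype.ext h⟩
  refine ⟨fun m : TriIndex => triFun m, σ, dirichletSystem_triangle, hσ, ?_, fun m => ?_,
    fun j => ?_⟩
  · ext m
    constructor
    · rintro ⟨l, rfl⟩
      exact ⟨(triShift_mem l.2).1, (triShift_mem l.2).2⟩
    · exact fun hm => hrange m hm.2
  · rw [hγ]
    exact triShift_sq_add_sq m.2.2
  · exact repTiling_triangle.nodalDeficiency_eq dirichletSystem_triangle (σ := σ) two_ne_zero hσ
      (fun m => triShift_sq_add_sq m.2.2) (fun m x => triFun_triShift_triHalf m.2.2 x)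
      (fun m x => triFun_triRefl (triShift_mem m.2).2 x) j
      fun i hi => hrange i (modEq_of_sq_add_sq_eq (triShift_mem j.2).2 hi)

theorem exists_dirichletSystem_box (k : ℕ) (hk : 2 ≤ k + 2) :
    ∃ (φ : (box (k + 2) hk).quantumNumbers → EuclideanSpace ℝ (Fin (box (k + 2) hk).dim) → ℝ)
      (σ : (box (k + 2) hk).quantumNumbers → (box (k + 2) hk).quantumNumbers),
      DirichletSystem (box (k + 2) hk).domain φ (fun m => (box (k + 2) hk).eigenvalue m) ∧
      Function.Injective σ ∧ range σ = {m | m.1 ∈ (box (k + 2) hk).evenNumbers} ∧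
      (∀ m, (box (k + 2) hk).eigenvalue (σ m) =
        (box (k + 2) hk).γ ^ 2 * (box (k + 2) hk).eigenvalue m) ∧
      ∀ j, nodalDeficiency (box (k + 2) hk).domain ((box (k + 2) hk).eigenvalue (σ j)) =
        2 * nodalDeficiency (box (k + 2) hk).domain ((box (k + 2) hk).eigenvalue j) +
          (count (box (k + 2) hk).domain ((box (k + 2) hk).eigenvalue (σ j)) : ℤ) -
          2 * (count (box (k + 2) hk).domain ((box (k + 2) hk).eigenvalue j) : ℤ) := by
  have hγ := (box (k + 2) hk).γ_pos
  have hγ2 := box_γ_pow (k + 2) hk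
  let I : Type := {m : Fin (k + 2) → ℕ // ∀ j, 1 ≤ m j}
  let σ : I → I := fun m => ⟨boxShift m.1, (boxShift_mem m.2).1⟩
  have hσ : Function.Injective σ := fun m m' h =>
    Subtype.ext (boxShift_injective (congrArg Subtype.val h))
  have hrange : ∀ m : I, m.1 0 ≡ 0 [MOD 2] → m ∈ range σ := fun m hm => by
    obtain ⟨l, hl, h⟩ := exists_boxShift_eq m.2 hm
    exact ⟨⟨l, hl⟩, Subtype.ext h⟩
  have S := dirichletSystem_box (n := k + 2) (a := fun j => (box (k + 2) hk).γ ^ (j : ℕ))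
    fun j => pow_pos hγ _
  refine ⟨fun m : I => sinProd (fun j => (box (k + 2) hk).γ ^ (j : ℕ)) m.1, σ, S, hσ, ?_,
    fun m => sum_boxShift hγ2 m.1, fun j => ?_⟩
  · ext m
    constructor
    · rintro ⟨l, rfl⟩
      exact ⟨(boxShift_mem l.2).1, (boxShift_mem l.2).2⟩
    · exact fun hm => hrange m hm.2
  · exact (repTiling_box hγ hγ2).nodalDeficiency_eq S (σ := σ) (pow_ne_zero 2 hγ.ne') hσ
      (fun m => sum_boxShift hγ2 m.1) (fun m x => sinProd_boxShift_boxHalf hγ.ne' hγ2 m.1 x)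
      (fun m x => sinProd_boxRefl (boxShift_mem m.2).2 x) j
      fun i hi => hrange i (modEq_of_sum_eq hγ2 (boxShift_mem j.2).2 hi)

theorem exists_dirichletSystem (T : RepTile) :
    ∃ (φ : T.quantumNumbers → EuclideanSpace ℝ (Fin T.dim) → ℝ)
      (σ : T.quantumNumbers → T.quantumNumbers),
      DirichletSystem T.domain φ (fun m => T.eigenvalue m) ∧
      Function.Injective σ ∧ range σ = {m | m.1 ∈ T.evenNumbers} ∧
      (∀ m, T.eigenvalue (σ m) = T.γ ^ 2 * T.eigenvalue m) ∧
      ∀ j, nodalDeficiency T.domain (T.eigenvalue (σ j)) =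
        2 * nodalDeficiency T.domain (T.eigenvalue j) +
          (count T.domain (T.eigenvalue (σ j)) : ℤ) -
          2 * (count T.domain (T.eigenvalue j) : ℤ) := by
  cases T with
  | triangle => exact exists_dirichletSystem_triangle
  | box n hn =>
    obtain ⟨k, rfl⟩ : ∃ k, n = k + 2 := ⟨n - 2, by omega⟩
    exact exists_dirichletSystem_box k hn

theorem finite_quantumNumbersBelow (T : RepTile) (lam : ℝ) :
    (T.quantumNumbersBelow lam).Finite := by
  obtain ⟨φ, σ, S, -⟩ := T.exists_dirichletSystem
  refine ((S.finite lam).image Subtype.val).subset ?_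
  rintro m ⟨hm, h⟩
  exact ⟨⟨m, hm⟩, h.le, rfl⟩

theorem one_le_oddBoundaryCount (T : RepTile) {lam : ℝ} (hlam : lam ∈ T.evenSpectrum) :
    1 ≤ T.oddBoundaryCount lam :=
  (ncard_pos ((T.finite_quantumNumbersBelow lam).subset fun _ hm => hm.1.1)).2
    (T.exists_mem_boundary hlam)

/-- Two different odd boundary points are enough for the count to be at least two. -/
theorem two_le_oddBoundaryCount (T : RepTile) {lam : ℝ} {m l : Fin T.dim → ℕ}
    (hm : m ∈ T.rightBoundary (T.quantumNumbersBelow lam) ∩ T.oddNumbers)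
    (hl : l ∈ T.rightBoundary (T.quantumNumbersBelow lam) ∩ T.oddNumbers) (hne : m ≠ l) :
    2 ≤ T.oddBoundaryCount lam :=
  (one_lt_ncard_iff ((T.finite_quantumNumbersBelow lam).subset fun _ hm => hm.1.1)).2
    ⟨m, l, hm, hl, hne⟩

/-- The recursion for the nodal deficiency of even eigenvalues. -/
theorem nodalDeficiency_recursion (T : RepTile) {lam : ℝ} (hlam : lam ∈ T.evenSpectrum) :
    DeficiencyWellDefined T.domain lam ∧
    DeficiencyWellDefined T.domain ((T.γ ^ 2)⁻¹ * lam) ∧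
    0 ≤ nodalDeficiency T.domain ((T.γ ^ 2)⁻¹ * lam) ∧
    nodalDeficiency T.domain lam =
      2 * nodalDeficiency T.domain ((T.γ ^ 2)⁻¹ * lam) + (T.oddBoundaryCount lam : ℤ) - 1 := by
  obtain ⟨φ, σ, S, hσ, hrange, hlamσ, hrec⟩ := T.exists_dirichletSystem
  have hγ := T.γ_pos
  have hcount : ∀ i : T.quantumNumbers, count T.domain (T.eigenvalue i) =
      (T.quantumNumbersBelow (T.eigenvalue i)).ncard + 1 := by
    intro i
    have : (Subtype.val '' {j : T.quantumNumbers | T.eigenvalue j < T.eigenvalue i}) =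
        T.quantumNumbersBelow (T.eigenvalue i) := by
      ext m
      constructor
      · rintro ⟨j, hj, rfl⟩
        exact ⟨j.2, hj⟩
      · rintro ⟨hm, h⟩
        exact ⟨⟨m, hm⟩, h, rfl⟩
    rw [← this, ncard_image_of_injective _ Subtype.val_injective]
    exact S.count_eq i
  obtain ⟨m, hm, rfl⟩ := hlam
  have hmQ : m ∈ T.quantumNumbers := by rw [T.quantumNumbers_eq_union]; exact Or.inl hm
  obtain ⟨j, hj⟩ : (⟨m, hmQ⟩ : T.quantumNumbers) ∈ range σ := by rw [hrange]; exact hm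
  have hmj : T.eigenvalue m = T.eigenvalue (σ j) := by rw [hj]
  have hscale : (T.γ ^ 2)⁻¹ * T.eigenvalue m = T.eigenvalue j := by
    rw [hmj, hlamσ, inv_mul_cancel_left₀ (by positivity)]
  rw [hscale, hmj]
  refine ⟨S.deficiencyWellDefined (σ j), S.deficiencyWellDefined j, S.nodalDeficiency_nonneg j, ?_⟩
  -- the quantum numbers below the smaller eigenvalue correspond to the even ones below the larger
  have himage : (Subtype.val ∘ σ) '' {i : T.quantumNumbers | T.eigenvalue i < T.eigenvalue j} =
      T.quantumNumbersBelow (T.eigenvalue (σ j)) ∩ T.evenNumbers := by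
    ext l
    constructor
    · rintro ⟨i, hi, rfl⟩
      refine ⟨⟨(σ i).2, ?_⟩, ?_⟩
      · change T.eigenvalue (σ i) < _
        rw [hlamσ, hlamσ]
        exact mul_lt_mul_of_pos_left hi (by positivity)
      · have : σ i ∈ range σ := mem_range_self i
        rwa [hrange] at this
    · rintro ⟨⟨hl, hl'⟩, he⟩
      obtain ⟨i, hi⟩ : (⟨l, hl⟩ : T.quantumNumbers) ∈ range σ := by rw [hrange]; exact he
      refine ⟨i, ?_, congrArg Subtype.val hi⟩
      have h1 : T.eigenvalue (σ i) < T.eigenvalue (σ j) := by rw [hi]; exact hl'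
      rw [hlamσ, hlamσ] at h1
      exact lt_of_mul_lt_mul_left h1 (by positivity)
  have hcard : (T.quantumNumbersBelow (T.eigenvalue (σ j)) ∩ T.evenNumbers).ncard + 1 =
      count T.domain (T.eigenvalue j) := by
    rw [← himage, ncard_image_of_injective _ (Subtype.val_injective.comp hσ)]
    exact (S.count_eq j).symm
  rw [hrec j, ← hcard, hcount (σ j),
    T.ncard_quantumNumbersBelow (T.finite_quantumNumbersBelow _)]
  push_cast
  ring

/-- An eigenvalue with positive nodal deficiency is not Courant-sharp. -/
theorem not_isCourantSharp (T : RepTile) {lam : ℝ} (hlam : lam ∈ T.evenSpectrum)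
    (hpos : 0 < nodalDeficiency T.domain lam) : ¬ IsCourantSharp T.domain lam := by
  rintro ⟨f, hf, h⟩
  have := (T.nodalDeficiency_recursion hlam).1.isLeast.2 ⟨f, hf, rfl⟩
  rw [eigenfunctionDeficiency, h, sub_self] at this
  omega

end RepTile

/-! ### A second odd boundary point for the triangle -/

namespace RepTile

theorem vec_mem_boundary_triangle {x c L : ℕ} (hc : 1 ≤ c) (hx : c < x) (h1 : x ^ 2 + c ^ 2 < L)
    (h2 : L ≤ (x + 1) ^ 2 + c ^ 2) (ho : x % 2 ≠ c % 2) :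
    (![x, c] : Fin 2 → ℕ) ∈
      triangle.rightBoundary (triangle.quantumNumbersBelow (L : ℝ)) ∩ triangle.oddNumbers := by
  have hq : (![x, c] : Fin 2 → ℕ) ∈ triangle.quantumNumbers := ⟨hc, hx⟩
  refine ⟨⟨⟨hq, ?_⟩, fun h => ?_⟩, hq, ho⟩
  · change ((x : ℕ) : ℝ) ^ 2 + ((c : ℕ) : ℝ) ^ 2 < L
    exact_mod_cast h1
  · have h3 : ((x + 1 : ℕ) : ℝ) ^ 2 + ((c : ℕ) : ℝ) ^ 2 < L := h.2
    have h4 : (x + 1) ^ 2 + c ^ 2 < L := by exact_mod_cast h3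
    omega

set_option synthInstance.maxSize 1000 in
theorem exists_odd_row_triangle_small : ∀ a < 14, ∀ b < a, 1 ≤ b → a % 2 = b % 2 →
    ¬ (a = 3 ∧ b = 1) → ∃ c < 6, c ≠ b ∧ 1 ≤ c ∧ ∃ x < 20, c < x ∧ x ^ 2 + c ^ 2 < a ^ 2 + b ^ 2 ∧
      a ^ 2 + b ^ 2 ≤ (x + 1) ^ 2 + c ^ 2 ∧ x % 2 ≠ c % 2 := by
  decide +kernel

/-- If `k ≥ 13` is the length of the first row, the first five rows have length `k` or `k - 1`,
and so two of them end at an odd point. -/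
theorem exists_odd_rows_triangle {k L : ℕ} (hk : 13 ≤ k) (h1 : k ^ 2 + 1 < L)
    (h2 : L ≤ (k + 1) ^ 2 + 1) : ∃ c c' x x', c ≠ c' ∧
      (1 ≤ c ∧ c < x ∧ x ^ 2 + c ^ 2 < L ∧ L ≤ (x + 1) ^ 2 + c ^ 2 ∧ x % 2 ≠ c % 2) ∧
      (1 ≤ c' ∧ c' < x' ∧ x' ^ 2 + c' ^ 2 < L ∧ L ≤ (x' + 1) ^ 2 + c' ^ 2 ∧ x' % 2 ≠ c' % 2) := by
  obtain ⟨j, rfl⟩ : ∃ j, k = j + 1 := ⟨k - 1, by omega⟩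
  have e1 : (j + 1 + 1) ^ 2 = (j + 1) ^ 2 + 2 * j + 3 := by ring
  have e2 : (j + 1) ^ 2 = j ^ 2 + 2 * j + 1 := by ring
  have hlong : ∀ c, 1 ≤ c → c ≤ 5 → (j + 1) ^ 2 + c ^ 2 < L → c < j + 1 ∧
      (j + 1) ^ 2 + c ^ 2 < L ∧ L ≤ (j + 1 + 1) ^ 2 + c ^ 2 := fun c hc hc' h => by
    have : 1 ≤ c ^ 2 := Nat.one_le_pow _ _ hc
    exact ⟨by omega, h, by omega⟩
  have hshort : ∀ c, 1 ≤ c → c ≤ 5 → ¬ (j + 1) ^ 2 + c ^ 2 < L → c < j ∧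
      j ^ 2 + c ^ 2 < L ∧ L ≤ (j + 1) ^ 2 + c ^ 2 := fun c hc hc' h => by
    have : c ^ 2 ≤ 5 ^ 2 := Nat.pow_le_pow_left hc' 2
    exact ⟨by omega, by omega, by omega⟩
  have hmono : ∀ c, (j + 1) ^ 2 + (c + 1) ^ 2 < L → (j + 1) ^ 2 + c ^ 2 < L := fun c h =>
    (Nat.add_le_add_left (Nat.pow_le_pow_left (Nat.le_succ c) 2) _).trans_lt h
  rcases Nat.mod_two_eq_zero_or_one (j + 1) with hp | hp
  · have l1 := hlong 1 (by omega) (by omega) (by simpa using h1)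
    by_cases h3 : (j + 1) ^ 2 + 3 ^ 2 < L
    · have l3 := hlong 3 (by omega) (by omega) h3
      exact ⟨1, 3, j + 1, j + 1, by omega, ⟨by omega, l1.1, l1.2.1, l1.2.2, by omega⟩,
        by omega, l3.1, l3.2.1, l3.2.2, by omega⟩
    · have s4 := hshort 4 (by omega) (by omega) fun h => h3 (hmono 3 h)
      exact ⟨1, 4, j + 1, j, by omega, ⟨by omega, l1.1, l1.2.1, l1.2.2, by omega⟩,
        by omega, s4.1, s4.2.1, s4.2.2, by omega⟩
  · by_cases h2' : (j + 1) ^ 2 + 2 ^ 2 < L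
    · have l2 := hlong 2 (by omega) (by omega) h2'
      by_cases h4 : (j + 1) ^ 2 + 4 ^ 2 < L
      · have l4 := hlong 4 (by omega) (by omega) h4
        exact ⟨2, 4, j + 1, j + 1, by omega, ⟨by omega, l2.1, l2.2.1, l2.2.2, by omega⟩,
          by omega, l4.1, l4.2.1, l4.2.2, by omega⟩
      · have s5 := hshort 5 (by omega) (by omega) fun h => h4 (hmono 4 h)
        exact ⟨2, 5, j + 1, j, by omega, ⟨by omega, l2.1, l2.2.1, l2.2.2, by omega⟩,
          by omega, s5.1, s5.2.1, s5.2.2, by omega⟩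
    · have s3 := hshort 3 (by omega) (by omega) fun h => h2' (hmono 2 h)
      have s5 := hshort 5 (by omega) (by omega) fun h => h2' (hmono 2 (hmono 3 (hmono 4 h)))
      exact ⟨3, 5, j, j, by omega, ⟨by omega, s3.1, s3.2.1, s3.2.2, by omega⟩,
        by omega, s5.1, s5.2.1, s5.2.2, by omega⟩

theorem two_le_oddBoundaryCount_triangle {lam : ℝ} (hlam : lam ∈ triangle.evenSpectrum)
    (hne : ¬ IsLeast triangle.evenSpectrum lam) : 2 ≤ triangle.oddBoundaryCount lam := by
  obtain ⟨m, ⟨⟨hm1, hm2⟩, hm3⟩, hm⟩ := id hlam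
  have hvec : ∀ {x c x' c' : ℕ}, c ≠ c' → (![x, c] : Fin 2 → ℕ) ≠ ![x', c'] := fun h h' =>
    h (by simpa using congrFun h' 1)
  obtain ⟨a, ha⟩ : ∃ a, m (0 : Fin 2) = a := ⟨_, rfl⟩
  obtain ⟨b, hb⟩ : ∃ b, m (1 : Fin 2) = b := ⟨_, rfl⟩
  have hL : lam = ((a ^ 2 + b ^ 2 : ℕ) : ℝ) := by
    rw [← hm, ← ha, ← hb]
    push_cast
    rfl
  rw [hb] at hm1
  rw [ha, hb] at hm2
  replace hm3 : a % 2 = b % 2 := by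
    rw [← ha, ← hb]; exact hm3
  have hab : ¬ (a = 3 ∧ b = 1) := by
    rintro ⟨h3, h1⟩
    refine hne ⟨hlam, ?_⟩
    rintro _ ⟨l, ⟨⟨hl1, hl2⟩, hl3⟩, rfl⟩
    rw [hL, h3, h1]
    have hl3' : l (0 : Fin 2) % 2 = l (1 : Fin 2) % 2 := hl3
    change _ ≤ ((l (0 : Fin 2) : ℕ) : ℝ) ^ 2 + ((l (1 : Fin 2) : ℕ) : ℝ) ^ 2
    have h5 : 3 ≤ l (0 : Fin 2) := by
      generalize l (0 : Fin 2) = u at *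
      generalize l (1 : Fin 2) = v at *
      omega
    have h6 : 3 ^ 2 + 1 ^ 2 ≤ l (0 : Fin 2) ^ 2 + l (1 : Fin 2) ^ 2 :=
      Nat.add_le_add (Nat.pow_le_pow_left h5 2) (Nat.pow_le_pow_left hl1 2)
    exact_mod_cast h6
  rw [hL]
  by_cases ha14 : a < 14
  · obtain ⟨c, -, hcb, hc, x, -, hx, h1, h2, h3⟩ :=
      exists_odd_row_triangle_small a ha14 b hm2 hm1 hm3 hab
    obtain ⟨j, rfl⟩ : ∃ j, a = j + 1 := ⟨a - 1, by omega⟩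
    refine two_le_oddBoundaryCount triangle (vec_mem_boundary_triangle hc hx h1 h2 h3)
      (vec_mem_boundary_triangle (x := j) (c := b) hm1 (by omega) ?_ le_rfl (by omega)) (hvec hcb)
    have : j ^ 2 < (j + 1) ^ 2 := Nat.pow_lt_pow_left (Nat.lt_succ_self j) two_ne_zero
    omega
  · set L := a ^ 2 + b ^ 2 with hLdef
    have hb2 : 1 ≤ b ^ 2 := Nat.one_le_pow _ _ hm1
    have ha2 : 14 ^ 2 ≤ a ^ 2 := Nat.pow_le_pow_left (by omega) 2
    have hs1 := Nat.sqrt_le' (L - 2)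
    have hs2 := Nat.succ_le_succ_sqrt' (L - 2)
    have hk : 13 ≤ Nat.sqrt (L - 2) := Nat.le_sqrt'.2 (by omega)
    obtain ⟨c, c', x, x', hcc, ⟨h1, h2, h3, h4, h5⟩, k1, k2, k3, k4, k5⟩ :=
      exists_odd_rows_triangle (L := L) hk (by omega) (by omega)
    exact two_le_oddBoundaryCount triangle (vec_mem_boundary_triangle h1 h2 h3 h4 h5)
      (vec_mem_boundary_triangle k1 k2 k3 k4 k5) (hvec hcc)

end RepTile

/-! ### A second odd boundary point for the box -/

section BoxRows

variable {n : ℕ} {β : ℝ}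

/-- The eigenvalue of the box with `γ ^ 2 = β` that belongs to `m`. -/
def boxSum (β : ℝ) (m : Fin n → ℕ) : ℝ := ∑ j : Fin n, β ^ (j : ℕ) * (m j : ℝ) ^ 2

theorem boxSum_update (m : Fin n → ℕ) (j : Fin n) (t : ℕ) :
    boxSum β (Function.update m j t) =
      boxSum β m + β ^ (j : ℕ) * ((t : ℝ) ^ 2 - (m j : ℝ) ^ 2) := by
  rw [boxSum, boxSum, ← Finset.add_sum_erase _ _ (Finset.mem_univ j),
    ← Finset.add_sum_erase Finset.univ (fun j : Fin n => β ^ (j : ℕ) * (m j : ℝ) ^ 2) (Finset.mem_univ j),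
    Function.update_self]
  have : ∀ i ∈ Finset.univ.erase j, β ^ (i : ℕ) * (Function.update m j t i : ℝ) ^ 2 =
      β ^ (i : ℕ) * (m i : ℝ) ^ 2 := fun i hi => by
    rw [Function.update_of_ne (Finset.ne_of_mem_erase hi)]
  rw [Finset.sum_congr rfl this]
  ring

/-- The quantum number `l` is an odd point of the right boundary below `lam`, that is, the odd end of
its row. Here `z` is the first coordinate. -/
def IsOddEnd (β lam : ℝ) (z : Fin n) (l : Fin n → ℕ) : Prop :=
  (∀ j, 1 ≤ l j) ∧ l z % 2 = 1 ∧ boxSum β l < lam ∧ lam ≤ boxSum β l + 2 * l z + 1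

/-- A lower bound for the cost of a row, from any part of its entries. -/
theorem sum_le_boxSum_sub (hβ : 0 < β) {l : Fin n → ℕ} (hl : ∀ j, 1 ≤ l j) (s : Finset (Fin n)) :
    ∑ j ∈ s, β ^ (j : ℕ) * ((l j : ℝ) ^ 2 - 1) ≤ boxSum β l - boxSum β fun _ : Fin n => 1 := by
  rw [boxSum, boxSum, ← Finset.sum_sub_distrib]
  have h : ∀ j : Fin n, β ^ (j : ℕ) * ((l j : ℝ) ^ 2 - 1) =
      β ^ (j : ℕ) * (l j : ℝ) ^ 2 - β ^ (j : ℕ) * ((1 : ℕ) : ℝ) ^ 2 := fun j => by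
    push_cast; ring
  simp only [← h]
  refine Finset.sum_le_univ_sum_of_nonneg fun j => mul_nonneg (by positivity) ?_
  have : (1 : ℝ) ≤ l j := by exact_mod_cast hl j
  nlinarith

/-- A row with first entry `x`, whose cost exceeds that of the row of ones by `d`. -/
theorem isOddEnd_of_cost {z : Fin n} {l : Fin n → ℕ} {lam d δ : ℝ} (hl : ∀ j, 1 ≤ l j)
    (ho : l z % 2 = 1)
    (hlam : lam = boxSum β (fun _ : Fin n => 1) + (((l z : ℝ) + 1) ^ 2 - 1) + δ)
    (hd : boxSum β l = boxSum β (fun _ : Fin n => 1) + ((l z : ℝ) ^ 2 - 1) + d)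
    (h0 : δ ≤ d) (h1 : d < δ + 2 * l z + 1) : IsOddEnd β lam z l :=
  ⟨hl, ho, by rw [hlam, hd]; linarith, by rw [hlam, hd]; linarith⟩

theorem update_pos {l : Fin n → ℕ} (hl : ∀ j, 1 ≤ l j) {i : Fin n} {t : ℕ} (ht : 1 ≤ t) (j : Fin n) :
    1 ≤ Function.update l i t j := by
  by_cases h : j = i
  · subst h; rwa [Function.update_self]
  · rw [Function.update_of_ne h]; exact hl j

/-- The row with first entry `x` and otherwise entries one. -/
theorem exists_row (z : Fin n) (hz : (z : ℕ) = 0) {x : ℕ} (hx : 1 ≤ x) :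
    ∃ l : Fin n → ℕ, (∀ j, 1 ≤ l j) ∧ l z = x ∧ (∀ j, j ≠ z → l j = 1) ∧
      boxSum β l = boxSum β (fun _ : Fin n => 1) + ((x : ℝ) ^ 2 - 1) := by
  refine ⟨Function.update (fun _ => 1) z x, fun j => update_pos (fun _ => le_rfl) hx j,
    Function.update_self .., fun j hj => Function.update_of_ne hj .., ?_⟩
  rw [boxSum_update, hz]
  simp

/-- The row with first entry `x`, second entry `t` and otherwise entries one. -/
theorem exists_row₁ (z : Fin n) (hz : (z : ℕ) = 0) (hn : 2 ≤ n) {x t : ℕ} (hx : 1 ≤ x)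
    (ht : 1 ≤ t) :
    ∃ l : Fin n → ℕ, (∀ j, 1 ≤ l j) ∧ l z = x ∧ (∀ j : Fin n, 2 ≤ (j : ℕ) → l j = 1) ∧
      boxSum β l = boxSum β (fun _ : Fin n => 1) + ((x : ℝ) ^ 2 - 1) + β * ((t : ℝ) ^ 2 - 1) := by
  obtain ⟨l, h1, h2, h3, h4⟩ := exists_row (β := β) z hz hx
  have hne : (⟨1, by omega⟩ : Fin n) ≠ z := fun h => by
    have := congrArg Fin.val h; simp only at this; omega
  refine ⟨Function.update l ⟨1, by omega⟩ t, update_pos h1 ht, ?_, fun j hj => ?_, ?_⟩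
  · rw [Function.update_of_ne hne.symm, h2]
  · rw [Function.update_of_ne (fun h => by rw [h] at hj; simp at hj)]
    exact h3 j fun h => by rw [h] at hj; omega
  · rw [boxSum_update, h4, h3 _ hne]
    simp

/-- The row with first entries `x`, `t`, `u` and otherwise entries one. -/
theorem exists_row₂ (z : Fin n) (hz : (z : ℕ) = 0) (hn : 3 ≤ n) {x t u : ℕ} (hx : 1 ≤ x)
    (ht : 1 ≤ t) (hu : 1 ≤ u) :
    ∃ l : Fin n → ℕ, (∀ j, 1 ≤ l j) ∧ l z = x ∧ (∀ j : Fin n, 3 ≤ (j : ℕ) → l j = 1) ∧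
      boxSum β l = boxSum β (fun _ : Fin n => 1) + ((x : ℝ) ^ 2 - 1) + β * ((t : ℝ) ^ 2 - 1) +
        β ^ 2 * ((u : ℝ) ^ 2 - 1) := by
  obtain ⟨l, h1, h2, h3, h4⟩ := exists_row₁ (β := β) z hz (by omega) hx ht
  refine ⟨Function.update l ⟨2, by omega⟩ u, update_pos h1 hu, ?_, fun j hj => ?_, ?_⟩
  · rw [Function.update_of_ne (fun h => by rw [h] at hz; simp at hz), h2]
  · rw [Function.update_of_ne (fun h => by rw [h] at hj; simp at hj)]
    exact h3 j (by omega)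
  · rw [boxSum_update, h4, h3 _ le_rfl]
    simp

/-- The row with first entries `x`, `t`, `u`, `v` and otherwise entries one. -/
theorem exists_row₃ (z : Fin n) (hz : (z : ℕ) = 0) (hn : 4 ≤ n) {x t u v : ℕ} (hx : 1 ≤ x)
    (ht : 1 ≤ t) (hu : 1 ≤ u) (hv : 1 ≤ v) :
    ∃ l : Fin n → ℕ, (∀ j, 1 ≤ l j) ∧ l z = x ∧
      boxSum β l = boxSum β (fun _ : Fin n => 1) + ((x : ℝ) ^ 2 - 1) + β * ((t : ℝ) ^ 2 - 1) +
        β ^ 2 * ((u : ℝ) ^ 2 - 1) + β ^ 3 * ((v : ℝ) ^ 2 - 1) := by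
  obtain ⟨l, h1, h2, h3, h4⟩ := exists_row₂ (β := β) z hz (by omega) hx ht hu
  refine ⟨Function.update l ⟨3, by omega⟩ v, update_pos h1 hv, ?_, ?_⟩
  · rw [Function.update_of_ne (fun h => by rw [h] at hz; simp at hz), h2]
  · rw [boxSum_update, h4, h3 _ le_rfl]
    simp

theorem le_two_of_pow_eq (hβ : 1 < β) (hn : 2 ≤ n) (h : β ^ n = 4) : β ≤ 2 := by
  by_contra! hlt
  have h1 : β ^ 2 ≤ β ^ n := pow_le_pow_right₀ hβ.le hn
  nlinarith

theorem lt_of_pow_eq (hβ : 1 < β) (hn : 3 ≤ n) (h : β ^ n = 4) : β < 8 / 5 := by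
  by_contra! hlt
  have h1 : β ^ 3 ≤ β ^ n := pow_le_pow_right₀ hβ.le hn
  have h2 : (8 / 5 : ℝ) ^ 3 ≤ β ^ 3 := by gcongr
  norm_num at h2
  linarith

/-! #### Rows that are modifications of the row of ones -/

/-- The increment of the cost from `u` to `u + 1` is small compared with the cost itself. -/
theorem increment_lt (hβ : 1 < β) (hβ2 : β ≤ 2) {u x : ℕ} (hx : 7 ≤ x)
    (h : β * ((u : ℝ) ^ 2 - 1) ≤ 2 * x + 3) : β * (2 * u + 1) < 2 * x + 1 := by
  by_contra! hcon
  have hx' : (7 : ℝ) ≤ x := by exact_mod_cast hx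
  have hu : 4 ≤ u := by
    by_contra! hu
    have : (u : ℝ) ≤ 3 := by exact_mod_cast Nat.le_of_lt_succ hu
    nlinarith
  have hu' : (4 : ℝ) ≤ u := by exact_mod_cast hu
  have h1 : (6 : ℝ) ≤ (u : ℝ) ^ 2 - 2 * u - 2 := by nlinarith
  nlinarith

/-- Long rows in any dimension: only the second entry of the row of ones has to be changed. -/
theorem exists_isOddEnd_large (hβ : 1 < β) (hβ2 : β ≤ 2) (hn : 2 ≤ n) {z : Fin n}
    (hz : (z : ℕ) = 0) {x : ℕ} (hx : 7 ≤ x) (ho : x % 2 = 1) {lam δ : ℝ}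
    (hlam : lam = boxSum β (fun _ : Fin n => 1) + (((x : ℝ) + 1) ^ 2 - 1) + δ)
    (hδ0 : 0 < δ) (hδ : δ ≤ 2 * x + 3) : ∃ l, IsOddEnd β lam z l ∧ l z = x := by
  classical
  -- the first row of the form `(t, 1, …, 1)` that is not longer than `x`
  have hex : ∃ t : ℕ, δ ≤ β * ((t : ℝ) ^ 2 - 1) := by
    obtain ⟨t, ht⟩ := exists_nat_gt (δ + 1)
    have h : δ ≤ (t : ℝ) ^ 2 - 1 := by nlinarith
    exact ⟨t, by nlinarith⟩
  obtain ⟨u, hu⟩ : ∃ u, Nat.find hex = u + 1 := by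
    refine ⟨Nat.find hex - 1, ?_⟩
    have : Nat.find hex ≠ 0 := fun h0 => by
      have h := Nat.find_spec hex
      rw [h0] at h
      norm_num at h
      linarith
    omega
  have h1 := Nat.find_spec hex
  have h2 : β * ((u : ℝ) ^ 2 - 1) < δ := not_le.1 (Nat.find_min hex (m := u) (by omega))
  rw [hu] at h1
  have h3 := increment_lt hβ hβ2 hx (h2.le.trans hδ)
  obtain ⟨l, hl, hlz, -, hls⟩ := exists_row₁ (β := β) z hz hn (x := x) (t := u + 1) (by omega)
    (by omega)
  subst hlz
  refine ⟨l, isOddEnd_of_cost hl ho hlam hls h1 ?_, rfl⟩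
  push_cast
  linarith

/-- A row with end `3`: among the increments `3 β`, `3 β ^ 2`, `3 β + 3 β ^ 2` and
`3 β + 3 β ^ 2 + 3 β ^ 3` of the cost there is one in the interval `[δ, δ + 7)`. -/
theorem exists_isOddEnd_three (hβ : 1 < β) (hn : 3 ≤ n) (hβn : β ^ n = 4) {z : Fin n}
    (hz : (z : ℕ) = 0) {lam δ : ℝ}
    (hlam : lam = boxSum β (fun _ : Fin n => 1) + (((3 : ℝ) + 1) ^ 2 - 1) + δ)
    (hδ0 : 0 < δ) (hδ : δ ≤ 9) : ∃ l, IsOddEnd β lam z l ∧ l z = 3 := by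
  have hβ2 := lt_of_pow_eq hβ hn hβn
  have key : ∀ (l : Fin n → ℕ) (d : ℝ), (∀ j, 1 ≤ l j) → l z = 3 →
      boxSum β l = boxSum β (fun _ : Fin n => 1) + ((3 : ℝ) ^ 2 - 1) + d → δ ≤ d → d < δ + 7 →
      ∃ l, IsOddEnd β lam z l ∧ l z = 3 := by
    intro l d hl hlz hls h1 h2
    refine ⟨l, isOddEnd_of_cost (d := d) (δ := δ) hl (by rw [hlz]) ?_ ?_ h1 ?_, hlz⟩ <;> rw [hlz]
    · exact_mod_cast hlam
    · exact_mod_cast hls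
    · push_cast; linarith
  have row : ∀ t u : ℕ, 1 ≤ t → 1 ≤ u →
      δ ≤ β * ((t : ℝ) ^ 2 - 1) + β ^ 2 * ((u : ℝ) ^ 2 - 1) →
      β * ((t : ℝ) ^ 2 - 1) + β ^ 2 * ((u : ℝ) ^ 2 - 1) < δ + 7 →
      ∃ l, IsOddEnd β lam z l ∧ l z = 3 := by
    intro t u ht hu h1 h2
    obtain ⟨l, hl, hlz, -, hls⟩ := exists_row₂ (β := β) z hz hn (x := 3) (by omega) ht hu
    refine key l _ hl hlz ?_ h1 h2
    rw [hls]; push_cast; ring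
  by_cases c1 : δ ≤ 3 * β
  · exact row 2 1 (by omega) (by omega) (by norm_num; linarith) (by norm_num; linarith)
  by_cases c2 : δ ≤ 3 * β ^ 2
  · exact row 1 2 (by omega) (by omega) (by norm_num; linarith) (by norm_num; nlinarith)
  by_cases c3 : δ ≤ 3 * β + 3 * β ^ 2
  · exact row 2 2 (by omega) (by omega) (by norm_num; linarith) (by norm_num; linarith)
  · -- now `β` is small, hence the dimension is larger than three
    have hβ3 : β < 1.31 := by
      by_contra! h
      nlinarith
    have hb3 : β ^ 3 < 7 / 3 := by
      calc β ^ 3 < (1.31 : ℝ) ^ 3 := by gcongr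
        _ < 7 / 3 := by norm_num
    have hn4 : 4 ≤ n := by
      by_contra! h
      obtain rfl : n = 3 := by omega
      linarith
    obtain ⟨l, hl, hlz, hls⟩ := exists_row₃ (β := β) z hz hn4 (x := 3) (t := 2) (u := 2) (v := 2)
      (by omega) (by omega) (by omega) (by omega)
    refine key l (3 * β + 3 * β ^ 2 + 3 * β ^ 3) hl hlz ?_ ?_ ?_
    · rw [hls]; push_cast; ring
    · have : 1 < β ^ 2 := one_lt_pow₀ hβ two_ne_zero
      have : 1 < β ^ 3 := one_lt_pow₀ hβ three_ne_zero
      linarith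
    · linarith

/-- A row with end `5`: among the increments `3 β`, `8 β`, `8 β + 3 β ^ 2` and `15 β` of the cost
there is one in the interval `[δ, δ + 11)`. -/
theorem exists_isOddEnd_five (hβ : 1 < β) (hn : 3 ≤ n) (hβn : β ^ n = 4) {z : Fin n}
    (hz : (z : ℕ) = 0) {lam δ : ℝ}
    (hlam : lam = boxSum β (fun _ : Fin n => 1) + (((5 : ℝ) + 1) ^ 2 - 1) + δ)
    (hδ0 : 0 < δ) (hδ : δ ≤ 13) : ∃ l, IsOddEnd β lam z l ∧ l z = 5 := by
  have hβ2 := lt_of_pow_eq hβ hn hβn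
  have row : ∀ t u : ℕ, 1 ≤ t → 1 ≤ u →
      δ ≤ β * ((t : ℝ) ^ 2 - 1) + β ^ 2 * ((u : ℝ) ^ 2 - 1) →
      β * ((t : ℝ) ^ 2 - 1) + β ^ 2 * ((u : ℝ) ^ 2 - 1) < δ + 11 →
      ∃ l, IsOddEnd β lam z l ∧ l z = 5 := by
    intro t u ht hu h1 h2
    obtain ⟨l, hl, hlz, -, hls⟩ := exists_row₂ (β := β) z hz hn (x := 5) (by omega) ht hu
    refine ⟨l, isOddEnd_of_cost (δ := δ) (d := β * ((t : ℝ) ^ 2 - 1) + β ^ 2 * ((u : ℝ) ^ 2 - 1))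
      hl (by rw [hlz]) ?_ ?_ h1 ?_, hlz⟩ <;> rw [hlz]
    · exact_mod_cast hlam
    · rw [hls]; ring
    · push_cast; linarith
  by_cases c1 : δ ≤ 3 * β
  · exact row 2 1 (by omega) (by omega) (by norm_num; linarith) (by norm_num; linarith)
  by_cases c2 : δ ≤ 8 * β
  · exact row 3 1 (by omega) (by omega) (by norm_num; linarith) (by norm_num; linarith)
  by_cases c3 : δ ≤ 8 * β + 3 * β ^ 2
  · exact row 3 2 (by omega) (by omega) (by norm_num; linarith) (by norm_num; nlinarith)
  · have hβ3 : β < 1.2 := by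
      by_contra! h
      nlinarith
    exact row 4 1 (by omega) (by omega) (by norm_num; linarith) (by norm_num; linarith)

/-! #### Rows that are modifications of a given row -/

section Modify

variable {z : Fin n} {p : Fin n → ℕ} {δ : ℝ}

/-- Each entry of a row is bounded by its cost. -/
theorem cost_entry_le (hβ : 1 < β) (hp : ∀ j, 1 ≤ p j) (hz : (z : ℕ) = 0)
    (hcost : boxSum β p = boxSum β (fun _ : Fin n => 1) + ((p z : ℝ) ^ 2 - 1) + δ)
    {j : Fin n} (hj : j ≠ z) : β ^ (j : ℕ) * ((p j : ℝ) ^ 2 - 1) ≤ δ := by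
  have h := sum_le_boxSum_sub (by linarith : 0 < β) hp {z, j}
  rw [Finset.sum_pair hj.symm, hz, hcost] at h
  linarith

/-- Two entries of a row are together bounded by its cost. -/
theorem cost_pair_le (hβ : 1 < β) (hp : ∀ j, 1 ≤ p j) (hz : (z : ℕ) = 0)
    (hcost : boxSum β p = boxSum β (fun _ : Fin n => 1) + ((p z : ℝ) ^ 2 - 1) + δ)
    {i j : Fin n} (hi : i ≠ z) (hj : j ≠ z) (hij : i ≠ j) :
    β ^ (i : ℕ) * ((p i : ℝ) ^ 2 - 1) + β ^ (j : ℕ) * ((p j : ℝ) ^ 2 - 1) ≤ δ := by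
  have h := sum_le_boxSum_sub (by linarith : 0 < β) hp {z, i, j}
  rw [Finset.sum_insert (by simp [hi.symm, hj.symm]), Finset.sum_pair hij, hz, hcost] at h
  linarith

/-- Increasing an entry of a row by one. -/
theorem isOddEnd_increase (hβ : 1 < β) (hp : ∀ j, 1 ≤ p j) (ho : p z % 2 = 1) {lam : ℝ}
    (hlam : lam = boxSum β p + 2 * p z + 1) {j : Fin n} (hj : j ≠ z)
    (h : β ^ (j : ℕ) * (2 * p j + 1) < 2 * p z + 1) : ∃ l, IsOddEnd β lam z l ∧ l ≠ p := by
  have hz : Function.update p j (p j + 1) z = p z := Function.update_of_ne hj.symm ..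
  refine ⟨Function.update p j (p j + 1), ⟨update_pos hp (by omega), by rw [hz]; exact ho, ?_, ?_⟩,
    fun h => ?_⟩
  · rw [boxSum_update, hlam]
    push_cast
    linarith
  · rw [boxSum_update, hlam, hz]
    have : 0 ≤ β ^ (j : ℕ) * (2 * p j + 1) := by positivity
    push_cast
    linarith
  · have := congrFun h j
    rw [Function.update_self] at this
    omega

/-- Moving an entry two to the next coordinate. -/
theorem isOddEnd_move (hβ : 1 < β) (hp : ∀ j, 1 ≤ p j) (ho : p z % 2 = 1) {lam : ℝ}
    (hlam : lam = boxSum β p + 2 * p z + 1) {i j : Fin n} (hi : i ≠ z) (hj : j ≠ z)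
    (hij : (j : ℕ) = i + 1) (hpi : p i = 2) (hpj : p j = 1)
    (h : 3 * β ^ (i : ℕ) * (β - 1) < 2 * p z + 1) : ∃ l, IsOddEnd β lam z l ∧ l ≠ p := by
  have hne : j ≠ i := fun h => by rw [h] at hij; omega
  have hs : boxSum β (Function.update (Function.update p i 1) j 2) =
      boxSum β p + 3 * β ^ (i : ℕ) * (β - 1) := by
    rw [boxSum_update, boxSum_update, Function.update_of_ne hne, hpi, hpj, hij]
    push_cast
    ring
  have hz : Function.update (Function.update p i 1) j 2 z = p z := by
    rw [Function.update_of_ne hj.symm, Function.update_of_ne hi.symm]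
  refine ⟨Function.update (Function.update p i 1) j 2,
    ⟨update_pos (update_pos hp le_rfl) one_le_two, by rw [hz]; exact ho, ?_, ?_⟩,
    fun h => ?_⟩
  · rw [hs, hlam]; linarith
  · rw [hs, hlam, hz]
    have : 0 ≤ 3 * β ^ (i : ℕ) * (β - 1) :=
      mul_nonneg (by positivity) (by linarith)
    linarith
  · have := congrFun h j
    rw [Function.update_self, hpj] at this
    omega

theorem exists_isOddEnd_modify_large (hβ : 1 < β) (hβ2 : β ≤ 2) (hn : 2 ≤ n) (hz : (z : ℕ) = 0)
    (hp : ∀ j, 1 ≤ p j) (ho : p z % 2 = 1) (hx : 7 ≤ p z) {lam : ℝ}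
    (hlam : lam = boxSum β p + 2 * p z + 1)
    (hcost : boxSum β p = boxSum β (fun _ : Fin n => 1) + ((p z : ℝ) ^ 2 - 1) + δ)
    (hδ : δ ≤ 2 * p z + 3) : ∃ l, IsOddEnd β lam z l ∧ l ≠ p := by
  have hj : (⟨1, by omega⟩ : Fin n) ≠ z := fun h => by rw [← h] at hz; simp at hz
  have h1 := cost_entry_le hβ hp hz hcost hj
  refine isOddEnd_increase hβ hp ho hlam hj ?_
  rw [pow_one] at h1 ⊢
  exact increment_lt hβ hβ2 hx (h1.trans hδ)

/-- If the row ends at `1`, the bound on the cost leaves only one entry two, which can be moved. -/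
theorem exists_isOddEnd_modify_one (hβ : 1 < β) (hn : 3 ≤ n) (hβn : β ^ n = 4)
    (hz : (z : ℕ) = 0) (hp : ∀ j, 1 ≤ p j) (hx : p z = 1) (hne : ∃ j, j ≠ z ∧ p j ≠ 1) {lam : ℝ}
    (hlam : lam = boxSum β p + 2 * p z + 1)
    (hcost : boxSum β p = boxSum β (fun _ : Fin n => 1) + ((p z : ℝ) ^ 2 - 1) + δ)
    (hδ : δ ≤ 5) : ∃ l, IsOddEnd β lam z l ∧ l ≠ p := by
  have hβ2 := lt_of_pow_eq hβ hn hβn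
  obtain ⟨i, hi, hpi⟩ := hne
  have h2 : 2 ≤ p i := by have := hp i; omega
  have hβi : 1 ≤ β ^ (i : ℕ) := one_le_pow₀ hβ.le
  have h1 := cost_entry_le hβ hp hz hcost hi
  have hpi2 : p i = 2 := by
    by_contra h
    have : (3 : ℝ) ≤ p i := by exact_mod_cast (by omega : 3 ≤ p i)
    have h8 : (8 : ℝ) ≤ (p i : ℝ) ^ 2 - 1 := by nlinarith
    nlinarith
  rw [hpi2] at h1
  norm_num at h1
  -- since `β ^ (n - 1) ≥ 2`, the entry two is not in the last coordinate
  have hlt : (i : ℕ) + 1 < n := by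
    by_contra h
    have hin : n = i + 1 := by have := i.2; omega
    rw [hin, pow_succ] at hβn
    nlinarith
  have hj : (⟨i + 1, hlt⟩ : Fin n) ≠ z := fun h => by rw [← h] at hz; simp at hz
  have hij : i ≠ (⟨i + 1, hlt⟩ : Fin n) := fun h => by
    have := congrArg Fin.val h; simp only at this; omega
  have h3 := cost_pair_le hβ hp hz hcost hi hj hij
  refine isOddEnd_move hβ hp (by rw [hx]) hlam hi hj rfl hpi2 ?_ ?_
  · by_contra h
    have h4 : 2 ≤ p ⟨i + 1, hlt⟩ := by have := hp ⟨i + 1, hlt⟩; omega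
    have h5 : (2 : ℝ) ≤ p ⟨i + 1, hlt⟩ := by exact_mod_cast h4
    have h6 : (3 : ℝ) ≤ (p ⟨i + 1, hlt⟩ : ℝ) ^ 2 - 1 := by nlinarith
    have h7 : 1 ≤ β ^ ((⟨i + 1, hlt⟩ : Fin n) : ℕ) := one_le_pow₀ hβ.le
    rw [hpi2] at h3
    norm_num at h3 h7
    nlinarith
  · rw [hx]
    push_cast
    nlinarith

/-- If the row ends at `3` or `5`, the bound on the cost leaves few possibilities for the second and
third entries, and one of them can be increased, or an entry two can be moved. -/
theorem exists_isOddEnd_modify_three_five (hβ : 1 < β) (hn : 3 ≤ n) (hβn : β ^ n = 4)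
    (hz : (z : ℕ) = 0) (hp : ∀ j, 1 ≤ p j) (hx : p z = 3 ∨ p z = 5) {lam : ℝ}
    (hlam : lam = boxSum β p + 2 * p z + 1)
    (hcost : boxSum β p = boxSum β (fun _ : Fin n => 1) + ((p z : ℝ) ^ 2 - 1) + δ)
    (hδ : δ ≤ 2 * p z + 3) : ∃ l, IsOddEnd β lam z l ∧ l ≠ p := by
  have hβ2 := lt_of_pow_eq hβ hn hβn
  have ho : p z % 2 = 1 := by rcases hx with h | h <;> rw [h]
  have h1 : (⟨1, by omega⟩ : Fin n) ≠ z := fun h => by rw [← h] at hz; simp at hz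
  have h2 : (⟨2, by omega⟩ : Fin n) ≠ z := fun h => by rw [← h] at hz; simp at hz
  have h12 : (⟨1, by omega⟩ : Fin n) ≠ ⟨2, by omega⟩ := fun h => by
    have := congrArg Fin.val h; simp at this
  have c12 := cost_pair_le hβ hp hz hcost h1 h2 h12
  have inc1 := isOddEnd_increase hβ hp ho hlam h1
  have inc2 := isOddEnd_increase hβ hp ho hlam h2
  have move := isOddEnd_move hβ hp ho hlam h1 h2 rfl
  have p1 := hp ⟨1, by omega⟩
  have p2 := hp ⟨2, by omega⟩
  generalize p ⟨1, by omega⟩ = t at *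
  generalize p ⟨2, by omega⟩ = u at *
  simp only [pow_one] at c12 inc1 inc2 move
  have hβsq : 1 < β ^ 2 := one_lt_pow₀ hβ two_ne_zero
  have hu0 : 0 ≤ β ^ 2 * ((u : ℝ) ^ 2 - 1) := by
    have : (1 : ℝ) ≤ u := by exact_mod_cast p2
    exact mul_nonneg (by positivity) (by nlinarith)
  have hu2 : u ≠ 1 → 3 * β ^ 2 ≤ β ^ 2 * ((u : ℝ) ^ 2 - 1) := fun h => by
    have : (2 : ℝ) ≤ u := by exact_mod_cast (by omega : 2 ≤ u)
    have h3 : (3 : ℝ) ≤ (u : ℝ) ^ 2 - 1 := by nlinarith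
    rw [mul_comm]
    gcongr
  have ht : t ≤ 3 := by
    by_contra! h
    have h4 : (4 : ℝ) ≤ t := by exact_mod_cast h
    have h5 : (15 : ℝ) ≤ (t : ℝ) ^ 2 - 1 := by nlinarith
    have h6 : (15 : ℝ) < β * ((t : ℝ) ^ 2 - 1) := by nlinarith
    rcases hx with h | h <;> rw [h] at hδ <;> norm_num at hδ <;> linarith
  interval_cases t
  · apply inc1
    rcases hx with h | h <;> rw [h] <;> norm_num <;> linarith
  · by_cases hu : u = 1
    · apply move rfl hu
      rcases hx with h | h <;> rw [h] <;> norm_num <;> nlinarith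
    · apply inc1
      have h3 := hu2 hu
      rcases hx with h | h <;> rw [h] at hδ ⊢ <;> norm_num at hδ c12 ⊢ <;> nlinarith
  · by_cases hu : u = 1
    · apply inc2
      rw [hu]
      rcases hx with h | h <;> rw [h] at hδ ⊢ <;> norm_num at hδ c12 ⊢ <;> nlinarith
    · apply inc1
      have h3 := hu2 hu
      rcases hx with h | h <;> rw [h] at hδ ⊢ <;> norm_num at hδ c12 ⊢ <;> nlinarith

end Modify

/-! #### The second odd row -/

set_option synthInstance.maxSize 1000 in
theorem exists_odd_row_plane_small : ∀ a < 8, ∀ b < 8, (a % 2 = 1 ∧ 2 ≤ b ∧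
    (a + 1) ^ 2 + 2 * b ^ 2 ≤ 51 ∧ (a + 1) ^ 2 + 2 * b ^ 2 ≠ 24) →
    ∃ x < 8, x % 2 = 1 ∧ ∃ c < 8, c ≠ b ∧ 1 ≤ c ∧ x ^ 2 + 2 * c ^ 2 < (a + 1) ^ 2 + 2 * b ^ 2 ∧
      (a + 1) ^ 2 + 2 * b ^ 2 ≤ (x + 1) ^ 2 + 2 * c ^ 2 := by
  decide +kernel

theorem exists_isOddEnd_plane (hβ : β = 2) {z : Fin 2} (hz : (z : ℕ) = 0) {p : Fin 2 → ℕ}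
    (hp : ∀ j, 1 ≤ p j) (ho : p z % 2 = 1) {lam : ℝ} (hlam : lam = boxSum β p + 2 * p z + 1)
    (hp1 : p 1 ≠ 1) (h51 : lam ≤ 51) (h24 : lam ≠ 24) : ∃ l, IsOddEnd β lam z l ∧ l ≠ p := by
  obtain rfl : z = 0 := Fin.ext hz
  subst hβ
  have hsum : ∀ l : Fin 2 → ℕ, boxSum 2 l = ((l 0 ^ 2 + 2 * l 1 ^ 2 : ℕ) : ℝ) := fun l => by
    simp [boxSum]
  have hL : lam = (((p 0 + 1) ^ 2 + 2 * p 1 ^ 2 : ℕ) : ℝ) := by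
    rw [hlam, hsum]; push_cast; ring
  rw [hL] at h51 h24
  have h51' : (p 0 + 1) ^ 2 + 2 * p 1 ^ 2 ≤ 51 := by exact_mod_cast h51
  have h24' : (p 0 + 1) ^ 2 + 2 * p 1 ^ 2 ≠ 24 := by exact_mod_cast h24
  have b0 : p 0 < 8 := by nlinarith
  have b1 : p 1 < 8 := by nlinarith
  have hp1' := hp 1
  obtain ⟨x, -, hx, c, -, hcb, hc, h1, h2⟩ :=
    exists_odd_row_plane_small (p 0) b0 (p 1) b1 ⟨ho, by omega, h51', h24'⟩
  have hx1 : 1 ≤ x := by omega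
  refine ⟨![x, c], ⟨fun j => by fin_cases j <;> simp [hx1, hc], hx, ?_, ?_⟩, fun h => hcb ?_⟩
  · rw [hL, hsum]
    exact_mod_cast h1
  · rw [hL, hsum]
    have : (p 0 + 1) ^ 2 + 2 * p 1 ^ 2 ≤ (x ^ 2 + 2 * c ^ 2) + 2 * x + 1 := by
      have h3 : (x + 1) ^ 2 = x ^ 2 + 2 * x + 1 := by ring
      omega
    simp only [Matrix.cons_val_zero, Matrix.cons_val_one]
    exact_mod_cast this
  · rw [← h]; rfl

/-- Apart from the smallest even eigenvalue and one exception in the plane, a row with an odd end is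
accompanied by a second one. -/
theorem exists_second_isOddEnd (hβ : 1 < β) (hn : 2 ≤ n) (hβn : β ^ n = 4) {z : Fin n}
    (hz : (z : ℕ) = 0) {p : Fin n → ℕ} (hp : ∀ j, 1 ≤ p j) (ho : p z % 2 = 1) {lam : ℝ}
    (hlam : lam = boxSum β p + 2 * p z + 1) (hp1 : p ≠ fun _ => 1)
    (hexc : ¬ (n = 2 ∧ lam = 24)) : ∃ l, IsOddEnd β lam z l ∧ l ≠ p := by
  have hβ2 := le_two_of_pow_eq hβ hn hβn
  by_cases hone : ∀ j, j ≠ z → p j = 1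
  · -- the row of ones: the row `(2, 1, …, 1)` has the same length
    have hpz : 3 ≤ p z := by
      by_contra h
      refine hp1 (funext fun j => ?_)
      by_cases hj : j = z
      · rw [hj]; have := hp z; omega
      · exact hone j hj
    have hpz' : (3 : ℝ) ≤ p z := by exact_mod_cast hpz
    have hj : (⟨1, by omega⟩ : Fin n) ≠ z := fun h => by rw [← h] at hz; simp at hz
    refine isOddEnd_increase hβ hp ho hlam hj ?_
    rw [hone _ hj]
    norm_num
    linarith
  push Not at hone
  set C := boxSum β fun _ : Fin n => 1 with hC
  set D := boxSum β p - C - ((p z : ℝ) ^ 2 - 1) with hD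
  have hcost : boxSum β p = C + ((p z : ℝ) ^ 2 - 1) + D := by rw [hD]; ring
  have hDpos : 3 < D := by
    obtain ⟨j, hj, hpj⟩ := hone
    have h1 := cost_entry_le hβ hp hz hcost hj
    have h2 : (2 : ℝ) ≤ p j := by exact_mod_cast (by have := hp j; omega : 2 ≤ p j)
    have h3 : β ≤ β ^ (j : ℕ) := le_self_pow₀ hβ.le fun h => hj (Fin.ext (h.trans hz.symm))
    have h4 : (3 : ℝ) ≤ (p j : ℝ) ^ 2 - 1 := by nlinarith
    nlinarith
  -- the first row has length `k`, where `k ^ 2 < R ≤ (k + 1) ^ 2`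
  set R := ((p z : ℝ) + 1) ^ 2 + D with hR
  have hlamR : lam = C + (R - 1) := by rw [hlam, hcost, hR]; ring
  obtain ⟨k, hk1, hk2⟩ : ∃ k : ℕ, (k : ℝ) ^ 2 < R ∧ R ≤ ((k : ℝ) + 1) ^ 2 := by
    classical
    have hex : ∃ N : ℕ, R ≤ (N : ℝ) ^ 2 := by
      obtain ⟨N, hN⟩ := exists_nat_ge R
      refine ⟨N, hN.trans ?_⟩
      exact_mod_cast Nat.le_self_pow two_ne_zero N
    obtain ⟨k, hk⟩ : ∃ k, Nat.find hex = k + 1 := by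
      refine ⟨Nat.find hex - 1, ?_⟩
      have : Nat.find hex ≠ 0 := fun h0 => by
        have h := Nat.find_spec hex
        rw [h0] at h
        norm_num at h
        nlinarith
      omega
    refine ⟨k, not_le.1 (Nat.find_min hex (m := k) (by omega)), ?_⟩
    have := Nat.find_spec hex
    rw [hk] at this
    exact_mod_cast this
  have hpk : p z + 1 ≤ k := by
    by_contra! h
    have h1 : (k : ℝ) + 1 ≤ (p z : ℝ) + 1 := by exact_mod_cast h
    nlinarith [Nat.cast_nonneg (α := ℝ) k]
  rcases Nat.mod_two_eq_zero_or_one k with hkp | hkp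
  swap
  · -- the first row itself ends at an odd point
    obtain ⟨l, hl, hlz, hl1, hls⟩ := exists_row (β := β) z hz (x := k) (by omega)
    refine ⟨l, ⟨hl, by rw [hlz]; exact hkp, ?_, ?_⟩, fun h => ?_⟩
    · rw [hls, hlamR]; linarith
    · rw [hls, hlamR, hlz]; linarith
    · rw [h] at hlz
      omega
  obtain ⟨x, rfl⟩ : ∃ x, k = x + 1 := ⟨k - 1, by omega⟩
  have hxo : x % 2 = 1 := by omega
  push_cast at hk1 hk2
  set δ := R - ((x : ℝ) + 1) ^ 2 with hδ
  have hδ0 : 0 < δ := by rw [hδ]; linarith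
  have hδ1 : δ ≤ 2 * x + 3 := by rw [hδ]; linarith
  have hlamδ : lam = C + (((x : ℝ) + 1) ^ 2 - 1) + δ := by rw [hlamR, hδ]; ring
  by_cases hx7 : 7 ≤ x
  · by_cases hpx : p z = x
    · refine exists_isOddEnd_modify_large (δ := D) hβ hβ2 hn hz hp ho (by omega) hlam hcost ?_
      rw [hpx]
      rw [hδ, hR, hpx] at hδ1
      linarith
    · obtain ⟨l, hl, hlz⟩ := exists_isOddEnd_large hβ hβ2 hn hz hx7 hxo hlamδ hδ0 hδ1
      exact ⟨l, hl, fun h => hpx (by rw [← h, hlz])⟩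
  by_cases hn3 : n = 2
  · subst hn3
    have hβ' : β = 2 := by nlinarith
    refine exists_isOddEnd_plane hβ' hz hp ho hlam ?_ ?_ fun h => hexc ⟨rfl, h⟩
    · obtain ⟨j, hj, hpj⟩ := hone
      have : j = 1 := by omega
      rwa [← this]
    · have hx5 : (x : ℝ) ≤ 5 := by exact_mod_cast (by omega : x ≤ 5)
      have hC3 : C = 3 := by rw [hC, hβ']; norm_num [boxSum]
      rw [hlamδ, hC3]
      nlinarith
  have hn3' : 3 ≤ n := by omega
  have hpx' : p z ≤ x := by omega
  have hDδ : p z = x → D ≤ 2 * p z + 3 := fun h => by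
    rw [hδ, hR, h] at hδ1
    rw [h]
    linarith
  have hnew : (∃ l, IsOddEnd β lam z l ∧ l z = x) → p z ≠ x → ∃ l, IsOddEnd β lam z l ∧ l ≠ p := by
    rintro ⟨l, hl, hlz⟩ h
    exact ⟨l, hl, fun h' => h (by rw [← h', hlz])⟩
  obtain h | h | h : x = 1 ∨ x = 3 ∨ x = 5 := by omega
  · have hpz : p z = 1 := by have := hp z; omega
    refine exists_isOddEnd_modify_one (δ := D) hβ hn3' hβn hz hp hpz hone hlam hcost ?_
    have := hDδ (hpz.trans h.symm)
    rw [hpz] at this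
    norm_num at this
    exact this
  · by_cases hpx : p z = x
    · exact exists_isOddEnd_modify_three_five hβ hn3' hβn hz hp (Or.inl (hpx.trans h)) hlam hcost
        (hDδ hpx)
    · refine hnew ?_ hpx
      rw [h] at hlamδ hδ1 ⊢
      refine exists_isOddEnd_three hβ hn3' hβn hz ?_ hδ0 ?_
      · exact_mod_cast hlamδ
      · norm_num at hδ1; exact hδ1
  · by_cases hpx : p z = x
    · exact exists_isOddEnd_modify_three_five hβ hn3' hβn hz hp (Or.inr (hpx.trans h)) hlam hcost
        (hDδ hpx)
    · refine hnew ?_ hpx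
      rw [h] at hlamδ hδ1 ⊢
      refine exists_isOddEnd_five hβ hn3' hβn hz ?_ hδ0 ?_
      · exact_mod_cast hlamδ
      · norm_num at hδ1; exact hδ1

end BoxRows

/-! ### Positivity of the nodal deficiency -/

namespace RepTile

theorem box_eigenvalue_eq (n : ℕ) (hn : 2 ≤ n) (m : Fin n → ℕ) :
    (box n hn).eigenvalue m = boxSum ((box n hn).γ ^ 2) m := by
  refine Finset.sum_congr rfl fun j _ => ?_
  ring

theorem one_lt_box_γ_sq (n : ℕ) (hn : 2 ≤ n) : 1 < (box n hn).γ ^ 2 := by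
  refine one_lt_pow₀ ?_ two_ne_zero
  by_contra! h
  have h1 := box_γ_pow n hn
  have h2 := pow_le_one₀ (n := n) (box n hn).γ_pos.le h
  linarith

theorem box_γ_sq_pow (n : ℕ) (hn : 2 ≤ n) : ((box n hn).γ ^ 2) ^ n = 4 := by
  rw [← pow_mul, mul_comm, pow_mul, box_γ_pow]
  norm_num

theorem box_eigenvalue_step (n : ℕ) (hn : 2 ≤ n) (m : Fin n → ℕ) :
    (box n hn).eigenvalue ((box n hn).step m) =
      boxSum ((box n hn).γ ^ 2) m + 2 * m ⟨0, by omega⟩ + 1 := by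
  refine (box_eigenvalue_eq n hn _).trans ((boxSum_update m ⟨0, by omega⟩ _).trans ?_)
  change _ + ((box n hn).γ ^ 2) ^ 0 * (((m ⟨0, by omega⟩ + 1 : ℕ) : ℝ) ^ 2 - _) = _
  push_cast
  ring

theorem mem_boundary_of_isOddEnd {n : ℕ} {hn : 2 ≤ n} {lam : ℝ} {l : Fin n → ℕ}
    (hl : IsOddEnd ((box n hn).γ ^ 2) lam ⟨0, by omega⟩ l) :
    l ∈ (box n hn).rightBoundary ((box n hn).quantumNumbersBelow lam) ∩ (box n hn).oddNumbers := by
  obtain ⟨h1, h2, h3, h4⟩ := hl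
  exact ⟨⟨⟨h1, (box_eigenvalue_eq n hn l).trans_lt h3⟩, fun h =>
    h4.not_gt ((box_eigenvalue_step n hn l).symm.trans_lt h.2)⟩, h1, h2⟩

/-- The smallest even eigenvalue of the box belongs to `(2, 1, …, 1)`. -/
theorem isLeast_evenSpectrum_box (n : ℕ) (hn : 2 ≤ n) :
    IsLeast (box n hn).evenSpectrum
      ((box n hn).eigenvalue ((box n hn).step fun _ => 1)) := by
  refine ⟨⟨_, (box n hn).step_mem_evenNumbers ⟨fun _ => le_rfl, rfl⟩, rfl⟩, ?_⟩
  rintro _ ⟨m, hm, rfl⟩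
  obtain ⟨l, hl, rfl⟩ := (box n hn).exists_step_eq_of_mem_evenNumbers hm
  have h1 : ∀ j, 1 ≤ l j := hl.1
  have hγ := (box n hn).γ_pos
  refine Finset.sum_le_sum fun j _ => ?_
  gcongr
  by_cases hj : j = (box n hn).first
  · rw [hj, step_first, step_first]
    exact Nat.succ_le_succ (h1 _)
  · exact (step_of_ne (box n hn) (fun _ => 1) hj).trans_le
      ((h1 j).trans_eq (step_of_ne (box n hn) l hj).symm)

theorem two_le_oddBoundaryCount_box {n : ℕ} {hn : 2 ≤ n} {lam : ℝ}
    (hlam : lam ∈ (box n hn).evenSpectrum) (hne : ¬ IsLeast (box n hn).evenSpectrum lam)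
    (hexc : ¬ (n = 2 ∧ lam = 24)) : 2 ≤ (box n hn).oddBoundaryCount lam := by
  obtain ⟨m, hm, rfl⟩ := hlam
  obtain ⟨p, hp, rfl⟩ := (box n hn).exists_step_eq_of_mem_evenNumbers hm
  have hp1 : p ≠ fun _ => 1 := fun h => hne (h ▸ isLeast_evenSpectrum_box n hn)
  have hstep := box_eigenvalue_step n hn p
  have hend : IsOddEnd ((box n hn).γ ^ 2) ((box n hn).eigenvalue ((box n hn).step p))
      ⟨0, (by omega : 0 < n)⟩ p :=
    ⟨hp.1, hp.2, (box_eigenvalue_eq n hn p).symm.trans_lt ((box n hn).eigenvalue_lt_step p),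
      hstep.le⟩
  obtain ⟨l, hl, hlp⟩ := exists_second_isOddEnd (one_lt_box_γ_sq n hn) hn (box_γ_sq_pow n hn)
    (z := ⟨0, (by omega : 0 < n)⟩) rfl hp.1 hp.2 hstep hp1 hexc
  exact two_le_oddBoundaryCount _ (mem_boundary_of_isOddEnd hl) (mem_boundary_of_isOddEnd hend) hlp

theorem two_le_oddBoundaryCount_of_not_isLeast (T : RepTile) {lam : ℝ}
    (hlam : lam ∈ T.evenSpectrum) (hne : ¬ IsLeast T.evenSpectrum lam)
    (hexc : ¬ (T = box 2 (le_refl 2) ∧ lam = 24)) : 2 ≤ T.oddBoundaryCount lam := by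
  cases T with
  | triangle => exact two_le_oddBoundaryCount_triangle hlam hne
  | box n hn =>
    refine two_le_oddBoundaryCount_box hlam hne ?_
    rintro ⟨rfl, h⟩
    exact hexc ⟨rfl, h⟩

theorem nodalDeficiency_pos_of_two_le (T : RepTile) {lam : ℝ} (hlam : lam ∈ T.evenSpectrum)
    (h : 2 ≤ T.oddBoundaryCount lam) : 0 < nodalDeficiency T.domain lam := by
  obtain ⟨-, -, h0, h1⟩ := T.nodalDeficiency_recursion hlam
  omega

theorem box_two_eigenvalue (m : Fin 2 → ℕ) :
    (box 2 le_rfl).eigenvalue m = (m 0 : ℝ) ^ 2 + 2 * (m 1 : ℝ) ^ 2 := by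
  rw [box_eigenvalue_eq, box_γ_pow, boxSum, Fin.sum_univ_two]
  simp

/-- The exceptional eigenvalue `24` of the rectangle inherits a positive deficiency from the
eigenvalue `12`, which belongs to `(2, 2)`. -/
theorem nodalDeficiency_box_two_pos (h24 : (24 : ℝ) ∈ (box 2 le_rfl).evenSpectrum) :
    0 < nodalDeficiency (box 2 le_rfl).domain 24 := by
  have e12 : (box 2 le_rfl).eigenvalue (fun _ : Fin 2 => 2) = 12 := by
    rw [box_two_eigenvalue]; norm_num
  have e6 : (box 2 le_rfl).eigenvalue (![2, 1] : Fin 2 → ℕ) = 6 := by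
    rw [box_two_eigenvalue]; norm_num
  have h12 : (12 : ℝ) ∈ (box 2 le_rfl).evenSpectrum :=
    ⟨fun _ : Fin 2 => 2, ⟨fun _ => one_le_two, rfl⟩, e12⟩
  have h6 : (6 : ℝ) ∈ (box 2 le_rfl).evenSpectrum :=
    ⟨(![2, 1] : Fin 2 → ℕ), ⟨fun j => by fin_cases j <;> simp, rfl⟩, e6⟩
  have hB : 2 ≤ (box 2 le_rfl).oddBoundaryCount 12 := by
    refine two_le_oddBoundaryCount_box h12 (fun h => ?_) (by norm_num)
    have := h.2 h6
    norm_num at this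
  have hpos := nodalDeficiency_pos_of_two_le _ h12 hB
  obtain ⟨-, -, -, h1⟩ := nodalDeficiency_recursion _ h24
  have h2 := one_le_oddBoundaryCount _ h24
  have h3 : ((box 2 le_rfl).γ ^ 2)⁻¹ * 24 = 12 := by
    rw [box_γ_pow]; norm_num
  rw [h3] at h1
  omega

end RepTile

end RepTileNodal

end

open RepTileNodal in
theorem mainTheorem5 (T : RepTile) (lam : ℝ) (hlam : lam ∈ T.evenSpectrum) :
    DeficiencyWellDefined T.domain lam ∧
    DeficiencyWellDefined T.domain ((T.γ ^ 2)⁻¹ * lam) ∧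
    nodalDeficiency T.domain lam =
      2 * nodalDeficiency T.domain ((T.γ ^ 2)⁻¹ * lam) + (T.oddBoundaryCount lam : ℤ) - 1 ∧
    1 ≤ T.oddBoundaryCount lam ∧
    (¬ IsLeast T.evenSpectrum lam → ¬ (T = RepTile.box 2 (le_refl 2) ∧ lam = 24) →
      2 ≤ T.oddBoundaryCount lam) ∧
    (¬ IsLeast T.evenSpectrum lam → ¬ IsCourantSharp T.domain lam) := by
  obtain ⟨h1, h2, -, h3⟩ := T.nodalDeficiency_recursion hlam
  refine ⟨h1, h2, h3, T.one_le_oddBoundaryCount hlam,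
    T.two_le_oddBoundaryCount_of_not_isLeast hlam, fun hne => T.not_isCourantSharp hlam ?_⟩
  by_cases hexc : T = RepTile.box 2 (le_refl 2) ∧ lam = 24
  · obtain ⟨rfl, rfl⟩ := hexc
    exact RepTile.nodalDeficiency_box_two_pos hlam
  · exact T.nodalDeficiency_pos_of_two_le hlam
      (T.two_le_oddBoundaryCount_of_not_isLeast hlam hne hexc)
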